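/- Let $\alpha\in(0,1)$, $T>0$, $K(x)=|x|^{-1-\alpha}$ on $\mathbb R^2$, $(a,b)^\perp=(-b,a)$, $\nabla^\perp=(-\partial_{x^2},\partial_{x^1})$, $\mathbb T=\mathbb R/\mathbb Z$. **Equation.** A weak solution on $(0,T)$ of $\partial_t\theta+u\cdot\nabla\theta=0$, $u=\nabla^\perp(K*\theta)$, is a function $\theta\in L^2(0,T;L^2(\mathbb R^2))$ with $u\in L^2(0,T;L^2(\mathbb R^2;\mathbb R^2))$ and $\int_0^T\int_{\mathbb R^2}\theta\,\partial_t\phi+\theta\,u\cdot\nabla\phi\,dx\,dt=0$ for all $\phi\in C_c^\infty((0,T)\times\mathbb R^2)$. **Compatible curves.** Let $(\theta_\delta)$ be a family of functions on $(0,T)\times\mathbb R^2$. A family of moving closed curves $z=z_\delta(s,t)$, $s\in\mathbb T$, $t\in(0,T)$, is compatible with $(\theta_\delta)$ if there are constants $C,B$ such that for all sufficiently small $\delta>0$: $z$ is $C^1$ in $(s,t)$; for each $t\in(0,T)$ the curve $z(\cdot,t)$ is a simple closed $C^2$ curve, parametrised counter-clockwise with uniform speed, of length and curvature at most $B$, bounding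 a bounded simply connected region $A(t)$; and there is $C^z\in(0,C)$ such that, for every $t\in(0,T)$, $\theta_\delta(\cdot,t)=1$ on $A_{\rm in}(t)=\{x\in A(t):\operatorname{dist}(x,\partial A(t))>C^z\delta\}$ and $\theta_\delta(\cdot,t)=0$ off $A_{\rm in}(t)\cup A_{\rm mid}(t)$, where $A_{\rm mid}(t)=\{x:\operatorname{dist}(x,\partial A(t))\le C^z\delta\}$. **Almost-sharp fronts.** $(\theta_\delta)$ is an almost-sharp front solution if, for all sufficiently small $\delta>0$, $\theta_\delta$ is a weak solution on $(0,T)$, $\theta_\delta(\cdot,t)\in C^2(\mathbb R^2)$ and $\|\nabla\theta_\delta(\cdot,t)\|_{L^\infty}\le G/\delta$ for all $t\in(0,T)$, with $G$ independent of $\delta$ and $t$, and if it has a compatible family of curves. **Theorem.** Let $(\theta_\delta)$ be an almost-sharp front solution and $z=z_\delta$ any compatible curve, and let $N=(\partial_s z)^\perp$. Then $z$ satisfies the sharp-front equation $$\partial_t z\cdot N=\Big(-\int_{\mathbb T}K(z-z_*)(\partial_s z_*-\partial_s z)\,ds_*\Big)\cdot N+O(\delta^{1-\alpha})$$ in the weak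 sense. That is, for all sufficiently small $\delta$ the integral over $s_*$ converges absolutely for all $(s,t)$, and for every $\phi\in C_c^\infty((0,T)\times\mathbb R^2)$, as $\delta\to0^+$, $$\int_0^T\int_{\mathbb T}\phi(z(s,t),t)\Big[\partial_t z+\int_{\mathbb T}K(z-z_*)(\partial_s z_*-\partial_s z)\,ds_*\Big]\cdot N\,ds\,dt=O(\delta^{1-\alpha}),$$ where the integrand on the left is integrable over $\mathbb T\times(0,T)$ for all sufficiently small $\delta$, and the implied constant may depend on $\phi$ and on the families but not on $\delta$. Here $z=z(s,t)$ and $z_*=z(s_*,t)$. -/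

import Mathlib

open MeasureTheory Set Filter Topology
open scoped ContDiff

noncomputable section

namespace AlmostSharpFront

/-- The plane `ℝ²` with its Euclidean norm. -/
abbrev Plane : Type := EuclideanSpace ℝ (Fin 2)

/-- Counter-clockwise rotation by `90` degrees, `(a, b) ↦ (-b, a)`. -/
def perp (x : Plane) : Plane := !₂[-(x 1), x 0]

/-- The kernel `K(x) = |x|^{-1-α}`. -/
def kernelK (α : ℝ) (x : Plane) : ℝ := ‖x‖ ^ (-1 - α)

/-- The operator `Λ^{-1+α}`, that is, convolution with `K`. -/
def potential (α : ℝ) (f : Plane → ℝ) (x : Plane) : ℝ :=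
  ∫ y, kernelK α (x - y) * f y

/-- The velocity `u = ∇^⊥ Λ^{-1+α} f = ∇^⊥ (K * f)`, where `∇^⊥ = (-∂₂, ∂₁)`. -/
def velocity (α : ℝ) (f : Plane → ℝ) (x : Plane) : Plane :=
  perp (gradient (potential α f) x)

/-- Test functions `φ ∈ C_c^∞((0,T) × ℝ²)`, written `φ t x`. -/
structure IsTestFunction (T : ℝ) (φ : ℝ → Plane → ℝ) : Prop where
  smooth : ContDiff ℝ ∞ (fun p : ℝ × Plane => φ p.1 p.2)
  compact : HasCompactSupport (fun p : ℝ × Plane => φ p.1 p.2)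
  support : tsupport (fun p : ℝ × Plane => φ p.1 p.2) ⊆ Ioo 0 T ×ˢ univ

/-- `θ` (written `θ t x`) is a weak solution on `(0,T) × ℝ²` of
`∂_t θ + u · ∇θ = 0`, `u = ∇^⊥ K * θ`. -/
structure IsWeakSolution (α T : ℝ) (θ : ℝ → Plane → ℝ) : Prop where
  memLp : MemLp (fun p : ℝ × Plane => θ p.1 p.2) 2 (volume.restrict (Ioo 0 T ×ˢ univ))
  memLp_velocity : MemLp (fun p : ℝ × Plane => velocity α (θ p.1) p.2) 2
    (volume.restrict (Ioo 0 T ×ˢ univ))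
  weak : ∀ φ : ℝ → Plane → ℝ, IsTestFunction T φ →
    ∫ p in Ioo (0 : ℝ) T ×ˢ (univ : Set Plane),
      (θ p.1 p.2 * deriv (fun τ => φ τ p.2) p.1
        + θ p.1 p.2 * inner ℝ (velocity α (θ p.1) p.2) (gradient (φ p.1) p.2)) = 0

/-- `γ`, a `1`-periodic function on `ℝ`, is a simple closed `C²` curve parametrised with uniform
speed and counter-clockwise, and it bounds the bounded simply connected open region `A`.
The orientation says that `A` lies, locally, exactly on the side of the curve to which the
normal `(∂_s γ)^⊥` points. -/
structure Bounds (γ : ℝ → Plane) (A : Set Plane) : Prop where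
  periodic : Function.Periodic γ 1
  contDiff : ContDiff ℝ 2 γ
  injOn : InjOn γ (Ico 0 1)
  uniform_speed : ∃ L : ℝ, 0 < L ∧ ∀ s, ‖deriv γ s‖ = L
  isOpen : IsOpen A
  isBounded : Bornology.IsBounded A
  simplyConnected : SimplyConnectedSpace A
  frontier_eq : frontier A = range γ
  inward_normal : ∀ s, ∀ᶠ ε : ℝ in 𝓝[>] 0,
    γ s + ε • perp (deriv γ s) ∈ A ∧ γ s - ε • perp (deriv γ s) ∉ A

/-- The transition region: points at distance at most `r` from `∂A`. -/
def midRegion (A : Set Plane) (r : ℝ) : Set Plane := {x | Metric.infDist x (frontier A) ≤ r}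

/-- The inner region: points of `A` at distance more than `r` from `∂A`. -/
def inRegion (A : Set Plane) (r : ℝ) : Set Plane := {x ∈ A | r < Metric.infDist x (frontier A)}

/-- The outer region. -/
def outRegion (A : Set Plane) (r : ℝ) : Set Plane := (inRegion A r ∪ midRegion A r)ᶜ

/-- A family `z` (written `z δ t s`) of moving closed curves is compatible with the family `θ`
(written `θ δ t x`): for all small `δ > 0`, at each time `t ∈ (0,T)` the curve `z δ t` bounds a
simply connected region `A t`, and `θ δ t` is `1` in the inner and `0` in the outer region,
the transition region having half-width `Cz * δ` with `0 < Cz < C` and `C` independent of `δ`.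
The curves are `C²` in `s` uniformly (length and curvature are bounded independently
of `δ` and `t`; for a curve with uniform speed `L` the curvature has absolute value
`‖∂_s² z‖ / L²`), and `C¹` in `(t, s)`, so that `∂_t z` makes sense. -/
def IsCompatibleCurve (T : ℝ) (θ : ℝ → ℝ → Plane → ℝ) (z : ℝ → ℝ → ℝ → Plane) : Prop :=
  ∃ C B : ℝ, ∀ᶠ δ : ℝ in 𝓝[>] 0, ∃ Cz : ℝ, 0 < Cz ∧ Cz < C ∧ ∃ A : ℝ → Set Plane,
    ContDiffOn ℝ 1 (fun p : ℝ × ℝ => z δ p.1 p.2) (Ioo 0 T ×ˢ univ) ∧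
    ∀ t ∈ Ioo 0 T,
      Bounds (z δ t) (A t) ∧
      (∀ s, ‖deriv (z δ t) s‖ ≤ B) ∧
      (∀ s, ‖deriv (deriv (z δ t)) s‖ ≤ B * ‖deriv (z δ t) s‖ ^ 2) ∧
      (∀ x ∈ inRegion (A t) (Cz * δ), θ δ t x = 1) ∧
      (∀ x ∈ outRegion (A t) (Cz * δ), θ δ t x = 0)

/-- An almost-sharp front on the time interval `(0,T)`: a family `θ δ` of solutions, `C²` in `x`,
with `‖∇θ‖_{L^∞} ≲ 1/δ`, that has the geometry described by some compatible curve. -/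
structure IsAlmostSharpFront (α T : ℝ) (θ : ℝ → ℝ → Plane → ℝ) : Prop where
  solution : ∀ᶠ δ : ℝ in 𝓝[>] 0, IsWeakSolution α T (θ δ)
  contDiff : ∀ᶠ δ : ℝ in 𝓝[>] 0, ∀ t ∈ Ioo 0 T, ContDiff ℝ 2 (θ δ t)
  growth : ∃ G : ℝ, ∀ᶠ δ : ℝ in 𝓝[>] 0, ∀ t ∈ Ioo 0 T, ∀ x, ‖gradient (θ δ t) x‖ ≤ G / δ
  exists_curve : ∃ z : ℝ → ℝ → ℝ → Plane, IsCompatibleCurve T θ z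

/-- The integrand `K(z - z_*) (∂_s z_* - ∂_s z)` as a function of `s_*`, for a fixed curve `γ`
and a fixed parameter `s`. -/
def frontIntegrand (α : ℝ) (γ : ℝ → Plane) (s s' : ℝ) : Plane :=
  kernelK α (γ s - γ s') • (deriv γ s' - deriv γ s)

/-- `𝓘(γ)(s) = ∫_𝕋 K(z - z_*) (∂_s z_* - ∂_s z) ds_*`. -/
def frontIntegral (α : ℝ) (γ : ℝ → Plane) (s : ℝ) : Plane :=
  ∫ s' in (-1 / 2 : ℝ)..(1 / 2), frontIntegrand α γ s s'

/-- The defect `∂_t z · N - (-𝓘(z)) · N` of a moving curve `z` (written `z t s`) in the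
sharp-front equation, with normal `N = (∂_s z)^⊥`. -/
def frontDefect (α : ℝ) (z : ℝ → ℝ → Plane) (t s : ℝ) : ℝ :=
  inner ℝ (deriv (fun τ => z τ s) t) (perp (deriv (z t) s))
    - inner ℝ (-frontIntegral α (z t) s) (perp (deriv (z t) s))

end AlmostSharpFront

end

/-! ### Plane geometry and change of variables -/

namespace AlmostSharpFront

/-! Test the equation for $\theta=\theta_\delta$ against $\phi$ and replace $\theta$ by $1_A$. Each
of the two terms changes by at most a constant times $\|\theta-1_A\|_{L^1}$, and for $1_A$ they are
exactly the two boundary integrals of the sharp-front equation.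

Time term: $\int\!\int_A\partial_t\phi=\int\!\oint\phi\,\partial_tz\cdot N$, because $N$ points
inwards (`integral_transport`).

Flux term: formally $\int\theta u\cdot\nabla\phi$ is the quadratic form
$\iint\theta(x)\theta(y)\nabla^\perp K(x-y)\cdot\nabla\phi(x)$. Since $\nabla K$ is odd,
$\nabla\phi(x)$ may be replaced by $(\nabla\phi(x)-\nabla\phi(y))/2$. The kernel is then of size
$|x-y|^{-1-\alpha}$ near the diagonal and $|x-y|^{-2-\alpha}$ away from it, which is integrable for
$0<\alpha<1$. So the form is Lipschitz in $L^1$ on functions bounded by $M$ (`abs_regForm_sub_le`).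
On $1_A$ two uses of the divergence theorem (`Bounds.integral_fderiv_eq`) give a double boundary
integral of $K(z-z_*)\,\partial_sz_*\cdot N$; as $\partial_sz\cdot N=0$, one may subtract
$\partial_sz$, which makes it converge (`Bounds.regForm_indicator`). As $\nabla K$ is not locally
integrable, all this is done for $(|x|^2+\varepsilon^2)^{-(1+\alpha)/2}$ with constants free of
$\varepsilon$, and $\varepsilon\to0$ at fixed $\delta$ (`tendsto_regForm`,
`tendsto_regForm_indicator`).

Size: $\theta-1_A$ lives in the transition region, whose area is $O(\delta)$
(`Bounds.volume_midRegion_le`). The bound $M$ on $\theta$ is derived: every point is within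
$O(\delta)$ of a point outside that region (`Bounds.exists_notMem_midRegion`), where
$\theta\in\{0,1\}$, and $|\nabla\theta|\le G/\delta$.

The error obtained is $O(\delta)$, which is stronger than $O(\delta^{1-\alpha})$. The arc-chord
constant of the curves may degenerate as $\delta\to0$; it serves only for integrability and limits
and never enters the error. -/

/-- The determinant of two plane vectors. -/
noncomputable def cross (a b : Plane) : ℝ := a 0 * b 1 - a 1 * b 0

lemma inner_plane (a b : Plane) : inner ℝ a b = a 0 * b 0 + a 1 * b 1 := by
  simp [PiLp.inner_apply, Fin.sum_univ_two, mul_comm]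

@[simp] lemma perp_zero_coord (x : Plane) : perp x 0 = -(x 1) := rfl
@[simp] lemma perp_one_coord (x : Plane) : perp x 1 = x 0 := rfl

lemma inner_perp_eq_cross (a b : Plane) : inner ℝ b (perp a) = cross a b := by
  rw [inner_plane, cross]; simp; ring

/-- Cramer's rule. In `Bounds.exists_isOpen_green` it expands a fixed direction in the frame of the
chart, which puts the pulled-back derivative in divergence form. -/
lemma cross_smul_eq (a b v : Plane) : cross a b • v = cross v b • a + cross a v • b := by
  ext i; fin_cases i <;> simp [cross] <;> ring

lemma cross_perp_self (a : Plane) : cross a (perp a) = ‖a‖ ^ 2 := by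
  rw [← real_inner_self_eq_norm_sq, inner_plane]; simp [cross]

/-- Counter-clockwise rotation as a linear isometry. -/
noncomputable def perpL : Plane →ₗᵢ[ℝ] Plane where
  toFun := perp
  map_add' x y := by ext i; fin_cases i <;> simp [perp]; ring
  map_smul' c x := by ext i; fin_cases i <;> simp [perp]
  norm_map' x := by
    simp only [LinearMap.coe_mk, AddHom.coe_mk, EuclideanSpace.norm_eq, Fin.sum_univ_two,
      perp_zero_coord, perp_one_coord, norm_neg]
    rw [add_comm]

@[simp] lemma norm_perp (x : Plane) : ‖perp x‖ = ‖x‖ := perpL.norm_map x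
lemma continuous_perp : Continuous perp := perpL.continuous

/-- The identification of `ℝ × ℝ` with the plane. -/
noncomputable def planeEquiv : (ℝ × ℝ) ≃L[ℝ] Plane :=
  LinearEquiv.toContinuousLinearEquiv
    { toFun := fun p => !₂[p.1, p.2]
      invFun := fun x => (x 0, x 1)
      map_add' := fun x y => by ext i; fin_cases i <;> simp
      map_smul' := fun c x => by ext i; fin_cases i <;> simp
      left_inv := fun p => by simp
      right_inv := fun x => by ext i; fin_cases i <;> simp }

@[simp] lemma planeEquiv_zero_coord (p : ℝ × ℝ) : planeEquiv p 0 = p.1 := rfl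
@[simp] lemma planeEquiv_one_coord (p : ℝ × ℝ) : planeEquiv p 1 = p.2 := rfl

lemma measurePreserving_planeEquiv : MeasurePreserving planeEquiv := by
  have h1 : MeasurePreserving (@WithLp.toLp 2 (Fin 2 → ℝ)) := PiLp.volume_preserving_toLp (Fin 2)
  have h2 := (volume_preserving_finTwoArrow ℝ).symm
  have h3 := h1.comp h2
  have he : ⇑planeEquiv = WithLp.toLp 2 ∘ ⇑MeasurableEquiv.finTwoArrow.symm := by
    funext p
    ext i
    fin_cases i <;> rfl
  rw [he]
  exact h3

lemma det_plane (L : Plane →L[ℝ] Plane) :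
    L.det = cross (L (planeEquiv (1, 0))) (L (planeEquiv (0, 1))) := by
  have h : L.det = LinearMap.det (L : Plane →ₗ[ℝ] Plane) := rfl
  have e0 : planeEquiv (1, 0) = EuclideanSpace.single 0 1 := by
    ext i; fin_cases i <;> simp
  have e1 : planeEquiv (0, 1) = EuclideanSpace.single 1 1 := by
    ext i; fin_cases i <;> simp
  rw [h, ← LinearMap.det_toMatrix (EuclideanSpace.basisFun (Fin 2) ℝ).toBasis,
    Matrix.det_fin_two, e0, e1]
  simp [LinearMap.toMatrix_apply, cross]
  ring

/-- The parameter domain is carried to the plane by the measure-preserving `planeEquiv`; the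
Jacobian of the resulting self-map of the plane is the cross product of the two partial derivatives.
-/
lemma setIntegral_image_plane {S : Set (ℝ × ℝ)} (hS : MeasurableSet S) {g : ℝ × ℝ → Plane}
    {g' : ℝ × ℝ → (ℝ × ℝ) →L[ℝ] Plane} (hg : ∀ p ∈ S, HasFDerivAt g (g' p) p)
    (hinj : InjOn g S) (F : Plane → ℝ) :
    ∫ x in g '' S, F x = ∫ p in S, |cross (g' p (1, 0)) (g' p (0, 1))| * F (g p) := by
  have hS' : MeasurableSet (planeEquiv.symm ⁻¹' S) :=
    planeEquiv.symm.continuous.measurable hS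
  have himg : g '' S = (fun x => g (planeEquiv.symm x)) '' (planeEquiv.symm ⁻¹' S) := by
    ext x; constructor
    · rintro ⟨p, hp, rfl⟩
      exact ⟨planeEquiv p, by simpa using hp, by simp⟩
    · rintro ⟨y, hy, rfl⟩
      exact ⟨_, hy, rfl⟩
  rw [himg, integral_image_eq_integral_abs_det_fderiv_smul volume hS'
    (f' := fun x => (g' (planeEquiv.symm x)).comp (planeEquiv.symm : Plane →L[ℝ] ℝ × ℝ))]
  · have hpre : S = planeEquiv ⁻¹' (planeEquiv.symm ⁻¹' S) := by
      ext p; simp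
    conv_rhs => rw [hpre]
    rw [← measurePreserving_planeEquiv.setIntegral_preimage_emb
      planeEquiv.toHomeomorph.measurableEmbedding]
    simp only [det_plane, ContinuousLinearMap.comp_apply, ContinuousLinearEquiv.coe_coe,
      ContinuousLinearEquiv.symm_apply_apply, smul_eq_mul]
  · intro x hx
    exact ((hg _ hx).comp x planeEquiv.symm.hasFDerivAt).hasFDerivWithinAt
  · intro x hx y hy hxy
    exact planeEquiv.symm.injective (hinj hx hy hxy)

/-! ### Closed curves: periodicity and injectivity modulo integers -/

namespace Bounds

variable {γ : ℝ → Plane} {A : Set Plane}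

lemma contDiff_one (h : Bounds γ A) : ContDiff ℝ 1 γ := h.contDiff.of_le (by norm_num)

lemma differentiable (h : Bounds γ A) : Differentiable ℝ γ :=
  h.contDiff.differentiable (by norm_num)

lemma hasDerivAt (h : Bounds γ A) (s : ℝ) : HasDerivAt γ (deriv γ s) s :=
  (h.differentiable s).hasDerivAt

lemma continuous_deriv (h : Bounds γ A) : Continuous (deriv γ) :=
  h.contDiff.continuous_deriv (by norm_num)

lemma deriv_ne_zero (h : Bounds γ A) (s : ℝ) : deriv γ s ≠ 0 := by
  obtain ⟨L, hL, hs⟩ := h.uniform_speed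
  rw [← norm_pos_iff, hs s]; exact hL

lemma periodic_deriv (h : Bounds γ A) : Function.Periodic (deriv γ) 1 := by
  intro s
  rw [← deriv_comp_add_const]
  congr 1
  ext1 x
  exact h.periodic x

lemma exists_int_of_eq (h : Bounds γ A) {s s' : ℝ} (hs : γ s = γ s') : ∃ n : ℤ, s = s' + n := by
  have key : ∀ x, γ (Int.fract x) = γ x := fun x => by
    have := h.periodic.sub_int_mul_eq (x := x) ⌊x⌋
    rwa [mul_one] at this
  have h1 : Int.fract s = Int.fract s' :=
    h.injOn ⟨Int.fract_nonneg s, Int.fract_lt_one s⟩ ⟨Int.fract_nonneg s', Int.fract_lt_one s'⟩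
      (by rw [key, key, hs])
  obtain ⟨n, hn⟩ := Int.fract_eq_fract.1 h1
  exact ⟨n, by rw [← hn]; ring⟩

lemma eq_of_abs_sub_lt (h : Bounds γ A) {s s' : ℝ} (hs : γ s = γ s') (hlt : |s - s'| < 1) :
    s = s' := by
  obtain ⟨n, hn⟩ := h.exists_int_of_eq hs
  have : |(n : ℝ)| < 1 := by rwa [hn, add_sub_cancel_left] at hlt
  have : n = 0 := by
    have h2 : |n| < 1 := by exact_mod_cast this
    exact Int.abs_lt_one_iff.1 h2
  simpa [this] using hn

lemma exists_eq_abs_sub_le (h : Bounds γ A) (s s₀ : ℝ) : ∃ s', γ s' = γ s ∧ |s' - s₀| ≤ 1 / 2 := by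
  refine ⟨s - round (s - s₀), ?_, ?_⟩
  · have := h.periodic.sub_int_mul_eq (x := s) (round (s - s₀))
    rwa [mul_one] at this
  · have := abs_sub_round (s - s₀)
    rwa [show s - round (s - s₀) - s₀ = s - s₀ - round (s - s₀) by ring]

lemma disjoint_range (h : Bounds γ A) (s : ℝ) : γ s ∉ A := by
  have : γ s ∈ frontier A := h.frontier_eq ▸ mem_range_self s
  rw [h.isOpen.frontier_eq] at this
  exact this.2

end Bounds

/-! ### Charts along the curve with a fixed transversal direction -/

/-- The local coordinates `(s, ρ) ↦ γ(s) + ρ w` near a curve. -/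
noncomputable def curveChart (γ : ℝ → Plane) (w : Plane) (p : ℝ × ℝ) : Plane := γ p.1 + p.2 • w

section Chart

variable {γ : ℝ → Plane} {A : Set Plane}

lemma curveChart_contDiff (hγ : ContDiff ℝ 1 γ) (w : Plane) : ContDiff ℝ 1 (curveChart γ w) := by
  unfold curveChart
  exact (hγ.comp contDiff_fst).add (contDiff_snd.smul contDiff_const)

/-- The derivative of the local coordinates. -/
noncomputable def curveChartDeriv (γ : ℝ → Plane) (w : Plane) (p : ℝ × ℝ) : (ℝ × ℝ) →L[ℝ] Plane :=
  (ContinuousLinearMap.fst ℝ ℝ ℝ).smulRight (deriv γ p.1) +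
    (ContinuousLinearMap.snd ℝ ℝ ℝ).smulRight w

lemma curveChart_hasFDerivAt (hγ : Differentiable ℝ γ) (w : Plane) (p : ℝ × ℝ) :
    HasFDerivAt (curveChart γ w) (curveChartDeriv γ w p) p := by
  have h1 : HasFDerivAt (fun q : ℝ × ℝ => γ q.1)
      ((ContinuousLinearMap.fst ℝ ℝ ℝ).smulRight (deriv γ p.1)) p := by
    have := (hγ p.1).hasDerivAt.hasFDerivAt.comp p (hasFDerivAt_fst (𝕜 := ℝ) (p := p))
    refine this.congr_fderiv ?_
    ext <;> simp
  have h2 : HasFDerivAt (fun q : ℝ × ℝ => q.2 • w)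
      ((ContinuousLinearMap.snd ℝ ℝ ℝ).smulRight w) p :=
    (hasFDerivAt_snd (𝕜 := ℝ) (p := p)).smul_const w
  exact h1.add h2

@[simp] lemma curveChartDeriv_one_zero (w : Plane) (p : ℝ × ℝ) :
    curveChartDeriv γ w p (1, 0) = deriv γ p.1 := by simp [curveChartDeriv]

@[simp] lemma curveChartDeriv_zero_one (w : Plane) (p : ℝ × ℝ) :
    curveChartDeriv γ w p (0, 1) = w := by simp [curveChartDeriv]

lemma continuous_cross_left (v : Plane) : Continuous (fun a : Plane => cross a v) := by
  unfold cross; fun_prop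

lemma hasDerivAt_cross {c : ℝ → Plane} {c' : Plane} {s : ℝ} (h : HasDerivAt c c' s) (w : Plane) :
    HasDerivAt (fun s => cross (c s) w) (cross c' w) s := by
  have h0 : ∀ i, HasDerivAt (fun s => c s i) (c' i) s := fun i =>
    (EuclideanSpace.proj (𝕜 := ℝ) i).hasFDerivAt.comp_hasDerivAt s h
  exact ((h0 0).mul_const _).sub ((h0 1).mul_const _)

/-- Crossing with `w` removes the term `ρ w` and leaves a strictly increasing function of `s`, so
`s` is recovered first and `ρ` afterwards. Because `w` does not vary with `s`, no smallness of `ρ`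
is needed. -/
lemma curveChart_injOn (hγ : Differentiable ℝ γ) {w : Plane} {a b : ℝ}
    (hpos : ∀ s ∈ Icc a b, 0 < cross (deriv γ s) w) :
    InjOn (curveChart γ w) (Icc a b ×ˢ univ) := by
  have hmono : StrictMonoOn (fun s => cross (γ s) w) (Icc a b) := by
    refine strictMonoOn_of_deriv_pos (convex_Icc a b) ?_ ?_
    · exact ((continuous_cross_left w).comp hγ.continuous).continuousOn
    · intro s hs
      rw [(hasDerivAt_cross (hγ s).hasDerivAt w).deriv]
      exact hpos s (interior_subset hs)
  rintro ⟨s, ρ⟩ ⟨hs, -⟩ ⟨s', ρ'⟩ ⟨hs', -⟩ heq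
  have hc : cross (γ s) w = cross (γ s') w := by
    have h0 : cross (curveChart γ w (s, ρ)) w = cross (curveChart γ w (s', ρ')) w := by rw [heq]
    have e : ∀ s ρ, cross (curveChart γ w (s, ρ)) w = cross (γ s) w := by
      intro s ρ; simp [cross, curveChart]; ring
    rwa [e, e] at h0
  have hss : s = s' := hmono.injOn hs hs' hc
  subst hss
  have hw : w ≠ 0 := by
    rintro rfl
    have := hpos s hs
    simp [cross] at this
  have : ρ • w = ρ' • w := by simpa [curveChart] using heq
  rw [smul_left_injective ℝ hw this]

end Chart

lemma subset_or_disjoint_of_isPreconnected {X : Type*} [TopologicalSpace X] {S A : Set X}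
    (hS : IsPreconnected S) (hA : IsOpen A) (hSA : Disjoint S (frontier A)) :
    S ⊆ A ∨ Disjoint S A := by
  have hcov : S ⊆ A ∪ (closure A)ᶜ := by
    intro x hx
    by_cases hxA : x ∈ A
    · exact Or.inl hxA
    · refine Or.inr fun hxc => disjoint_left.1 hSA hx ?_
      rw [hA.frontier_eq]; exact ⟨hxc, hxA⟩
  have hd : Disjoint A (closure A)ᶜ := disjoint_compl_right_iff_subset.2 subset_closure
  rcases hS.subset_or_subset hA isClosed_closure.isOpen_compl hd hcov with h | h
  · exact Or.inl h
  · exact Or.inr (hd.symm.mono_left h)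

end AlmostSharpFront

/-! ### The divergence theorem near one boundary point -/

namespace AlmostSharpFront

/-- The fundamental theorem of calculus in each variable. No derivative falls on the coefficients,
as `c` is constant and `m` does not depend on the second variable; hence `m` need only be
continuous. -/
lemma setIntegral_rect_eq {F : ℝ × ℝ → ℝ} (hF : ContDiff ℝ 1 F) {a b r : ℝ} (hab : a ≤ b)
    (hr : 0 ≤ r) (ha : ∀ ρ ∈ Icc 0 r, F (a, ρ) = 0) (hb : ∀ ρ ∈ Icc 0 r, F (b, ρ) = 0)
    (htop : ∀ s ∈ Icc a b, F (s, r) = 0) (c : ℝ) {m : ℝ → ℝ} (hm : Continuous m) :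
    ∫ p in Ioo a b ×ˢ Ioo 0 r, (c * fderiv ℝ F p (1, 0) + m p.1 * fderiv ℝ F p (0, 1))
      = -∫ s in a..b, m s * F (s, 0) := by
  have hd : Continuous (fderiv ℝ F) := hF.continuous_fderiv (by norm_num)
  have hdiff : Differentiable ℝ F := hF.differentiable (by norm_num)
  have hint : ∀ g : ℝ × ℝ → ℝ, Continuous g → IntegrableOn g (Ioo a b ×ˢ Ioo 0 r) := fun g hg =>
    (hg.continuousOn.integrableOn_compact (isCompact_Icc.prod isCompact_Icc)).mono_set
      (prod_mono Ioo_subset_Icc_self Ioo_subset_Icc_self)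
  have hc1 : Continuous fun p : ℝ × ℝ => c * fderiv ℝ F p (1, 0) := by fun_prop
  have hc2 : Continuous fun p : ℝ × ℝ => m p.1 * fderiv ℝ F p (0, 1) := by fun_prop
  rw [integral_add (hint _ hc1) (hint _ hc2)]
  have hs : ∀ s ρ, HasDerivAt (fun s => F (s, ρ)) (fderiv ℝ F (s, ρ) (1, 0)) s := fun s ρ => by
    have h1 : HasDerivAt (fun s : ℝ => (s, ρ)) ((1 : ℝ), (0 : ℝ)) s :=
      (hasDerivAt_id s).prodMk (hasDerivAt_const s ρ)
    exact (hdiff (s, ρ)).hasFDerivAt.comp_hasDerivAt s h1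
  have hρ : ∀ s ρ, HasDerivAt (fun ρ => F (s, ρ)) (fderiv ℝ F (s, ρ) (0, 1)) ρ := fun s ρ => by
    have h1 : HasDerivAt (fun ρ : ℝ => (s, ρ)) ((0 : ℝ), (1 : ℝ)) ρ :=
      (hasDerivAt_const ρ s).prodMk (hasDerivAt_id ρ)
    exact (hdiff (s, ρ)).hasFDerivAt.comp_hasDerivAt ρ h1
  have e1 : ∫ p in Ioo a b ×ˢ Ioo 0 r, c * fderiv ℝ F p (1, 0) = 0 := by
    rw [Measure.volume_eq_prod, ← Measure.prod_restrict, integral_prod_symm]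
    · have : ∀ ρ ∈ Ioo 0 r, ∫ s in Ioo a b, c * fderiv ℝ F (s, ρ) (1, 0) = 0 := by
        intro ρ hρr
        have hI := Ioo_subset_Icc_self hρr
        rw [integral_const_mul, ← integral_Ioc_eq_integral_Ioo,
          ← intervalIntegral.integral_of_le hab,
          intervalIntegral.integral_eq_sub_of_hasDerivAt (fun s _ => hs s ρ)
            (Continuous.intervalIntegrable (by fun_prop) _ _), ha ρ hI, hb ρ hI]
        simp
      rw [setIntegral_congr_fun measurableSet_Ioo this]; simp
    · rw [Measure.prod_restrict, ← Measure.volume_eq_prod]; exact hint _ hc1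
  have e2 : ∫ p in Ioo a b ×ˢ Ioo 0 r, m p.1 * fderiv ℝ F p (0, 1)
      = -∫ s in a..b, m s * F (s, 0) := by
    rw [Measure.volume_eq_prod, setIntegral_prod _ (by rw [← Measure.volume_eq_prod]; exact hint _ hc2)]
    have : ∀ s ∈ Ioo a b, ∫ ρ in Ioo 0 r, m s * fderiv ℝ F (s, ρ) (0, 1) = -(m s * F (s, 0)) := by
      intro s hsr
      rw [integral_const_mul, ← integral_Ioc_eq_integral_Ioo,
        ← intervalIntegral.integral_of_le hr,
        intervalIntegral.integral_eq_sub_of_hasDerivAt (fun ρ _ => hρ s ρ)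
          (Continuous.intervalIntegrable (by fun_prop) _ _), htop s (Ioo_subset_Icc_self hsr)]
      ring
    rw [setIntegral_congr_fun measurableSet_Ioo this, integral_neg, ← integral_Ioc_eq_integral_Ioo,
      ← intervalIntegral.integral_of_le hab]
  rw [e1, e2, zero_add]

namespace Bounds

variable {γ : ℝ → Plane} {A : Set Plane}

/-- Near a boundary point `A` is one side of the curve. The chart is injective where the tangent
stays transversal to `w`, and the remaining arc is compact and misses `γ s₀`, so a small rectangle
meets the curve only in its axis. Each open half is connected and avoids the frontier, and
`inward_normal` decides on which side it lies. -/
lemma exists_rect (h : Bounds γ A) (s₀ : ℝ) :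
    ∃ r : ℝ, 0 < r ∧ r < 1 / 2 ∧
      (∀ s ∈ Icc (s₀ - r) (s₀ + r), 0 < cross (deriv γ s) (perp (deriv γ s₀))) ∧
      (∀ p ∈ Icc (s₀ - r) (s₀ + r) ×ˢ Icc (-r) r, ∀ s, |s - s₀| ≤ 1 / 2 →
        γ s = curveChart γ (perp (deriv γ s₀)) p → s = p.1 ∧ p.2 = 0) ∧
      (∀ p ∈ Ioo (s₀ - r) (s₀ + r) ×ˢ Ioo 0 r, curveChart γ (perp (deriv γ s₀)) p ∈ A) ∧
      (∀ p ∈ Ioo (s₀ - r) (s₀ + r) ×ˢ Ioo (-r) 0, curveChart γ (perp (deriv γ s₀)) p ∉ A) := by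
  set w := perp (deriv γ s₀) with hw
  have hcw : Continuous fun s => cross (deriv γ s) w :=
    (continuous_cross_left w).comp h.continuous_deriv
  have hpos0 : 0 < cross (deriv γ s₀) w := by
    rw [hw, cross_perp_self]
    exact pow_pos (norm_pos_iff.2 (h.deriv_ne_zero s₀)) 2
  obtain ⟨r₁, hr₁, hpos⟩ := Metric.eventually_nhds_iff_ball.1
    (hcw.continuousAt.eventually (lt_mem_nhds hpos0))
  set r₂ := min (r₁ / 2) (1 / 4) with hr₂
  have hr₂0 : 0 < r₂ := by positivity
  have hr₂1 : r₂ < r₁ := (min_le_left _ _).trans_lt (by linarith)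
  have hr₂2 : r₂ ≤ 1 / 4 := min_le_right _ _
  have hpos2 : ∀ s ∈ Icc (s₀ - r₂) (s₀ + r₂), 0 < cross (deriv γ s) w := by
    intro s hs
    apply hpos
    rw [Metric.mem_ball, Real.dist_eq, abs_lt]
    constructor <;> linarith [hs.1, hs.2]
  have hinj := curveChart_injOn h.differentiable hpos2
  -- the rest of the curve stays away from `γ s₀`
  set Kc : Set ℝ := Icc (s₀ - 1 / 2) (s₀ - r₂) ∪ Icc (s₀ + r₂) (s₀ + 1 / 2) with hKc
  have hKcomp : IsCompact (γ '' Kc) :=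
    (isCompact_Icc.union isCompact_Icc).image h.differentiable.continuous
  have hnot : curveChart γ w (s₀, 0) ∉ γ '' Kc := by
    rintro ⟨s, hs, hs'⟩
    have e : γ s = γ s₀ := by simpa [curveChart] using hs'
    have hlt : |s - s₀| < 1 := by
      rw [abs_lt]
      rcases hs with hs | hs <;> constructor <;> linarith [hs.1, hs.2]
    have := h.eq_of_abs_sub_lt e hlt
    rcases hs with hs | hs <;> linarith [hs.1, hs.2]
  have hcc : Continuous (curveChart γ w) := (curveChart_contDiff h.contDiff_one w).continuous
  obtain ⟨r₃, hr₃, hball⟩ := Metric.eventually_nhds_iff_ball.1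
    (hcc.continuousAt.eventually (hKcomp.isClosed.isOpen_compl.mem_nhds hnot))
  set r := min (r₂ / 2) (r₃ / 2) with hr
  have hr0 : 0 < r := by positivity
  have hrr₂ : r < r₂ := (min_le_left _ _).trans_lt (by linarith)
  have hrr₃ : r < r₃ := (min_le_right _ _).trans_lt (by linarith)
  have hsep : ∀ p ∈ Icc (s₀ - r) (s₀ + r) ×ˢ Icc (-r) r, ∀ s, |s - s₀| ≤ 1 / 2 →
      γ s = curveChart γ w p → s = p.1 ∧ p.2 = 0 := by
    rintro ⟨a, ρ⟩ ⟨ha, hρ⟩ s hs heq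
    have hmem : (a, ρ) ∈ Metric.ball (s₀, (0 : ℝ)) r₃ := by
      rw [Metric.mem_ball, Prod.dist_eq, max_lt_iff, Real.dist_eq, Real.dist_eq, abs_lt, abs_lt]
      simp only [mem_Icc] at ha hρ
      refine ⟨⟨?_, ?_⟩, ?_, ?_⟩ <;> dsimp only <;> linarith [ha.1, ha.2, hρ.1, hρ.2]
    have hn := hball _ hmem
    have hs2 : s ∈ Icc (s₀ - r₂) (s₀ + r₂) := by
      by_contra hcon
      apply hn
      refine ⟨s, ?_, heq⟩
      rw [abs_le] at hs
      rw [mem_Icc, not_and_or, not_le, not_le] at hcon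
      rcases hcon with hcon | hcon
      · left; constructor <;> linarith
      · right; constructor <;> linarith
    have ha2 : a ∈ Icc (s₀ - r₂) (s₀ + r₂) := by
      simp only [mem_Icc] at ha ⊢
      constructor <;> linarith [ha.1, ha.2]
    have := hinj (x₁ := (s, 0)) (x₂ := (a, ρ)) ⟨hs2, mem_univ _⟩ ⟨ha2, mem_univ _⟩
      (by rw [← heq]; simp [curveChart])
    simp only [Prod.mk.injEq] at this
    exact ⟨this.1, this.2.symm⟩
  have hfr : ∀ S ⊆ Icc (s₀ - r) (s₀ + r) ×ˢ Icc (-r) r, (∀ p ∈ S, p.2 ≠ 0) →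
      Disjoint (curveChart γ w '' S) (frontier A) := by
    intro S hS hne
    rw [h.frontier_eq, disjoint_left]
    rintro _ ⟨p, hp, rfl⟩ ⟨s, hs⟩
    obtain ⟨s', hs', hle⟩ := h.exists_eq_abs_sub_le s s₀
    exact hne p hp (hsep p (hS hp) s' hle (hs'.trans hs)).2
  refine ⟨r, hr0, by linarith, fun s hs => hpos2 s ⟨by linarith [hs.1], by linarith [hs.2]⟩,
    hsep, ?_, ?_⟩
  · set S := Ioo (s₀ - r) (s₀ + r) ×ˢ Ioo 0 r with hS
    have hpc : IsPreconnected (curveChart γ w '' S) :=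
      (isPreconnected_Ioo.prod isPreconnected_Ioo).image _ hcc.continuousOn
    have hd := hfr S (prod_mono Ioo_subset_Icc_self
      (Ioo_subset_Icc_self.trans (Icc_subset_Icc (by linarith) le_rfl))) (fun p hp => hp.2.1.ne')
    rcases subset_or_disjoint_of_isPreconnected hpc h.isOpen hd with hsub | hdis
    · exact fun p hp => hsub (mem_image_of_mem _ hp)
    · exfalso
      obtain ⟨ε, ⟨hε, -⟩, hε2⟩ := ((h.inward_normal s₀).and (Ioo_mem_nhdsGT hr0)).exists
      refine disjoint_left.1 hdis (mem_image_of_mem _ (show (s₀, ε) ∈ S from ?_)) hε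
      exact ⟨⟨by simp [hr0], by simp [hr0]⟩, hε2⟩
  · set S := Ioo (s₀ - r) (s₀ + r) ×ˢ Ioo (-r) 0 with hS
    have hpc : IsPreconnected (curveChart γ w '' S) :=
      (isPreconnected_Ioo.prod isPreconnected_Ioo).image _ hcc.continuousOn
    have hd := hfr S (prod_mono Ioo_subset_Icc_self
      (Ioo_subset_Icc_self.trans (Icc_subset_Icc le_rfl (by linarith)))) (fun p hp => hp.2.2.ne)
    rcases subset_or_disjoint_of_isPreconnected hpc h.isOpen hd with hsub | hdis
    · exfalso
      obtain ⟨ε, ⟨-, hε⟩, hε2⟩ := ((h.inward_normal s₀).and (Ioo_mem_nhdsGT hr0)).exists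
      apply hε
      have : (s₀, -ε) ∈ S :=
        ⟨⟨by simp [hr0], by simp [hr0]⟩, by simp [hε2.2], by simp [hε2.1]⟩
      have := hsub (mem_image_of_mem _ this)
      simpa [curveChart, sub_eq_add_neg] using this
    · exact fun p hp hpA => disjoint_left.1 hdis (mem_image_of_mem _ hp) hpA

lemma intervalIntegral_shift {f : ℝ → ℝ} (hf : Function.Periodic f 1) (s₀ : ℝ) :
    ∫ s in (-1 / 2 : ℝ)..(1 / 2), f s = ∫ s in (s₀ - 1 / 2)..(s₀ + 1 / 2), f s := by
  have := hf.intervalIntegral_add_eq (-1 / 2) (s₀ - 1 / 2)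
  convert this using 2 <;> ring

/-- In the chart `A` is the upper half of a rectangle. Cramer's rule turns the Jacobian times the
derivative along `v` into a combination of the two partial derivatives of the pullback, of the kind
treated by `setIntegral_rect_eq`; only the side on the curve contributes. -/
lemma exists_isOpen_green (h : Bounds γ A) (s₀ : ℝ) :
    ∃ U : Set Plane, IsOpen U ∧ γ s₀ ∈ U ∧ ∀ f : Plane → ℝ, ContDiff ℝ 1 f → tsupport f ⊆ U →
      ∀ v : Plane, ∫ x in A, fderiv ℝ f x v
        = -∫ s in (-1 / 2 : ℝ)..(1 / 2), f (γ s) * inner ℝ v (perp (deriv γ s)) := by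
  obtain ⟨r, hr0, hr1, hpos, hsep, hup, hdown⟩ := h.exists_rect s₀
  set w := perp (deriv γ s₀) with hw
  set Φ := curveChart γ w with hΦ
  have hΦc : ContDiff ℝ 1 Φ := curveChart_contDiff h.contDiff_one w
  have hΦ' : ∀ p, HasFDerivAt Φ (curveChartDeriv γ w p) p :=
    curveChart_hasFDerivAt h.differentiable w
  have hinj := curveChart_injOn h.differentiable hpos
  set Q := Ioo (s₀ - r) (s₀ + r) ×ˢ Ioo (-r) r with hQ
  set S := Ioo (s₀ - r) (s₀ + r) ×ˢ Ioo 0 r with hS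
  have hQo : IsOpen Q := isOpen_Ioo.prod isOpen_Ioo
  have hQ0 : (s₀, (0 : ℝ)) ∈ Q := by simp [hQ, hr0]
  refine ⟨interior (Φ '' Q), isOpen_interior, ?_, ?_⟩
  -- The chart has surjective derivative at `(s₀, 0)`, so it maps the rectangle onto a neighbourhood
  -- of `γ s₀`.
  · have hstrict : HasStrictFDerivAt Φ (curveChartDeriv γ w (s₀, 0)) (s₀, 0) :=
      hΦc.contDiffAt.hasStrictFDerivAt' (hΦ' _) (by norm_num)
    have hsurj : (curveChartDeriv γ w (s₀, 0)).range = ⊤ := by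
      rw [LinearMap.range_eq_top]
      intro v
      have hc : cross (deriv γ s₀) w ≠ 0 := (hpos s₀ ⟨by linarith, by linarith⟩).ne'
      refine ⟨((cross (deriv γ s₀) w)⁻¹ * cross v w, (cross (deriv γ s₀) w)⁻¹ *
        cross (deriv γ s₀) v), ?_⟩
      have := cross_smul_eq (deriv γ s₀) w v
      simp only [curveChartDeriv, ContinuousLinearMap.coe_coe, add_apply,
        ContinuousLinearMap.smulRight_apply, ContinuousLinearMap.coe_fst',
        ContinuousLinearMap.coe_snd', mul_smul]
      rw [← smul_add, ← this, smul_smul, inv_mul_cancel₀ hc, one_smul]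
    have hmap := hstrict.map_nhds_eq_of_surj hsurj
    have : Φ '' Q ∈ 𝓝 (Φ (s₀, 0)) := by
      rw [← hmap]; exact image_mem_map (hQo.mem_nhds hQ0)
    have h0 : Φ (s₀, 0) = γ s₀ := by simp [hΦ, curveChart]
    rw [h0] at this
    exact mem_interior_iff_mem_nhds.2 this
  · intro f hf hsupp v
    have hfQ : ∀ x, x ∉ Φ '' Q → f x = 0 := fun x hx => by
      by_contra hne
      exact hx (interior_subset (hsupp (subset_tsupport _ hne)))
    have hfQ' : ∀ x, x ∉ Φ '' Q → fderiv ℝ f x = 0 := fun x hx => by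
      by_contra hne
      exact hx (interior_subset (hsupp (tsupport_fderiv_subset ℝ (subset_tsupport _ hne))))
    have hSQ : S ⊆ Q := prod_mono le_rfl (Ioo_subset_Ioo (by linarith) le_rfl)
    have hSA : Φ '' S ⊆ A := by rintro _ ⟨p, hp, rfl⟩; exact hup p hp
    have hAQ : ∀ x ∈ A \ Φ '' S, fderiv ℝ f x v = 0 := by
      rintro x ⟨hxA, hxS⟩
      rw [hfQ' x, zero_apply]
      rintro ⟨⟨s, ρ⟩, hp, rfl⟩
      rcases lt_trichotomy ρ 0 with hρ | hρ | hρ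
      · exact hdown (s, ρ) ⟨hp.1, hp.2.1, hρ⟩ hxA
      · subst hρ
        exact h.disjoint_range s (by simpa [hΦ, curveChart] using hxA)
      · exact hxS ⟨(s, ρ), ⟨hp.1, hρ, hp.2.2⟩, rfl⟩
    rw [setIntegral_eq_of_subset_of_forall_sdiff_eq_zero h.isOpen.measurableSet hSA hAQ,
      setIntegral_image_plane (measurableSet_Ioo.prod measurableSet_Ioo) (fun p _ => hΦ' p)
        (hinj.mono (prod_mono Ioo_subset_Icc_self (subset_univ _)))]
    simp only [curveChartDeriv_one_zero, curveChartDeriv_zero_one]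
    have hfd : Differentiable ℝ f := hf.differentiable (by norm_num)
    have hF : ContDiff ℝ 1 (f ∘ Φ) := hf.comp hΦc
    have hFd : ∀ p u, fderiv ℝ (f ∘ Φ) p u = fderiv ℝ f (Φ p) (curveChartDeriv γ w p u) := by
      intro p u
      rw [((hfd (Φ p)).hasFDerivAt.comp p (hΦ' p)).fderiv]; rfl
    have hpt : ∀ p ∈ S, |cross (deriv γ p.1) w| * fderiv ℝ f (Φ p) v
        = cross v w * fderiv ℝ (f ∘ Φ) p (1, 0)
          + cross (deriv γ p.1) v * fderiv ℝ (f ∘ Φ) p (0, 1) := by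
      intro p hp
      rw [abs_of_pos (hpos _ (Ioo_subset_Icc_self hp.1)), hFd, hFd, curveChartDeriv_one_zero,
        curveChartDeriv_zero_one]
      simp only [← smul_eq_mul, ← map_smul, ← map_add]
      rw [cross_smul_eq]
    rw [setIntegral_congr_fun (measurableSet_Ioo.prod measurableSet_Ioo) hpt]
    -- By injectivity on the closed strip, the edges of the rectangle are not mapped into the image
    -- of the open rectangle, outside of which `f` vanishes.
    have hz : ∀ p ∈ Icc (s₀ - r) (s₀ + r) ×ˢ Icc (-r) r, p ∉ Q → (f ∘ Φ) p = 0 := by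
      intro p hp hpQ
      apply hfQ
      rintro ⟨q, hq, hqp⟩
      have : q = p := hinj ⟨Ioo_subset_Icc_self hq.1, mem_univ _⟩ ⟨hp.1, mem_univ _⟩ hqp
      exact hpQ (this ▸ hq)
    rw [setIntegral_rect_eq hF (by linarith) hr0.le (c := cross v w)
      (m := fun s => cross (deriv γ s) v)]
    · rw [neg_inj]
      have hper : Function.Periodic (fun s => f (γ s) * inner ℝ v (perp (deriv γ s))) 1 := by
        intro s; simp only [h.periodic s, h.periodic_deriv s]
      rw [intervalIntegral_shift hper s₀, intervalIntegral.integral_of_le (by linarith),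
        intervalIntegral.integral_of_le (by linarith)]
      rw [setIntegral_eq_of_subset_of_forall_sdiff_eq_zero (s := Ioc (s₀ - r) (s₀ + r))
        (t := Ioc (s₀ - 1 / 2) (s₀ + 1 / 2)) measurableSet_Ioc (Ioc_subset_Ioc (by linarith) (by linarith))]
      · refine setIntegral_congr_fun measurableSet_Ioc fun s _ => ?_
        simp only [inner_perp_eq_cross, hΦ, curveChart, Function.comp, zero_smul, add_zero]
        ring
      · rintro s ⟨hs, hsr⟩
        have : f (γ s) = 0 := by
          apply hfQ
          rintro ⟨p, hp, hps⟩
          have habs : |s - s₀| ≤ 1 / 2 := by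
            rw [abs_le]; constructor <;> linarith [hs.1, hs.2]
          have := (hsep p ⟨Ioo_subset_Icc_self hp.1, Ioo_subset_Icc_self hp.2⟩ s habs hps.symm).1
          exact hsr (this ▸ Ioo_subset_Ioc_self hp.1)
        simp [this]
    · intro ρ hρ
      exact hz _ ⟨⟨le_rfl, by linarith⟩, by linarith [hρ.1], hρ.2⟩ (fun hq => lt_irrefl _ hq.1.1)
    · intro ρ hρ
      exact hz _ ⟨⟨by linarith, le_rfl⟩, by linarith [hρ.1], hρ.2⟩ (fun hq => lt_irrefl _ hq.1.2)
    · intro s hs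
      exact hz _ ⟨hs, by linarith, le_rfl⟩ (fun hq => lt_irrefl _ hq.2.2)
    · exact (continuous_cross_left v).comp h.continuous_deriv

end Bounds

end AlmostSharpFront

/-! ### The divergence theorem on the whole region -/

namespace AlmostSharpFront

lemma integral_mul_fderiv_eq_neg {f g : Plane → ℝ} (hf : ContDiff ℝ 1 f) (hg : ContDiff ℝ 1 g)
    (hgc : HasCompactSupport g) (v : Plane) :
    ∫ x, f x * fderiv ℝ g x v = -∫ x, fderiv ℝ f x v * g x := by
  have hf' : Continuous fun x => fderiv ℝ f x v :=
    (hf.continuous_fderiv (by norm_num)).clm_apply continuous_const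
  have hg' : Continuous fun x => fderiv ℝ g x v :=
    (hg.continuous_fderiv (by norm_num)).clm_apply continuous_const
  refine integral_mul_fderiv_eq_neg_fderiv_mul_of_integrable ?_ ?_ ?_
    (fun x _ => hf.differentiable (by norm_num) x) (fun x _ => hg.differentiable (by norm_num) x)
  · exact (hf'.mul hg.continuous).integrable_of_hasCompactSupport hgc.mul_left
  · exact (hf.continuous.mul hg').integrable_of_hasCompactSupport (hgc.fderiv_apply ℝ v).mul_left
  · exact (hf.continuous.mul hg.continuous).integrable_of_hasCompactSupport hgc.mul_left

namespace Bounds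

variable {γ : ℝ → Plane} {A : Set Plane}

lemma isCompact_closure (h : Bounds γ A) : IsCompact (closure A) := h.isBounded.isCompact_closure

lemma volume_lt_top (h : Bounds γ A) : volume A < ⊤ := h.isBounded.measure_lt_top

lemma integrableOn_of_continuous (h : Bounds γ A) {f : Plane → ℝ} (hf : Continuous f) :
    IntegrableOn f A :=
  (hf.continuousOn.integrableOn_compact h.isCompact_closure).mono_set subset_closure

lemma exists_isOpen_green_of_mem (h : Bounds γ A) {p : Plane} (hp : p ∈ closure A) :
    ∃ U : Set Plane, IsOpen U ∧ p ∈ U ∧ ∀ f : Plane → ℝ, ContDiff ℝ 1 f → tsupport f ⊆ U →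
      ∀ v : Plane, ∫ x in A, fderiv ℝ f x v
        = -∫ s in (-1 / 2 : ℝ)..(1 / 2), f (γ s) * inner ℝ v (perp (deriv γ s)) := by
  by_cases hpA : p ∈ A
  -- At an interior point `U = A` works: `f` vanishes on the curve, and the derivative of a
  -- compactly supported function has integral zero.
  · refine ⟨A, h.isOpen, hpA, fun f hf hsupp v => ?_⟩
    have hcs : HasCompactSupport f :=
      h.isCompact_closure.of_isClosed_subset (isClosed_tsupport f) (hsupp.trans subset_closure)
    have hz : ∀ s, f (γ s) = 0 := fun s => by
      by_contra hne
      exact h.disjoint_range s (hsupp (subset_tsupport _ hne))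
    have e1 : ∫ x in A, fderiv ℝ f x v = ∫ x, fderiv ℝ f x v := by
      refine setIntegral_eq_integral_of_forall_compl_eq_zero fun x hx => ?_
      have : fderiv ℝ f x = 0 := by
        by_contra hne
        exact hx (hsupp (tsupport_fderiv_subset ℝ (subset_tsupport _ hne)))
      simp [this]
    have e2 : ∫ x, fderiv ℝ f x v = 0 := by
      simpa using integral_mul_fderiv_eq_neg (f := fun _ => (1 : ℝ)) contDiff_const hf hcs v
    rw [e1, e2]
    simp [hz]
  · have hfr : p ∈ frontier A := by rw [h.isOpen.frontier_eq]; exact ⟨hp, hpA⟩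
    rw [h.frontier_eq] at hfr
    obtain ⟨s, rfl⟩ := hfr
    exact h.exists_isOpen_green s

/-- The divergence theorem for a region bounded by a closed curve with inward normal
`(∂_s γ)^⊥`. -/
theorem integral_fderiv_eq (h : Bounds γ A) {f : Plane → ℝ} (hf : ContDiff ℝ 1 f) (v : Plane) :
    ∫ x in A, fderiv ℝ f x v
      = -∫ s in (-1 / 2 : ℝ)..(1 / 2), f (γ s) * inner ℝ v (perp (deriv γ s)) := by
  choose! U hUo hpU hU using fun p (hp : p ∈ closure A) => h.exists_isOpen_green_of_mem hp
  obtain ⟨t, hcov⟩ := h.isCompact_closure.elim_nhds_subcover' (fun p _ => U p)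
    (fun p hp => (hUo p hp).mem_nhds (hpU p hp))
  obtain ⟨χ, hχ⟩ := SmoothPartitionOfUnity.exists_isSubordinate
    (modelWithCornersSelf ℝ Plane)
    (isClosed_closure (s := A)) (fun i : t => U i.1) (fun i => hUo _ i.1.2) (by
      intro x hx
      obtain ⟨i, hi, hxi⟩ := mem_iUnion₂.1 (hcov hx)
      exact mem_iUnion.2 ⟨⟨i, hi⟩, hxi⟩)
  have hχc : ∀ i, ContDiff ℝ 1 (fun x => χ i x) := fun i =>
    ((χ i).contMDiff.contDiff).of_le (by exact_mod_cast le_top)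
  have hg : ∀ i, ContDiff ℝ 1 (fun x => χ i x * f x) := fun i => (hχc i).mul hf
  -- The sum is one on the closure, hence in the area integral and in the boundary integral alike.
  have hsum : ∀ x ∈ closure A, ∑ i, χ i x * f x = f x := fun x hx => by
    have := χ.sum_eq_one hx
    rw [finsum_eq_sum_of_fintype] at this
    rw [← Finset.sum_mul, this, one_mul]
  have hloc : ∀ i : t, ∫ x in A, fderiv ℝ (fun x => χ i x * f x) x v
      = -∫ s in (-1 / 2 : ℝ)..(1 / 2), (χ i (γ s) * f (γ s)) * inner ℝ v (perp (deriv γ s)) :=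
    fun i => hU _ i.1.2 _ (hg i) ((tsupport_mul_subset_left).trans (hχ i)) v
  have hfd : ∀ x ∈ A, fderiv ℝ f x v = ∑ i, fderiv ℝ (fun x => χ i x * f x) x v := by
    intro x hx
    have : fderiv ℝ f x = fderiv ℝ (fun x => ∑ i, χ i x * f x) x := by
      refine Filter.EventuallyEq.fderiv_eq ?_
      filter_upwards [h.isOpen.mem_nhds hx] with y hy
      exact (hsum y (subset_closure hy)).symm
    rw [this, fderiv_fun_sum (fun i _ => (hg i).differentiable (by norm_num) x),
      sum_apply]
  rw [setIntegral_congr_fun h.isOpen.measurableSet hfd, integral_finsetSum, Finset.sum_congr rfl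
    (fun i _ => hloc i), Finset.sum_neg_distrib, ← intervalIntegral.integral_finsetSum]
  · rw [neg_inj]
    refine intervalIntegral.integral_congr fun s _ => ?_
    rw [← Finset.sum_mul, hsum (γ s)]
    exact frontier_subset_closure (h.frontier_eq ▸ mem_range_self s)
  · intro i _
    refine Continuous.intervalIntegrable ?_ _ _
    have h1 := h.differentiable.continuous
    have h2 := hf.continuous
    have h3 := (hχc i).continuous
    have h4 := continuous_perp.comp h.continuous_deriv
    exact ((h3.comp h1).mul (h2.comp h1)).mul (continuous_const.inner h4)
  · intro i _
    exact h.integrableOn_of_continuous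
      (((hg i).continuous_fderiv (by norm_num)).clm_apply continuous_const)

end Bounds

end AlmostSharpFront

/-! ### The regularised kernel and its integrable majorant -/

namespace AlmostSharpFront

/-- The regularised kernel `(|x|² + ε²)^{-(1+α)/2}`. -/
noncomputable def regKernel (α ε : ℝ) (x : Plane) : ℝ := (‖x‖ ^ 2 + ε ^ 2) ^ ((-1 - α) / 2)

/-- The gradient of the regularised kernel. -/
noncomputable def regKernelGrad (α ε : ℝ) (x : Plane) : Plane :=
  ((-1 - α) * (‖x‖ ^ 2 + ε ^ 2) ^ ((-3 - α) / 2)) • x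

/-- An integrable majorant for the symmetrised kernel. -/
noncomputable def majorant (α : ℝ) (x : Plane) : ℝ :=
  if ‖x‖ ≤ 1 then ‖x‖ ^ (-1 - α) else ‖x‖ ^ (-2 - α)

section Kernel

variable {α ε : ℝ}

lemma regKernel_base_pos (hε : 0 < ε) (x : Plane) : 0 < ‖x‖ ^ 2 + ε ^ 2 := by positivity

lemma regKernel_contDiff (hε : 0 < ε) {n : WithTop ℕ∞} : ContDiff ℝ n (regKernel α ε) := by
  unfold regKernel
  exact ((contDiff_norm_sq ℝ).add contDiff_const).rpow_const_of_ne
    (fun x => (regKernel_base_pos hε x).ne')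

lemma regKernel_hasFDerivAt (hε : 0 < ε) (x : Plane) :
    HasFDerivAt (regKernel α ε) (innerSL ℝ (regKernelGrad α ε x)) x := by
  have h1 : HasFDerivAt (fun x : Plane => ‖x‖ ^ 2 + ε ^ 2) (2 • innerSL ℝ x) x :=
    (hasStrictFDerivAt_norm_sq x).hasFDerivAt.add_const _
  have h2 := h1.rpow_const (p := (-1 - α) / 2) (Or.inl (regKernel_base_pos hε x).ne')
  refine h2.congr_fderiv ?_
  ext v
  simp only [regKernelGrad, map_smul, smul_apply, smul_eq_mul, innerSL_apply_apply, nsmul_eq_mul]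
  rw [show (-1 - α) / 2 - 1 = (-3 - α) / 2 by ring]
  push_cast
  ring

lemma regKernelGrad_neg (x : Plane) : regKernelGrad α ε (-x) = -regKernelGrad α ε x := by
  simp [regKernelGrad]

lemma regKernelGrad_continuous (hε : 0 < ε) : Continuous (regKernelGrad α ε) := by
  unfold regKernelGrad
  refine (continuous_const.mul (Continuous.rpow_const (by fun_prop)
    fun x => Or.inl (regKernel_base_pos hε x).ne')).smul continuous_id

lemma regKernel_nonneg (x : Plane) : 0 ≤ regKernel α ε x := by
  unfold regKernel; positivity

lemma sq_rpow_half (r p : ℝ) (hr : 0 ≤ r) : (r ^ 2) ^ (p / 2) = r ^ p := by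
  rw [← Real.rpow_natCast r 2, ← Real.rpow_mul hr]; congr 1; push_cast; ring

/-- The origin is excluded because the real power gives `kernelK α 0 = 0`, while the regularised
kernel is positive there for `ε ≠ 0`. -/
lemma regKernel_le (hα : 0 < α) {x : Plane} (hx : x ≠ 0) : regKernel α ε x ≤ kernelK α x := by
  have h0 : 0 < ‖x‖ := norm_pos_iff.2 hx
  rw [kernelK, ← sq_rpow_half _ _ h0.le, regKernel]
  exact Real.rpow_le_rpow_of_nonpos (by positivity) (by nlinarith [sq_nonneg ε]) (by linarith)

lemma kernelK_nonneg (x : Plane) : 0 ≤ kernelK α x := by unfold kernelK; positivity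

lemma tendsto_regKernel {x : Plane} (hx : x ≠ 0) :
    Tendsto (fun ε => regKernel α ε x) (𝓝[>] 0) (𝓝 (kernelK α x)) := by
  have h0 : 0 < ‖x‖ := norm_pos_iff.2 hx
  have hc : ContinuousAt (fun ε => regKernel α ε x) 0 := by
    unfold regKernel
    refine ContinuousAt.rpow_const (by fun_prop) (Or.inl ?_)
    positivity
  have := hc.tendsto.mono_left (nhdsWithin_le_nhds (s := Ioi 0))
  convert this using 2
  simp [regKernel, kernelK, sq_rpow_half _ _ h0.le]

lemma norm_regKernelGrad_le (hα : 0 < α) (x : Plane) :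
    ‖regKernelGrad α ε x‖ ≤ (1 + α) * ‖x‖ ^ (-2 - α) := by
  rcases eq_or_ne x 0 with rfl | hx
  · simp only [regKernelGrad, smul_zero, norm_zero]; positivity
  have h0 : 0 < ‖x‖ := norm_pos_iff.2 hx
  have h1 : (‖x‖ ^ 2 + ε ^ 2) ^ ((-3 - α) / 2) ≤ ‖x‖ ^ (-3 - α) := by
    rw [← sq_rpow_half _ _ h0.le]
    exact Real.rpow_le_rpow_of_nonpos (by positivity) (by nlinarith [sq_nonneg ε]) (by linarith)
  have h2 : ‖x‖ ^ (-2 - α) = ‖x‖ ^ (-3 - α) * ‖x‖ := by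
    rw [show -2 - α = (-3 - α) + 1 by ring, Real.rpow_add_one h0.ne']
  rw [regKernelGrad, norm_smul, norm_mul, Real.norm_eq_abs, Real.norm_eq_abs,
    abs_of_neg (by linarith : -1 - α < 0), abs_of_nonneg (by positivity), h2,
    show -(-1 - α) = 1 + α by ring, mul_assoc]
  gcongr

/-- This bound degenerates as `ε → 0`. It only gives integrability at fixed `ε`, so that Fubini and
the exchange of variables are allowed before symmetrisation. -/
lemma exists_norm_regKernelGrad_le (hα : 0 < α) (hε : 0 < ε) :
    ∃ M, ∀ x, ‖regKernelGrad α ε x‖ ≤ M := by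
  obtain ⟨M, hM⟩ := (isCompact_closedBall (0 : Plane) 1).exists_bound_of_continuousOn
    (regKernelGrad_continuous (α := α) hε).continuousOn
  refine ⟨max M (1 + α), fun x => ?_⟩
  by_cases hx : ‖x‖ ≤ 1
  · exact (hM x (by simpa using hx)).trans (le_max_left _ _)
  · refine (norm_regKernelGrad_le hα x).trans (le_trans ?_ (le_max_right _ _))
    have : ‖x‖ ^ (-2 - α) ≤ 1 := Real.rpow_le_one_of_one_le_of_nonpos (by linarith) (by linarith)
    nlinarith

lemma majorant_nonneg (x : Plane) : 0 ≤ majorant α x := by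
  unfold majorant; split_ifs <;> positivity

lemma majorant_neg (x : Plane) : majorant α (-x) = majorant α x := by simp [majorant]

/-- The minimum is the gain from symmetrisation: it lowers the singularity by one order and leaves
the decay alone. At the origin both sides are zero by the convention for real powers. -/
lemma rpow_mul_min_eq_majorant (hα : 0 < α) (x : Plane) :
    ‖x‖ ^ (-2 - α) * min ‖x‖ 1 = majorant α x := by
  unfold majorant
  split_ifs with h
  · rw [min_eq_left h]
    rcases eq_or_ne x 0 with rfl | hx
    · rw [norm_zero, Real.zero_rpow (by linarith), Real.zero_rpow (by linarith)]; simp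
    · rw [← Real.rpow_add_one (norm_ne_zero_iff.2 hx)]; congr 1; ring
  · rw [min_eq_right (by linarith), mul_one]

lemma integrable_norm_fun_plane {f : ℝ → ℝ}
    (hf : IntegrableOn (fun r => r * f r) (Ioi 0)) : Integrable (fun x : Plane => f ‖x‖) := by
  have h := integrable_fun_norm_addHaar (volume : Measure Plane) (f := f)
  rw [h]
  simpa [finrank_euclideanSpace] using hf

/-- In polar coordinates the two powers become $r^{-\alpha}$ on $(0,1]$, which needs $\alpha<1$, and
$r^{-1-\alpha}$ on $(1,\infty)$, which needs $\alpha>0$. -/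
lemma integrable_majorant (hα : α ∈ Ioo (0 : ℝ) 1) : Integrable (majorant α) := by
  refine integrable_norm_fun_plane
    (f := fun r => if r ≤ 1 then r ^ (-1 - α) else r ^ (-2 - α)) ?_
  rw [← Ioc_union_Ioi_eq_Ioi (zero_le_one' ℝ)]
  refine IntegrableOn.union ?_ ?_
  · have h1 : IntegrableOn (fun r : ℝ => r ^ (-α)) (Ioc 0 1) := by
      rw [← intervalIntegrable_iff_integrableOn_Ioc_of_le zero_le_one]
      exact intervalIntegral.intervalIntegrable_rpow' (by linarith [hα.2])
    refine h1.congr_fun (fun r hr => ?_) measurableSet_Ioc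
    simp only [if_pos hr.2]
    rw [mul_comm, ← Real.rpow_add_one hr.1.ne']; congr 1; ring
  · have h1 : IntegrableOn (fun r : ℝ => r ^ (-1 - α)) (Ioi 1) :=
      integrableOn_Ioi_rpow_of_lt (by linarith [hα.1]) zero_lt_one
    refine h1.congr_fun (fun r hr => ?_) measurableSet_Ioi
    have hr' : (1 : ℝ) < r := hr
    simp only [if_neg (not_le.2 hr')]
    rw [mul_comm, ← Real.rpow_add_one (by linarith)]; congr 1; ring

lemma integrableOn_kernelK_ball (hα : α ∈ Ioo (0 : ℝ) 1) :
    IntegrableOn (kernelK α) (Metric.closedBall 0 1) := by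
  refine (integrable_majorant hα).integrableOn.congr_fun (fun x hx => ?_)
    measurableSet_closedBall
  simp only [majorant, kernelK]
  rw [if_pos (by simpa using hx)]

lemma kernelK_measurable : Measurable (kernelK α) := by
  unfold kernelK; fun_prop

/-- `K` is the sum of an integrable and a bounded function. -/
lemma kernelK_le (hα : α ∈ Ioo (0 : ℝ) 1) (x : Plane) :
    kernelK α x ≤ (Metric.closedBall (0 : Plane) 1).indicator (kernelK α) x + 1 := by
  by_cases hx : x ∈ Metric.closedBall (0 : Plane) 1
  · rw [indicator_of_mem hx]; linarith
  · rw [indicator_of_notMem hx, zero_add, kernelK]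
    have : 1 < ‖x‖ := by simpa using hx
    exact Real.rpow_le_one_of_one_le_of_nonpos this.le (by linarith [hα.1])

lemma locallyIntegrable_kernelK (hα : α ∈ Ioo (0 : ℝ) 1) : LocallyIntegrable (kernelK α) := by
  have h1 : LocallyIntegrable
      (fun x => (Metric.closedBall (0 : Plane) 1).indicator (kernelK α) x + 1) :=
    ((integrable_indicator_iff measurableSet_closedBall).2
      (integrableOn_kernelK_ball hα)).locallyIntegrable.add (locallyIntegrable_const 1)
  refine h1.mono kernelK_measurable.aestronglyMeasurable (ae_of_all _ fun x => ?_)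
  rw [Real.norm_of_nonneg (kernelK_nonneg x)]
  exact (kernelK_le hα x).trans (le_abs_self _)

end Kernel

/-! ### The quadratic form of the flux -/

/-- The quadratic form `∬ f(x) f(y) ⟪∇^⊥ K_ε(x - y), g(x)⟫`. -/
noncomputable def regForm (α ε : ℝ) (g : Plane → Plane) (f : Plane → ℝ) : ℝ :=
  ∫ p : Plane × Plane, f p.1 * f p.2 * inner ℝ (perp (regKernelGrad α ε (p.1 - p.2))) (g p.1)

section Form

variable {α ε : ℝ}

lemma perp_neg (x : Plane) : perp (-x) = -perp x := perpL.map_neg x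

lemma integrable_mul_kernel {f : Plane → ℝ} (hf : Integrable f) {k : Plane × Plane → ℝ}
    (hk : Continuous k) {M : ℝ} (hM : ∀ p, |k p| ≤ M) :
    Integrable (fun p : Plane × Plane => f p.1 * f p.2 * k p) :=
  (hf.mul_prod hf).mul_bdd hk.aestronglyMeasurable (ae_of_all _ hM)

lemma regForm_integrable (hα : 0 < α) (hε : 0 < ε) {g : Plane → Plane} (hg : Continuous g)
    {H : ℝ} (hgH : ∀ x, ‖g x‖ ≤ H) {f : Plane → ℝ} (hf : Integrable f) :
    Integrable (fun p : Plane × Plane =>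
      f p.1 * f p.2 * inner ℝ (perp (regKernelGrad α ε (p.1 - p.2))) (g p.1)) := by
  obtain ⟨M, hM⟩ := exists_norm_regKernelGrad_le (α := α) hα hε
  have hM0 : 0 ≤ M := (norm_nonneg _).trans (hM 0)
  refine integrable_mul_kernel hf (M := M * H) ?_ fun p => ?_
  · exact (continuous_perp.comp ((regKernelGrad_continuous hε).comp
      (continuous_fst.sub continuous_snd))).inner (hg.comp continuous_fst)
  · refine (abs_real_inner_le_norm _ _).trans ?_
    rw [norm_perp]
    exact mul_le_mul (hM _) (hgH _) (norm_nonneg _) hM0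

/-- The gradient of the kernel is odd, so the exchange of the variables changes its sign; the form
is the average of itself and its exchanged version. -/
lemma regForm_eq_symm (hα : 0 < α) (hε : 0 < ε) {g : Plane → Plane} (hg : Continuous g)
    {H : ℝ} (hgH : ∀ x, ‖g x‖ ≤ H) {f : Plane → ℝ} (hf : Integrable f) :
    Integrable (fun p : Plane × Plane => f p.1 * f p.2 *
      (inner ℝ (perp (regKernelGrad α ε (p.1 - p.2))) (g p.1 - g p.2) / 2)) ∧
    regForm α ε g f = ∫ p : Plane × Plane, f p.1 * f p.2 *
      (inner ℝ (perp (regKernelGrad α ε (p.1 - p.2))) (g p.1 - g p.2) / 2) := by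
  have h1 := regForm_integrable hα hε hg hgH hf
  have h2 : Integrable (fun p : Plane × Plane =>
      f p.2 * f p.1 * inner ℝ (perp (regKernelGrad α ε (p.2 - p.1))) (g p.2)) := h1.swap
  have hsw : regForm α ε g f = ∫ p : Plane × Plane, f p.2 * f p.1 *
      inner ℝ (perp (regKernelGrad α ε (p.2 - p.1))) (g p.2) := by
    rw [regForm, Measure.volume_eq_prod, ← integral_prod_swap]; rfl
  have hpt : ∀ p : Plane × Plane, f p.1 * f p.2 *
      (inner ℝ (perp (regKernelGrad α ε (p.1 - p.2))) (g p.1 - g p.2) / 2)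
      = (f p.1 * f p.2 * inner ℝ (perp (regKernelGrad α ε (p.1 - p.2))) (g p.1)
        + f p.2 * f p.1 * inner ℝ (perp (regKernelGrad α ε (p.2 - p.1))) (g p.2)) / 2 := by
    intro p
    rw [show p.2 - p.1 = -(p.1 - p.2) by abel, regKernelGrad_neg, perp_neg, inner_neg_left,
      inner_sub_right]
    ring
  simp only [hpt]
  refine ⟨(h1.add h2).div_const 2, ?_⟩
  rw [integral_div, integral_add h1 h2, ← hsw, ← regForm]
  ring

lemma symm_kernel_le (hα : 0 < α) {g : Plane → Plane} {H : ℝ} (hgH : ∀ x, ‖g x‖ ≤ H)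
    (hgL : ∀ x y, ‖g x - g y‖ ≤ H * ‖x - y‖) (x y : Plane) :
    |inner ℝ (perp (regKernelGrad α ε (x - y))) (g x - g y) / 2|
      ≤ (1 + α) * H * majorant α (x - y) := by
  have hH : 0 ≤ H := (norm_nonneg _).trans (hgH 0)
  have h1 : ‖g x - g y‖ ≤ 2 * H * min ‖x - y‖ 1 := by
    rcases min_cases ‖x - y‖ 1 with h | h <;> rw [h.1]
    · nlinarith [hgL x y, mul_nonneg hH (norm_nonneg (x - y))]
    · linarith [norm_sub_le (g x) (g y), hgH x, hgH y]
  rw [abs_div, abs_two, div_le_iff₀ two_pos, ← rpow_mul_min_eq_majorant hα]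
  refine (abs_real_inner_le_norm _ _).trans ?_
  rw [norm_perp]
  calc _ ≤ ((1 + α) * ‖x - y‖ ^ (-2 - α)) * (2 * H * min ‖x - y‖ 1) :=
        mul_le_mul (norm_regKernelGrad_le hα _) h1 (norm_nonneg _) (by positivity)
    _ = _ := by ring

lemma integral_mul_shift {d k : Plane → ℝ} (hd : Integrable d) (hk : Integrable k) :
    Integrable (fun p : Plane × Plane => d p.2 * k (p.1 - p.2)) ∧
      ∫ p : Plane × Plane, d p.2 * k (p.1 - p.2) = (∫ x, d x) * ∫ x, k x := by
  have h1 : Integrable (fun p : Plane × Plane => d p.2 * k (p.1 - p.2)) := by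
    have := hd.convolution_integrand (ContinuousLinearMap.mul ℝ ℝ) hk
    exact this
  refine ⟨h1, ?_⟩
  rw [Measure.volume_eq_prod, integral_prod_symm _ (by rwa [← Measure.volume_eq_prod])]
  simp_rw [integral_const_mul, integral_sub_right_eq_self]
  rw [integral_mul_const]

/-- After symmetrisation the kernel is dominated, uniformly in `ε`, by an integrable function of `x
- y`. The difference of the products is telescoped into two terms, each with one factor `f₁ - f₂`
and one factor at most `M`, and Fubini separates the two integrals. -/
lemma abs_regForm_sub_le (hα : α ∈ Ioo (0 : ℝ) 1) (hε : 0 < ε) {g : Plane → Plane}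
    (hg : Continuous g) {H : ℝ} (hgH : ∀ x, ‖g x‖ ≤ H)
    (hgL : ∀ x y, ‖g x - g y‖ ≤ H * ‖x - y‖) {f₁ f₂ : Plane → ℝ} (hf₁ : Integrable f₁)
    (hf₂ : Integrable f₂) {M : ℝ} (hM₁ : ∀ x, |f₁ x| ≤ M) (hM₂ : ∀ x, |f₂ x| ≤ M) :
    |regForm α ε g f₁ - regForm α ε g f₂|
      ≤ 2 * M * ((1 + α) * H * ∫ x, majorant α x) * ∫ x, |f₁ x - f₂ x| := by
  obtain ⟨i₁, e₁⟩ := regForm_eq_symm hα.1 hε hg hgH hf₁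
  obtain ⟨i₂, e₂⟩ := regForm_eq_symm hα.1 hε hg hgH hf₂
  have hH : 0 ≤ H := (norm_nonneg _).trans (hgH 0)
  have hM : 0 ≤ M := (abs_nonneg _).trans (hM₁ 0)
  obtain ⟨j, ej⟩ := integral_mul_shift (hf₁.sub hf₂).abs (integrable_majorant hα)
  have j' : Integrable (fun p : Plane × Plane =>
      |(f₁ - f₂) p.1| * majorant α (p.1 - p.2)) := by
    refine j.swap.congr (ae_of_all _ fun p => ?_)
    simp only [Function.comp, Prod.fst_swap, Prod.snd_swap]
    rw [← majorant_neg, neg_sub]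
  have ej' : ∫ p : Plane × Plane, |(f₁ - f₂) p.1| * majorant α (p.1 - p.2)
      = (∫ x, |(f₁ - f₂) x|) * ∫ x, majorant α x := by
    rw [← ej, Measure.volume_eq_prod, ← integral_prod_swap]
    refine integral_congr_ae (ae_of_all _ fun p => ?_)
    simp only [Prod.fst_swap, Prod.snd_swap]
    rw [← majorant_neg, neg_sub]
  rw [e₁, e₂, ← integral_sub i₁ i₂, ← Real.norm_eq_abs]
  refine (norm_integral_le_of_norm_le ((j'.add j).const_mul (M * ((1 + α) * H)))
    (ae_of_all _ fun p => ?_)).trans ?_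
  · rw [← sub_mul, norm_mul, Real.norm_eq_abs, Real.norm_eq_abs]
    have h1 : |f₁ p.1 * f₁ p.2 - f₂ p.1 * f₂ p.2|
        ≤ M * (|(f₁ - f₂) p.1| + |(f₁ - f₂) p.2|) := by
      have : f₁ p.1 * f₁ p.2 - f₂ p.1 * f₂ p.2
          = (f₁ p.1 - f₂ p.1) * f₁ p.2 + f₂ p.1 * (f₁ p.2 - f₂ p.2) := by ring
      rw [this]
      refine (abs_add_le _ _).trans ?_
      rw [abs_mul, abs_mul, mul_add]
      refine add_le_add ?_ ?_
      · rw [mul_comm M]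
        exact mul_le_mul_of_nonneg_left (hM₁ _) (abs_nonneg _)
      · exact mul_le_mul_of_nonneg_right (hM₂ _) (abs_nonneg _)
    refine (mul_le_mul h1 (symm_kernel_le hα.1 hgH hgL _ _) (abs_nonneg _) (by positivity)).trans
      (le_of_eq ?_)
    simp only [Pi.add_apply]
    ring
  · have : ∫ p : Plane × Plane, M * ((1 + α) * H) *
        ((fun p : Plane × Plane => |(f₁ - f₂) p.1| * majorant α (p.1 - p.2)) +
        fun p : Plane × Plane => |(f₁ - f₂) p.2| * majorant α (p.1 - p.2)) p
        = 2 * M * ((1 + α) * H * ∫ x, majorant α x) * ∫ x, |(f₁ - f₂) x| := by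
      rw [integral_const_mul, integral_add' j' j, ej, ej']
      ring
    exact this.le

end Form

end AlmostSharpFront

/-! ### The form of an indicator as a double boundary integral -/

namespace AlmostSharpFront

namespace Bounds

variable {γ : ℝ → Plane} {A : Set Plane}

/-- The integral of a Jacobian determinant over `A` as a boundary integral. -/
lemma integral_jacobian (h : Bounds γ A) {f k : Plane → ℝ} (hf : ContDiff ℝ 1 f)
    (hk : ContDiff ℝ 2 k) :
    ∫ x in A, (fderiv ℝ f x (planeEquiv (1, 0)) * fderiv ℝ k x (planeEquiv (0, 1))
        - fderiv ℝ f x (planeEquiv (0, 1)) * fderiv ℝ k x (planeEquiv (1, 0)))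
      = ∫ s in (-1 / 2 : ℝ)..(1 / 2), f (γ s) * fderiv ℝ k (γ s) (deriv γ s) := by
  set e₀ := planeEquiv (1, 0) with he₀
  set e₁ := planeEquiv (0, 1) with he₁
  have hdk : ∀ v, ContDiff ℝ 1 (fun x => fderiv ℝ k x v) := fun v =>
    (hk.fderiv_right (m := 1) (by norm_num)).clm_apply contDiff_const
  have hd : ∀ v u x, fderiv ℝ (fun x => f x * fderiv ℝ k x v) x u
      = f x * fderiv ℝ (fderiv ℝ k) x u v + fderiv ℝ f x u * fderiv ℝ k x v := by
    intro v u x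
    have h1 : HasFDerivAt (fun x => fderiv ℝ k x v)
        ((fderiv ℝ (fderiv ℝ k) x).flip v) x := by
      have := ((hk.fderiv_right (m := 1) (by norm_num)).differentiable (by norm_num) x).hasFDerivAt
      simpa using this.clm_apply (hasFDerivAt_const v x)
    have h2 : HasFDerivAt (fun x => f x * fderiv ℝ k x v) _ x :=
      (hf.differentiable (by norm_num) x).hasFDerivAt.mul h1
    rw [h2.fderiv]
    simp [mul_comm]
  have hsymm : ∀ x, fderiv ℝ (fderiv ℝ k) x e₀ e₁ = fderiv ℝ (fderiv ℝ k) x e₁ e₀ := fun x =>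
    (hk.contDiffAt.isSymmSndFDerivAt (by simp)) e₀ e₁
  have hg := fun v => hf.mul (hdk v)
  have hi : ∀ v u, IntegrableOn (fun x => fderiv ℝ (fun x => f x * fderiv ℝ k x v) x u) A :=
    fun v u => h.integrableOn_of_continuous
      (((hg v).continuous_fderiv (by norm_num)).clm_apply continuous_const)
  -- The Jacobian determinant is a divergence: the second derivatives of `k` cancel by symmetry.
  have hpt : ∀ x, fderiv ℝ f x e₀ * fderiv ℝ k x e₁ - fderiv ℝ f x e₁ * fderiv ℝ k x e₀
      = fderiv ℝ (fun x => f x * fderiv ℝ k x e₁) x e₀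
        - fderiv ℝ (fun x => f x * fderiv ℝ k x e₀) x e₁ := by
    intro x; rw [hd, hd, hsymm]; ring
  simp_rw [hpt]
  have hc : ∀ v u, Continuous fun s =>
      f (γ s) * fderiv ℝ k (γ s) v * inner ℝ u (perp (deriv γ s)) := fun v u =>
    ((hg v).continuous.comp h.differentiable.continuous).mul
      (continuous_const.inner (continuous_perp.comp h.continuous_deriv))
  rw [integral_sub (hi _ _) (hi _ _), h.integral_fderiv_eq (hg _), h.integral_fderiv_eq (hg _),
    sub_neg_eq_add, neg_add_eq_sub, ← intervalIntegral.integral_sub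
      ((hc _ _).intervalIntegrable _ _) ((hc _ _).intervalIntegrable _ _)]
  refine intervalIntegral.integral_congr fun s _ => ?_
  have hγ : deriv γ s = (deriv γ s 0) • e₀ + (deriv γ s 1) • e₁ := by
    ext i; fin_cases i <;> simp [he₀, he₁]
  have h3 : fderiv ℝ k (γ s) (deriv γ s)
      = deriv γ s 0 * fderiv ℝ k (γ s) e₀ + deriv γ s 1 * fderiv ℝ k (γ s) e₁ := by
    conv_lhs => rw [hγ]
    simp
  simp only [h3, inner_perp_eq_cross]
  simp [cross, he₀, he₁]
  ring

lemma continuous (h : Bounds γ A) : Continuous γ := h.differentiable.continuous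

/-- The regularised quadratic form of the indicator of `A` as a double boundary integral. -/
lemma regForm_indicator (h : Bounds γ A) {α ε : ℝ} (hα : 0 < α) (hε : 0 < ε) {ψ : Plane → ℝ}
    (hψ : ContDiff ℝ 1 ψ) {H : ℝ} (hψH : ∀ x, ‖gradient ψ x‖ ≤ H) :
    regForm α ε (gradient ψ) (A.indicator 1)
      = ∫ s in (-1 / 2 : ℝ)..(1 / 2), ψ (γ s) * ∫ s' in (-1 / 2 : ℝ)..(1 / 2),
          regKernel α ε (γ s - γ s') * inner ℝ (deriv γ s' - deriv γ s) (perp (deriv γ s)) := by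
  have hgc : Continuous (gradient ψ) :=
    (InnerProductSpace.toDual ℝ Plane).symm.continuous.comp (hψ.continuous_fderiv (by norm_num))
  have hA1 : Integrable (A.indicator (1 : Plane → ℝ)) :=
    (integrable_indicator_iff h.isOpen.measurableSet).2
      (integrableOn_const h.volume_lt_top.ne)
  have hint := regForm_integrable hα hε hgc hψH hA1
  have hKd : ∀ x v, fderiv ℝ (regKernel α ε) x v = inner ℝ (regKernelGrad α ε x) v := by
    intro x v; rw [(regKernel_hasFDerivAt hε x).fderiv]; rfl
  have step1 : regForm α ε (gradient ψ) (A.indicator 1)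
      = ∫ y in A, ∫ x in A, inner ℝ (perp (regKernelGrad α ε (x - y))) (gradient ψ x) := by
    rw [regForm, Measure.volume_eq_prod, integral_prod_symm _ hint,
      ← integral_indicator h.isOpen.measurableSet]
    congr 1; ext y
    by_cases hy : y ∈ A
    · rw [indicator_of_mem hy, ← integral_indicator h.isOpen.measurableSet]
      congr 1; ext x
      by_cases hx : x ∈ A <;> simp [hx, hy]
    · simp [hy]
  -- For fixed `y` the integrand is minus the Jacobian of `ψ` and the shifted kernel, so the
  -- gradient of `ψ` is traded for boundary values of `ψ` and a derivative of the kernel along the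
  -- curve.
  have step2 : ∀ y, ∫ x in A, inner ℝ (perp (regKernelGrad α ε (x - y))) (gradient ψ x)
      = -∫ s in (-1 / 2 : ℝ)..(1 / 2),
          ψ (γ s) * inner ℝ (regKernelGrad α ε (γ s - y)) (deriv γ s) := by
    intro y
    have hk : ContDiff ℝ 2 (fun x => regKernel α ε (x - y)) :=
      (regKernel_contDiff hε).comp (contDiff_id.sub contDiff_const)
    have hkd : ∀ x v, fderiv ℝ (fun x => regKernel α ε (x - y)) x v
        = inner ℝ (regKernelGrad α ε (x - y)) v := by
      intro x v; rw [fderiv_comp_sub, hKd]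
    have := h.integral_jacobian hψ hk
    simp only [hkd] at this
    rw [← this, ← integral_neg]
    refine setIntegral_congr_fun h.isOpen.measurableSet fun x _ => ?_
    have hgr : ∀ v, fderiv ℝ ψ x v = inner ℝ (gradient ψ x) v := fun v => by
      simp [gradient]
    simp only [hgr, inner_plane]
    simp
    ring
  -- What remains is the integral in `y` of a derivative in the fixed direction `deriv γ s`, so the
  -- divergence theorem applies again. Subtracting `deriv γ s` is free, as it is orthogonal to its
  -- own rotation.
  have step3 : ∀ s, ∫ y in A, inner ℝ (regKernelGrad α ε (γ s - y)) (deriv γ s)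
      = -∫ s' in (-1 / 2 : ℝ)..(1 / 2),
          regKernel α ε (γ s - γ s') * inner ℝ (deriv γ s' - deriv γ s) (perp (deriv γ s)) := by
    intro s
    have hk : ContDiff ℝ 1 (fun y => regKernel α ε (γ s - y)) :=
      (regKernel_contDiff hε).comp (contDiff_const.sub contDiff_id)
    have := h.integral_fderiv_eq hk (deriv γ s)
    have hkd : ∀ y v, fderiv ℝ (fun y => regKernel α ε (γ s - y)) y v
        = -inner ℝ (regKernelGrad α ε (γ s - y)) v := by
      intro y v
      have h1 : HasFDerivAt (fun y => γ s - y) (-ContinuousLinearMap.id ℝ Plane) y :=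
        (hasFDerivAt_id y).const_sub _
      have h2 : HasFDerivAt (fun y => regKernel α ε (γ s - y)) _ y :=
        (regKernel_hasFDerivAt hε (γ s - y)).comp y h1
      rw [h2.fderiv]
      simp
    simp only [hkd, integral_neg, neg_inj] at this
    rw [this, ← intervalIntegral.integral_neg]
    refine intervalIntegral.integral_congr fun s' _ => ?_
    simp only [inner_perp_eq_cross]
    simp [cross]
    ring
  have hRc := regKernelGrad_continuous (α := α) hε
  rw [step1]
  simp_rw [step2]
  rw [integral_neg]
  simp_rw [intervalIntegral.integral_of_le (show (-1 / 2 : ℝ) ≤ 1 / 2 by norm_num)] at step3 ⊢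
  rw [integral_integral_swap]
  · simp_rw [integral_const_mul, step3]
    rw [← integral_neg]
    congr 1; ext s; ring
  · have hc : Continuous (fun p : Plane × ℝ =>
        ψ (γ p.2) * inner ℝ (regKernelGrad α ε (γ p.2 - p.1)) (deriv γ p.2)) := by
      have h1 := h.continuous.comp (continuous_snd (X := Plane) (Y := ℝ))
      exact (hψ.continuous.comp h1).mul ((hRc.comp (h1.sub continuous_fst)).inner
        (h.continuous_deriv.comp continuous_snd))
    rw [Measure.prod_restrict, ← Measure.volume_eq_prod]
    exact (hc.continuousOn.integrableOn_compact
      (h.isCompact_closure.prod (isCompact_Icc (a := (-1 / 2 : ℝ)) (b := 1 / 2)))).mono_set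
      (prod_mono subset_closure Ioc_subset_Icc_self)

end Bounds

end AlmostSharpFront

/-! ### Distance on the circle and arc-chord bounds -/

namespace AlmostSharpFront

/-- The distance of `u` to the nearest integer. -/
noncomputable def distInt (u : ℝ) : ℝ := |u - round u|

lemma distInt_nonneg (u : ℝ) : 0 ≤ distInt u := abs_nonneg _

lemma distInt_le_half (u : ℝ) : distInt u ≤ 1 / 2 := abs_sub_round u

lemma distInt_periodic : Function.Periodic distInt 1 := by
  intro u
  simp only [distInt, round_add_one]
  push_cast
  congr 1; ring

lemma distInt_of_mem {u : ℝ} (hu : u ∈ Ioo (-1 / 2 : ℝ) (1 / 2)) : distInt u = |u| := by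
  have : round u = 0 := by
    rw [round_eq, Int.floor_eq_iff]; constructor <;> push_cast <;> linarith [hu.1, hu.2]
  simp [distInt, this]

section

variable {α : ℝ}

lemma intervalIntegrable_distInt_rpow (hα : α < 1) (a b : ℝ) :
    IntervalIntegrable (fun u => distInt u ^ (-α)) volume a b := by
  have hp : Function.Periodic (fun u => distInt u ^ (-α)) 1 := fun u => by
    simp only [distInt_periodic u]
  refine hp.intervalIntegrable one_ne_zero (t := -1 / 2) ?_ a b
  have h1 : IntervalIntegrable (fun u : ℝ => |u| ^ (-α)) volume (-1 / 2) (1 / 2) := by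
    have hr : IntervalIntegrable (fun u : ℝ => |u| ^ (-α)) volume 0 (1 / 2) := by
      refine (intervalIntegral.intervalIntegrable_rpow' (r := -α) (by linarith)).congr ?_
      intro u hu
      rw [uIoc_of_le (by norm_num)] at hu
      simp only [abs_of_pos hu.1]
    have hl := ((IntervalIntegrable.iff_comp_neg).1 hr).symm
    simp only [abs_neg, neg_zero] at hl
    rw [show -(1 / 2 : ℝ) = -1 / 2 by ring] at hl
    exact hl.trans hr
  rw [show (-1 / 2 : ℝ) + 1 = 1 / 2 by norm_num]
  rw [intervalIntegrable_iff, uIoc_of_le (by norm_num), integrableOn_Ioc_iff_integrableOn_Ioo]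
  rw [intervalIntegrable_iff, uIoc_of_le (by norm_num), integrableOn_Ioc_iff_integrableOn_Ioo] at h1
  refine h1.congr_fun (fun u hu => ?_) measurableSet_Ioo
  simp only [distInt_of_mem hu]

lemma intervalIntegrable_distInt_sub_rpow (hα : α < 1) (s a b : ℝ) :
    IntervalIntegrable (fun s' => distInt (s - s') ^ (-α)) volume a b := by
  have := (intervalIntegrable_distInt_rpow hα (s - a) (s - b)).comp_sub_left s
  simpa using this

lemma integral_distInt_sub_rpow (s : ℝ) :
    ∫ s' in (-1 / 2 : ℝ)..(1 / 2), distInt (s - s') ^ (-α)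
      = ∫ u in (-1 / 2 : ℝ)..(1 / 2), distInt u ^ (-α) := by
  have hp : Function.Periodic (fun u => distInt u ^ (-α)) 1 := fun u => by
    simp only [distInt_periodic u]
  rw [intervalIntegral.integral_comp_sub_left (fun u => distInt u ^ (-α)),
    Bounds.intervalIntegral_shift hp s]
  congr 1; ring

end

namespace Bounds

variable {γ : ℝ → Plane} {A : Set Plane} {B : ℝ}

lemma norm_deriv_eq (h : Bounds γ A) (s s' : ℝ) : ‖deriv γ s‖ = ‖deriv γ s'‖ := by
  obtain ⟨L, -, hL⟩ := h.uniform_speed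
  rw [hL, hL]

lemma norm_deriv_sub_le (h : Bounds γ A)
    (hB2 : ∀ s, ‖deriv (deriv γ) s‖ ≤ B * ‖deriv γ s‖ ^ 2) (s s' : ℝ) :
    ‖deriv γ s - deriv γ s'‖ ≤ B * ‖deriv γ 0‖ ^ 2 * |s - s'| := by
  have hd : Differentiable ℝ (deriv γ) :=
    ((contDiff_succ_iff_deriv (n := 1)).1 h.contDiff).2.2.differentiable (by norm_num)
  have := (convex_univ (𝕜 := ℝ) (E := ℝ)).norm_image_sub_le_of_norm_deriv_le (f := deriv γ)
    (C := B * ‖deriv γ 0‖ ^ 2) (fun x _ => hd x)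
    (fun x _ => by rw [← h.norm_deriv_eq x 0]; exact hB2 x) (mem_univ s') (mem_univ s)
  simpa using this

lemma norm_sub_sub_smul_le (h : Bounds γ A) (hB : 0 ≤ B)
    (hB2 : ∀ s, ‖deriv (deriv γ) s‖ ≤ B * ‖deriv γ s‖ ^ 2) (s s' : ℝ) :
    ‖γ s - γ s' - (s - s') • deriv γ s'‖ ≤ B * ‖deriv γ 0‖ ^ 2 * |s - s'| * |s - s'| := by
  have hD : ∀ x, HasDerivAt (fun x => γ x - (x - s') • deriv γ s') (deriv γ x - deriv γ s') x := by
    intro x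
    have h1 : HasDerivAt (fun x => (x - s') • deriv γ s') ((1 : ℝ) • deriv γ s') x :=
      ((hasDerivAt_id x).sub_const s').smul_const (deriv γ s')
    rw [one_smul] at h1
    exact (h.hasDerivAt x).sub h1
  have := (convex_uIcc s' s).norm_image_sub_le_of_norm_hasDerivWithin_le
    (f := fun x => γ x - (x - s') • deriv γ s') (C := B * ‖deriv γ 0‖ ^ 2 * |s - s'|)
    (fun x _ => (hD x).hasDerivWithinAt) (fun x hx => by
      refine (h.norm_deriv_sub_le hB2 x s').trans ?_
      exact mul_le_mul_of_nonneg_left (abs_sub_left_of_mem_uIcc hx) (by positivity))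
    left_mem_uIcc right_mem_uIcc
  simp only [sub_self, zero_smul, sub_zero] at this
  rwa [show γ s - γ s' - (s - s') • deriv γ s' = γ s - (s - s') • deriv γ s' - γ s' by abel]

/-- Taylor expansion over a full period: as `γ 1 = γ 0`, the linear term, of length $L$, is at most
the remainder $BL^2$. So a closed curve of curvature at most $B$ has length at least $1/B$. -/
lemma one_le_mul_norm_deriv (h : Bounds γ A) (hB : 0 ≤ B)
    (hB2 : ∀ s, ‖deriv (deriv γ) s‖ ≤ B * ‖deriv γ s‖ ^ 2) : 1 ≤ B * ‖deriv γ 0‖ := by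
  have h1 := h.norm_sub_sub_smul_le hB hB2 1 0
  have h2 : γ 1 = γ 0 := by simpa using h.periodic 0
  have h0 : 0 < ‖deriv γ 0‖ := norm_pos_iff.2 (h.deriv_ne_zero 0)
  simp only [h2, sub_self, sub_zero, one_smul, zero_sub, norm_neg, abs_one, mul_one] at h1
  by_contra hlt
  nlinarith

lemma speed_pos_const (h : Bounds γ A) (hB1 : ∀ s, ‖deriv γ s‖ ≤ B) : 0 < B :=
  (norm_pos_iff.2 (h.deriv_ne_zero 0)).trans_le (hB1 0)

/-- On short arcs the curve is quantitatively injective. -/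
lemma half_speed_mul_le (h : Bounds γ A) (hB1 : ∀ s, ‖deriv γ s‖ ≤ B)
    (hB2 : ∀ s, ‖deriv (deriv γ) s‖ ≤ B * ‖deriv γ s‖ ^ 2) {s s' : ℝ}
    (hs : |s - s'| ≤ 1 / (2 * B ^ 2)) :
    ‖deriv γ 0‖ / 2 * |s - s'| ≤ ‖γ s - γ s'‖ := by
  have hB := h.speed_pos_const hB1
  have h1 := h.norm_sub_sub_smul_le hB.le hB2 s s'
  have h2 : ‖(s - s') • deriv γ s'‖ = |s - s'| * ‖deriv γ 0‖ := by
    rw [norm_smul, h.norm_deriv_eq s' 0, Real.norm_eq_abs]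
  have h3 : ‖(s - s') • deriv γ s'‖ ≤ ‖γ s - γ s'‖ + ‖γ s - γ s' - (s - s') • deriv γ s'‖ := by
    have := norm_sub_norm_le ((s - s') • deriv γ s') (γ s - γ s')
    rw [norm_sub_rev ((s - s') • deriv γ s')] at this
    linarith
  -- The Taylor remainder is at most half of the linear term: since $L\le B$, $BL^2|s-s'|\le
  -- B^2|s-s'|\,L\le L/2$.
  have h4 : B * ‖deriv γ 0‖ ^ 2 * |s - s'| ≤ ‖deriv γ 0‖ / 2 := by
    have h5 : B ^ 2 * |s - s'| ≤ 1 / 2 := by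
      rw [le_div_iff₀ (by positivity)] at hs; linarith
    have h6 : B * ‖deriv γ 0‖ ^ 2 * |s - s'| ≤ (B ^ 2 * |s - s'|) * ‖deriv γ 0‖ := by
      have := hB1 0
      have h7 : 0 ≤ B * |s - s'| * ‖deriv γ 0‖ := by positivity
      nlinarith
    have := norm_nonneg (deriv γ 0)
    nlinarith
  have h5 := abs_nonneg (s - s')
  nlinarith

lemma sub_round_eq (h : Bounds γ A) (s s' : ℝ) :
    ∃ s'', γ s'' = γ s' ∧ deriv γ s'' = deriv γ s' ∧ |s - s''| = distInt (s - s') := by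
  refine ⟨s' + round (s - s'), ?_, ?_, ?_⟩
  · simpa using h.periodic.int_mul (round (s - s')) s'
  · simpa using h.periodic_deriv.int_mul (round (s - s')) s'
  · rw [distInt]; congr 1; ring

/-- By periodicity `s'` may be replaced by its integer translate nearest to `s`; the constant is
$BL^2\le B^3$. -/
lemma norm_deriv_sub_le_distInt (h : Bounds γ A) (hB1 : ∀ s, ‖deriv γ s‖ ≤ B)
    (hB2 : ∀ s, ‖deriv (deriv γ) s‖ ≤ B * ‖deriv γ s‖ ^ 2) (s s' : ℝ) :
    ‖deriv γ s' - deriv γ s‖ ≤ B ^ 3 * distInt (s - s') := by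
  obtain ⟨s'', -, h2, h3⟩ := h.sub_round_eq s s'
  rw [← h2, ← h3, norm_sub_rev]
  refine (h.norm_deriv_sub_le hB2 s s'').trans ?_
  have hB := h.speed_pos_const hB1
  have : B * ‖deriv γ 0‖ ^ 2 ≤ B ^ 3 := by
    have := pow_le_pow_left₀ (norm_nonneg _) (hB1 0) 2
    nlinarith
  exact mul_le_mul_of_nonneg_right this (abs_nonneg _)

end Bounds

/-- A uniform arc-chord bound on compact time sets. -/
lemma exists_arc_chord {z : ℝ → ℝ → Plane} {A : ℝ → Set Plane} {B : ℝ} {J : Set ℝ}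
    (hJ : IsCompact J) (hz : ContinuousOn (fun p : ℝ × ℝ => z p.1 p.2) (J ×ˢ univ))
    (h : ∀ t ∈ J, Bounds (z t) (A t)) (hB1 : ∀ t ∈ J, ∀ s, ‖deriv (z t) s‖ ≤ B)
    (hB2 : ∀ t ∈ J, ∀ s, ‖deriv (deriv (z t)) s‖ ≤ B * ‖deriv (z t) s‖ ^ 2) :
    ∃ c > 0, ∀ t ∈ J, ∀ s s', c * distInt (s - s') ≤ ‖z t s - z t s'‖ := by
  rcases J.eq_empty_or_nonempty with rfl | ⟨t₀, ht₀⟩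
  · exact ⟨1, one_pos, by simp⟩
  have hB : 0 < B := (h t₀ ht₀).speed_pos_const (hB1 t₀ ht₀)
  set η := 1 / (2 * B ^ 2) with hη
  -- Pairs that are not close on the circle form a compact set, on which simplicity of the curve
  -- keeps the chord positive. One parameter lies in a period and the other within `1 / 2` of it,
  -- hence in `[-1, 2]`.
  set S : Set (ℝ × ℝ × ℝ) := {p | p.1 ∈ J ∧ p.2.1 ∈ Icc (0 : ℝ) 1 ∧
    p.2.2 ∈ Icc (-1 : ℝ) 2 ∧ η ≤ |p.2.1 - p.2.2| ∧ |p.2.1 - p.2.2| ≤ 1 / 2} with hS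
  have hScomp : IsCompact S := by
    have hcl : IsClosed ({p : ℝ × ℝ × ℝ | η ≤ |p.2.1 - p.2.2|} ∩
        {p : ℝ × ℝ × ℝ | |p.2.1 - p.2.2| ≤ 1 / 2}) :=
      (isClosed_le (by fun_prop) (by fun_prop)).inter (isClosed_le (by fun_prop) (by fun_prop))
    have := (hJ.prod ((isCompact_Icc (a := (0 : ℝ)) (b := 1)).prod
      (isCompact_Icc (a := (-1 : ℝ)) (b := 2)))).inter_right hcl
    convert this using 1
    ext p
    simp only [hS, mem_ofPred_eq, mem_inter_iff, mem_prod]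
    tauto
  have hcont : ContinuousOn (fun p : ℝ × ℝ × ℝ => ‖z p.1 p.2.1 - z p.1 p.2.2‖) S := by
    refine ContinuousOn.norm (ContinuousOn.sub ?_ ?_)
    · exact hz.comp (f := fun p : ℝ × ℝ × ℝ => (p.1, p.2.1)) (by fun_prop)
        (fun p hp => ⟨hp.1, mem_univ _⟩)
    · exact hz.comp (f := fun p : ℝ × ℝ × ℝ => (p.1, p.2.2)) (by fun_prop)
        (fun p hp => ⟨hp.1, mem_univ _⟩)
  have hmin : ∃ m > 0, ∀ p ∈ S, m ≤ ‖z p.1 p.2.1 - z p.1 p.2.2‖ := by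
    rcases S.eq_empty_or_nonempty with he | hne
    · exact ⟨1, one_pos, by simp [he]⟩
    · obtain ⟨p, hp, hpm⟩ := hScomp.exists_isMinOn hne hcont
      refine ⟨_, ?_, fun q hq => hpm hq⟩
      rw [gt_iff_lt, norm_pos_iff, sub_ne_zero]
      intro heq
      have := (h p.1 hp.1).eq_of_abs_sub_lt heq (hp.2.2.2.2.trans_lt (by norm_num))
      have h4 := hp.2.2.2.1
      rw [this, sub_self, abs_zero] at h4
      have : 0 < η := by positivity
      linarith
  obtain ⟨m, hm, hmS⟩ := hmin
  -- On short arcs the factor is half the speed, which is at least `1 / (2 * B)`; otherwise the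
  -- chord is at least `m` and the parameter distance is at most one.
  refine ⟨min (1 / (2 * B)) m, by positivity, fun t ht s s' => ?_⟩
  have hbt := h t ht
  have hfr : z t (Int.fract s) = z t s := by
    have := hbt.periodic.sub_int_mul_eq (x := s) ⌊s⌋
    rwa [mul_one] at this
  have hdf : distInt (s - s') = distInt (Int.fract s - s') := by
    have := distInt_periodic.sub_int_mul_eq (x := s - s') ⌊s⌋
    rw [← this, Int.fract]; congr 1; ring
  rw [hdf, ← hfr]
  obtain ⟨s'', h2, -, h3⟩ := hbt.sub_round_eq (Int.fract s) s'
  rw [← h2, ← h3]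
  by_cases hle : |Int.fract s - s''| ≤ η
  · refine le_trans ?_ (hbt.half_speed_mul_le (hB1 t ht) (hB2 t ht) hle)
    refine mul_le_mul_of_nonneg_right ((min_le_left _ _).trans ?_) (abs_nonneg _)
    have := hbt.one_le_mul_norm_deriv hB.le (hB2 t ht)
    rw [div_le_div_iff₀ (by positivity) two_pos]
    linarith
  · have h4 : |Int.fract s - s''| ≤ 1 / 2 := h3 ▸ distInt_le_half _
    have h5 := Int.fract_nonneg s
    have h6 := Int.fract_lt_one s
    have h7 := abs_le.1 h4
    have := hmS (t, Int.fract s, s'') ⟨ht, ⟨h5, h6.le⟩, ⟨by linarith, by linarith⟩,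
      (not_le.1 hle).le, h4⟩
    refine le_trans ?_ this
    have h8 : min (1 / (2 * B)) m ≤ m := min_le_right _ _
    have h9 := abs_nonneg (Int.fract s - s'')
    nlinarith

/-! ### The sharp-front integral and the limit of the form on an indicator -/

section Front

variable {γ : ℝ → Plane} {A : Set Plane} {α c D : ℝ}

/-- With $d$ the distance on the circle, the kernel costs $d^{-1-\alpha}$ by the arc-chord bound and
the difference of the tangents gains a factor $d$. At $d=0$ the tangents coincide and both sides
vanish. -/
lemma norm_frontIntegrand_le (hα : 0 < α) (hc : 0 < c)
    (hac : ∀ s s', c * distInt (s - s') ≤ ‖γ s - γ s'‖)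
    (hD : ∀ s s', ‖deriv γ s' - deriv γ s‖ ≤ D * distInt (s - s')) (s s' : ℝ) :
    kernelK α (γ s - γ s') * ‖deriv γ s' - deriv γ s‖
      ≤ c ^ (-1 - α) * D * distInt (s - s') ^ (-α) := by
  have h0 := distInt_nonneg (s - s')
  rcases h0.eq_or_lt with h0 | h0
  · have h1 := hD s s'
    rw [← h0, mul_zero] at h1
    rw [le_antisymm h1 (norm_nonneg _), mul_zero, ← h0, Real.zero_rpow (by linarith), mul_zero]
  · have hpos : 0 < c * distInt (s - s') := by positivity
    have hk : kernelK α (γ s - γ s') ≤ c ^ (-1 - α) * distInt (s - s') ^ (-1 - α) := by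
      rw [kernelK, ← Real.mul_rpow hc.le h0.le]
      exact Real.rpow_le_rpow_of_nonpos hpos (hac s s') (by linarith)
    refine (mul_le_mul hk (hD s s') (norm_nonneg _) (by positivity)).trans (le_of_eq ?_)
    have : distInt (s - s') ^ (-α) = distInt (s - s') ^ (-1 - α) * distInt (s - s') := by
      rw [show -α = (-1 - α) + 1 by ring, Real.rpow_add_one h0.ne']
    rw [this]; ring

lemma measurable_frontIntegrand (h : Bounds γ A) (s : ℝ) :
    Measurable (frontIntegrand α γ s) := by
  exact (kernelK_measurable.comp (measurable_const.sub h.continuous.measurable)).smul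
    (h.continuous_deriv.measurable.sub measurable_const)

lemma intervalIntegrable_frontIntegrand (h : Bounds γ A) (hα : α ∈ Ioo (0 : ℝ) 1) (hc : 0 < c)
    (hac : ∀ s s', c * distInt (s - s') ≤ ‖γ s - γ s'‖)
    (hD : ∀ s s', ‖deriv γ s' - deriv γ s‖ ≤ D * distInt (s - s')) (s : ℝ) :
    IntervalIntegrable (frontIntegrand α γ s) volume (-1 / 2) (1 / 2) := by
  refine ((intervalIntegrable_distInt_sub_rpow hα.2 s (-1 / 2) (1 / 2)).const_mul
    (c ^ (-1 - α) * D)).mono_fun (measurable_frontIntegrand h s).aestronglyMeasurable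
    (ae_of_all _ fun s' => ?_)
  simp only [frontIntegrand, norm_smul, Real.norm_of_nonneg (kernelK_nonneg _)]
  exact (norm_frontIntegrand_le hα.1 hc hac hD s s').trans (le_abs_self _)

lemma norm_frontIntegral_le (hα : α ∈ Ioo (0 : ℝ) 1) (hc : 0 < c)
    (hac : ∀ s s', c * distInt (s - s') ≤ ‖γ s - γ s'‖)
    (hD : ∀ s s', ‖deriv γ s' - deriv γ s‖ ≤ D * distInt (s - s')) (s : ℝ) :
    ‖frontIntegral α γ s‖
      ≤ c ^ (-1 - α) * D * ∫ u in (-1 / 2 : ℝ)..(1 / 2), distInt u ^ (-α) := by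
  rw [frontIntegral, ← integral_distInt_sub_rpow s, ← intervalIntegral.integral_const_mul]
  refine intervalIntegral.norm_integral_le_of_norm_le (by norm_num) (ae_of_all _ fun s' _ => ?_)
    ((intervalIntegrable_distInt_sub_rpow hα.2 s _ _).const_mul _)
  rw [frontIntegrand, norm_smul, Real.norm_of_nonneg (kernelK_nonneg _)]
  exact norm_frontIntegrand_le hα.1 hc hac hD s s'

/-- The regularised quadratic form of a region converges to the sharp-front integral. -/
lemma tendsto_regForm_indicator (h : Bounds γ A) (hα : α ∈ Ioo (0 : ℝ) 1) (hc : 0 < c)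
    (hac : ∀ s s', c * distInt (s - s') ≤ ‖γ s - γ s'‖)
    (hD : ∀ s s', ‖deriv γ s' - deriv γ s‖ ≤ D * distInt (s - s')) {ψ : Plane → ℝ}
    (hψ : ContDiff ℝ 1 ψ) {H : ℝ} (hψH : ∀ x, ‖gradient ψ x‖ ≤ H) :
    Tendsto (fun ε => regForm α ε (gradient ψ) (A.indicator 1)) (𝓝[>] 0)
      (𝓝 (∫ s in (-1 / 2 : ℝ)..(1 / 2),
        ψ (γ s) * inner ℝ (frontIntegral α γ s) (perp (deriv γ s)))) := by
  set P₀ := ∫ u in (-1 / 2 : ℝ)..(1 / 2), distInt u ^ (-α) with hP₀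
  set f : ℝ → ℝ → ℝ := fun ε s => ∫ s' in (-1 / 2 : ℝ)..(1 / 2),
    regKernel α ε (γ s - γ s') * inner ℝ (deriv γ s' - deriv γ s) (perp (deriv γ s)) with hf
  have hbd : ∀ ε s s', ‖regKernel α ε (γ s - γ s') *
      inner ℝ (deriv γ s' - deriv γ s) (perp (deriv γ s))‖
      ≤ ‖deriv γ 0‖ * (c ^ (-1 - α) * D) * distInt (s - s') ^ (-α) := by
    intro ε s s'
    rw [norm_mul, Real.norm_of_nonneg (regKernel_nonneg _)]
    have h1 : ‖inner ℝ (deriv γ s' - deriv γ s) (perp (deriv γ s))‖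
        ≤ ‖deriv γ s' - deriv γ s‖ * ‖deriv γ 0‖ := by
      refine (norm_inner_le_norm _ _).trans (le_of_eq ?_)
      rw [norm_perp, h.norm_deriv_eq s 0]
    have h2 := norm_frontIntegrand_le hα.1 hc hac hD s s'
    -- At coinciding points `regKernel_le` is not available, but there the tangents agree and the
    -- integrand is zero.
    rcases eq_or_ne (γ s - γ s') 0 with h0 | h0
    · obtain ⟨n, hn⟩ := h.exists_int_of_eq (sub_eq_zero.1 h0)
      have : deriv γ s' = deriv γ s := by
        rw [hn]; simpa using (h.periodic_deriv.int_mul n s').symm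
      rw [this, sub_self, inner_zero_left, norm_zero, mul_zero]
      have hDn : 0 ≤ c ^ (-1 - α) * D * distInt (s - s') ^ (-α) :=
        le_trans (mul_nonneg (kernelK_nonneg _) (norm_nonneg _)) h2
      have := mul_nonneg (norm_nonneg (deriv γ 0)) hDn
      linarith
    · calc _ ≤ kernelK α (γ s - γ s') * (‖deriv γ s' - deriv γ s‖ * ‖deriv γ 0‖) :=
            mul_le_mul (regKernel_le hα.1 h0) h1 (norm_nonneg _) (kernelK_nonneg _)
        _ = ‖deriv γ 0‖ * (kernelK α (γ s - γ s') * ‖deriv γ s' - deriv γ s‖) := by ring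
        _ ≤ ‖deriv γ 0‖ * (c ^ (-1 - α) * D * distInt (s - s') ^ (-α)) :=
            mul_le_mul_of_nonneg_left h2 (norm_nonneg _)
        _ = _ := by ring
  have hcont : ∀ ε > 0, Continuous (fun p : ℝ × ℝ => regKernel α ε (γ p.1 - γ p.2) *
      inner ℝ (deriv γ p.2 - deriv γ p.1) (perp (deriv γ p.1))) := by
    intro ε hε
    have h1 := h.continuous.comp (continuous_fst (X := ℝ) (Y := ℝ))
    have h2 := h.continuous.comp (continuous_snd (X := ℝ) (Y := ℝ))
    have h3 := h.continuous_deriv.comp (continuous_fst (X := ℝ) (Y := ℝ))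
    have h4 := h.continuous_deriv.comp (continuous_snd (X := ℝ) (Y := ℝ))
    exact ((regKernel_contDiff (n := 0) hε).continuous.comp (h1.sub h2)).mul
      ((h4.sub h3).inner (continuous_perp.comp h3))
  have hbdi : ∀ s, IntervalIntegrable (fun s' => ‖deriv γ 0‖ * (c ^ (-1 - α) * D) *
      distInt (s - s') ^ (-α)) volume (-1 / 2) (1 / 2) := fun s =>
    (intervalIntegrable_distInt_sub_rpow hα.2 s _ _).const_mul _
  have hinner : ∀ s, Tendsto (fun ε => f ε s) (𝓝[>] 0)
      (𝓝 (inner ℝ (frontIntegral α γ s) (perp (deriv γ s)))) := by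
    intro s
    have e : inner ℝ (frontIntegral α γ s) (perp (deriv γ s))
        = ∫ s' in (-1 / 2 : ℝ)..(1 / 2), kernelK α (γ s - γ s') *
          inner ℝ (deriv γ s' - deriv γ s) (perp (deriv γ s)) := by
      have hi := intervalIntegrable_frontIntegrand h hα hc hac hD s
      rw [real_inner_comm, frontIntegral]
      have := ((innerSL ℝ (perp (deriv γ s))).intervalIntegral_comp_comm hi).symm
      simp only [innerSL_apply_apply] at this
      rw [this]
      refine intervalIntegral.integral_congr fun s' _ => ?_
      simp only [frontIntegrand, inner_smul_right]
      rw [real_inner_comm]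
    rw [e]
    refine intervalIntegral.tendsto_integral_filter_of_dominated_convergence
      (fun s' => ‖deriv γ 0‖ * (c ^ (-1 - α) * D) * distInt (s - s') ^ (-α)) ?_ ?_ (hbdi s) ?_
    · filter_upwards [self_mem_nhdsWithin] with ε hε
      exact ((hcont ε hε).comp (Continuous.prodMk_right s)).aestronglyMeasurable
    · exact Eventually.of_forall fun ε => ae_of_all _ fun s' _ => hbd ε s s'
    · refine ae_of_all _ fun s' _ => ?_
      rcases eq_or_ne (γ s - γ s') 0 with h0 | h0
      · obtain ⟨n, hn⟩ := h.exists_int_of_eq (sub_eq_zero.1 h0)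
        have : deriv γ s' = deriv γ s := by
          rw [hn]; simpa using (h.periodic_deriv.int_mul n s').symm
        simp [this]
      · exact (tendsto_regKernel h0).mul_const _
  have heq : ∀ᶠ ε in 𝓝[>] (0 : ℝ), regForm α ε (gradient ψ) (A.indicator 1)
      = ∫ s in (-1 / 2 : ℝ)..(1 / 2), ψ (γ s) * f ε s := by
    filter_upwards [self_mem_nhdsWithin] with ε hε
    exact h.regForm_indicator hα.1 hε hψ hψH
  refine Tendsto.congr' (heq.mono fun _ h => h.symm) ?_
  have hψc : Continuous fun s => ψ (γ s) := hψ.continuous.comp h.continuous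
  refine intervalIntegral.tendsto_integral_filter_of_dominated_convergence
    (fun s => |ψ (γ s)| * (‖deriv γ 0‖ * (c ^ (-1 - α) * D) * P₀)) ?_ ?_ ?_ ?_
  · filter_upwards [self_mem_nhdsWithin] with ε hε
    have := intervalIntegral.continuous_parametric_intervalIntegral_of_continuous' (μ := volume)
      (f := fun s s' => regKernel α ε (γ s - γ s') *
        inner ℝ (deriv γ s' - deriv γ s) (perp (deriv γ s))) (hcont ε hε) (-1 / 2) (1 / 2)
    exact (hψc.mul this).aestronglyMeasurable
  · refine Eventually.of_forall fun ε => ae_of_all _ fun s _ => ?_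
    rw [norm_mul, Real.norm_eq_abs]
    refine mul_le_mul_of_nonneg_left ?_ (abs_nonneg _)
    rw [hP₀, ← integral_distInt_sub_rpow s, ← intervalIntegral.integral_const_mul]
    exact intervalIntegral.norm_integral_le_of_norm_le (by norm_num)
      (ae_of_all _ fun s' _ => hbd ε s s') (hbdi s)
  · exact (hψc.abs.mul continuous_const).intervalIntegrable _ _
  · exact ae_of_all _ fun s _ => (hinner s).const_mul _

end Front

end AlmostSharpFront

/-! ### The flux of a smooth density -/

namespace AlmostSharpFront

lemma inner_perp_left (a b : Plane) : inner ℝ (perp a) b = -inner ℝ a (perp b) := by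
  simp only [inner_plane]; simp

lemma inner_gradient_eq (f : Plane → ℝ) (x v : Plane) :
    inner ℝ (gradient f x) v = fderiv ℝ f x v := by
  simp [gradient]

lemma continuous_gradient {f : Plane → ℝ} (hf : ContDiff ℝ 1 f) : Continuous (gradient f) :=
  (InnerProductSpace.toDual ℝ Plane).symm.continuous.comp (hf.continuous_fderiv (by norm_num))

section

variable {α : ℝ} {f : Plane → ℝ}

lemma integrable_kernelK_mul (hα : α ∈ Ioo (0 : ℝ) 1) {g : Plane → ℝ} (hg : Continuous g)
    (hgc : HasCompactSupport g) (x : Plane) : Integrable (fun y => kernelK α (x - y) * g y) := by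
  have h := hgc.convolutionExists_right (ContinuousLinearMap.mul ℝ ℝ)
    (locallyIntegrable_kernelK hα) hg x
  exact convolutionExistsAt_iff_integrable_swap.1 h

lemma continuous_integral_kernelK_mul (hα : α ∈ Ioo (0 : ℝ) 1) {g : Plane → ℝ}
    (hg : Continuous g) (hgc : HasCompactSupport g) :
    Continuous (fun x => ∫ y, kernelK α (x - y) * g y) := by
  have h := hgc.continuous_convolution_right (ContinuousLinearMap.mul ℝ ℝ)
    (locallyIntegrable_kernelK hα) hg
  refine h.congr fun x => ?_
  rw [convolution_eq_swap]
  rfl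

/-- Derivatives of the potential fall on the density. -/
lemma fderiv_potential (hα : α ∈ Ioo (0 : ℝ) 1) (hf : ContDiff ℝ 1 f) (hfc : HasCompactSupport f)
    (x v : Plane) :
    fderiv ℝ (potential α f) x v = ∫ y, kernelK α (x - y) * fderiv ℝ f y v := by
  set L := ContinuousLinearMap.mul ℝ ℝ
  have h1 := hfc.hasFDerivAt_convolution_right L (locallyIntegrable_kernelK hα) hf x
  have h2 : potential α f = convolution (kernelK α) f L volume := by
    ext x
    rw [convolution_eq_swap]
    rfl
  rw [h2, h1.fderiv]
  have h3 := (hfc.fderiv ℝ).convolutionExists_right (L.precompR Plane)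
    (locallyIntegrable_kernelK hα) (hf.continuous_fderiv (by norm_num)) x
  rw [convolution_def, ContinuousLinearMap.integral_apply h3,
    ← integral_sub_left_eq_self _ volume x]
  simp [L, ContinuousLinearMap.precompR_apply]

/-- The regularised quadratic form of a smooth density in terms of its derivatives. -/
lemma integral_inner_regKernelGrad {ε : ℝ} (hε : 0 < ε) (hf : ContDiff ℝ 1 f)
    (hfc : HasCompactSupport f) (x w : Plane) :
    ∫ y, f y * inner ℝ (perp (regKernelGrad α ε (x - y))) w
      = -∫ y, regKernel α ε (x - y) * fderiv ℝ f y (perp w) := by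
  have hk : ContDiff ℝ 1 (fun y => regKernel α ε (x - y)) :=
    (regKernel_contDiff hε).comp (contDiff_const.sub contDiff_id)
  rw [integral_mul_fderiv_eq_neg hk hf hfc, neg_neg]
  refine integral_congr_ae (ae_of_all _ fun y => ?_)
  have h1 : HasFDerivAt (fun y => x - y) (-ContinuousLinearMap.id ℝ Plane) y :=
    (hasFDerivAt_id y).const_sub _
  have h2 : HasFDerivAt (fun y => regKernel α ε (x - y)) _ y :=
    (regKernel_hasFDerivAt hε (x - y)).comp y h1
  simp only
  rw [h2.fderiv, inner_perp_left]
  simp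
  ring

/-- The regularised quadratic form of a smooth density converges to the flux. -/
lemma tendsto_regForm (hα : α ∈ Ioo (0 : ℝ) 1) (hf : ContDiff ℝ 1 f) (hfc : HasCompactSupport f)
    {g : Plane → Plane} (hg : Continuous g) {H : ℝ} (hgH : ∀ x, ‖g x‖ ≤ H) :
    Tendsto (fun ε => regForm α ε g f) (𝓝[>] 0)
      (𝓝 (∫ x, f x * inner ℝ (velocity α f x) (g x))) := by
  have hfi : Integrable f := hf.continuous.integrable_of_hasCompactSupport hfc
  have hH : 0 ≤ H := (norm_nonneg _).trans (hgH 0)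
  have hdc : Continuous (fderiv ℝ f) := hf.continuous_fderiv (by norm_num)
  -- Once the derivative has moved to `f`, only the kernel itself remains, and it is dominated by
  -- `kernelK`. So `U` bounds the inner integral independently of `ε`, and its continuity makes the
  -- outer majorant integrable.
  set U : Plane → ℝ := fun x => ∫ y, kernelK α (x - y) * ‖fderiv ℝ f y‖ with hU
  have hUi : ∀ x, Integrable (fun y => kernelK α (x - y) * ‖fderiv ℝ f y‖) :=
    integrable_kernelK_mul hα hdc.norm (hfc.fderiv ℝ).norm
  have hUc : Continuous U := continuous_integral_kernelK_mul hα hdc.norm (hfc.fderiv ℝ).norm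
  have hform : ∀ ε > 0, regForm α ε g f
      = ∫ x, ∫ y, f x * f y * inner ℝ (perp (regKernelGrad α ε (x - y))) (g x) := by
    intro ε hε
    rw [regForm, Measure.volume_eq_prod, integral_prod _ (regForm_integrable hα.1 hε hg hgH hfi)]
  have hin : ∀ ε > 0, ∀ x, ∫ y, f x * f y * inner ℝ (perp (regKernelGrad α ε (x - y))) (g x)
      = f x * -∫ y, regKernel α ε (x - y) * fderiv ℝ f y (perp (g x)) := by
    intro ε hε x
    rw [← integral_inner_regKernelGrad hε hf hfc x (g x), ← integral_const_mul]
    simp only [mul_assoc]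
  have hne : ∀ x : Plane, ∀ᵐ y, x - y ≠ 0 := fun x => by
    have : ∀ᵐ y : Plane, y ≠ x := by simp [ae_iff]
    filter_upwards [this] with y hy h
    exact hy (sub_eq_zero.1 h).symm
  have hbd : ∀ ε x v, ∀ᵐ y, ‖regKernel α ε (x - y) * fderiv ℝ f y (perp v)‖
      ≤ ‖v‖ * (kernelK α (x - y) * ‖fderiv ℝ f y‖) := by
    intro ε x v
    filter_upwards [hne x] with y hy
    rw [norm_mul, Real.norm_of_nonneg (regKernel_nonneg _)]
    have h1 := (fderiv ℝ f y).le_opNorm (perp v)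
    rw [norm_perp] at h1
    calc _ ≤ kernelK α (x - y) * (‖fderiv ℝ f y‖ * ‖v‖) :=
          mul_le_mul (regKernel_le hα.1 hy) h1 (norm_nonneg _) (kernelK_nonneg _)
      _ = _ := by ring
  have htgt : ∀ x, inner ℝ (velocity α f x) (g x)
      = -∫ y, kernelK α (x - y) * fderiv ℝ f y (perp (g x)) := by
    intro x
    rw [velocity, inner_perp_left, inner_gradient_eq, fderiv_potential hα hf hfc]
  simp only [htgt]
  refine Tendsto.congr' (f₁ := fun ε => ∫ x, ∫ y, f x * f y *
    inner ℝ (perp (regKernelGrad α ε (x - y))) (g x)) ?_ ?_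
  · filter_upwards [self_mem_nhdsWithin] with ε hε
    exact (hform ε hε).symm
  refine tendsto_integral_filter_of_dominated_convergence (fun x => |f x| * (H * U x)) ?_ ?_ ?_ ?_
  · filter_upwards [self_mem_nhdsWithin] with ε hε
    exact (regForm_integrable hα.1 hε hg hgH hfi).integral_prod_left.aestronglyMeasurable
  · filter_upwards [self_mem_nhdsWithin] with ε hε
    refine ae_of_all _ fun x => ?_
    rw [hin ε hε x, norm_mul, norm_neg, Real.norm_eq_abs]
    refine mul_le_mul_of_nonneg_left ?_ (abs_nonneg _)
    refine (norm_integral_le_of_norm_le ((hUi x).const_mul _) (hbd ε x (g x))).trans ?_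
    rw [integral_const_mul]
    exact mul_le_mul_of_nonneg_right (hgH x) (integral_nonneg fun y =>
      mul_nonneg (kernelK_nonneg _) (norm_nonneg _))
  · exact (hf.continuous.abs.mul (continuous_const.mul hUc)).integrable_of_hasCompactSupport
      hfc.norm.mul_right
  · refine ae_of_all _ fun x => ?_
    refine Tendsto.congr' (f₁ := fun ε => f x *
      -∫ y, regKernel α ε (x - y) * fderiv ℝ f y (perp (g x))) ?_ ?_
    · filter_upwards [self_mem_nhdsWithin] with ε hε
      exact (hin ε hε x).symm
    refine Tendsto.const_mul _ (Tendsto.neg ?_)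
    refine tendsto_integral_filter_of_dominated_convergence
      (fun y => ‖g x‖ * (kernelK α (x - y) * ‖fderiv ℝ f y‖)) ?_ ?_ ((hUi x).const_mul _) ?_
    · filter_upwards [self_mem_nhdsWithin] with ε hε
      refine Continuous.aestronglyMeasurable ?_
      exact ((regKernel_contDiff (n := 0) hε).continuous.comp
        (continuous_const.sub continuous_id)).mul (hdc.clm_apply continuous_const)
    · exact Eventually.of_forall fun ε => hbd ε x (g x)
    · filter_upwards [hne x] with y hy
      exact (tendsto_regKernel hy).mul_const _

/-- The flux of a density close to the indicator of a region is close to the sharp-front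
integral. -/
lemma abs_flux_sub_front_le {γ : ℝ → Plane} {A : Set Plane} {c D : ℝ} (h : Bounds γ A)
    (hα : α ∈ Ioo (0 : ℝ) 1) (hc : 0 < c)
    (hac : ∀ s s', c * distInt (s - s') ≤ ‖γ s - γ s'‖)
    (hD : ∀ s s', ‖deriv γ s' - deriv γ s‖ ≤ D * distInt (s - s'))
    (hf : ContDiff ℝ 1 f) (hfc : HasCompactSupport f) {M : ℝ} (hM1 : 1 ≤ M)
    (hM : ∀ x, |f x| ≤ M) {ψ : Plane → ℝ} (hψ : ContDiff ℝ 1 ψ) {H : ℝ}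
    (hψH : ∀ x, ‖gradient ψ x‖ ≤ H)
    (hψL : ∀ x y, ‖gradient ψ x - gradient ψ y‖ ≤ H * ‖x - y‖) :
    |(∫ x, f x * inner ℝ (velocity α f x) (gradient ψ x))
      - ∫ s in (-1 / 2 : ℝ)..(1 / 2),
        ψ (γ s) * inner ℝ (frontIntegral α γ s) (perp (deriv γ s))|
      ≤ 2 * M * ((1 + α) * H * ∫ x, majorant α x) * ∫ x, |f x - A.indicator 1 x| := by
  have hg := continuous_gradient hψ
  have hA1 : Integrable (A.indicator (1 : Plane → ℝ)) :=
    (integrable_indicator_iff h.isOpen.measurableSet).2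
      (integrableOn_const h.volume_lt_top.ne)
  -- The Lipschitz bound for the form is uniform in `ε`, so it passes to the limit; neither `c` nor
  -- `D` enters it.
  have hlim := ((tendsto_regForm hα hf hfc hg hψH).sub
    (tendsto_regForm_indicator h hα hc hac hD hψ hψH)).abs
  refine le_of_tendsto hlim ?_
  filter_upwards [self_mem_nhdsWithin] with ε hε
  refine abs_regForm_sub_le hα hε hg hψH hψL
    (hf.continuous.integrable_of_hasCompactSupport hfc) hA1 hM fun x => ?_
  by_cases hx : x ∈ A
  · simpa [hx] using hM1
  · simp only [indicator_of_notMem hx, abs_zero]; linarith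

end

end AlmostSharpFront

/-! ### Area of the transition region and the sup bound on the density -/

namespace AlmostSharpFront

namespace Bounds

variable {γ : ℝ → Plane} {A : Set Plane} {B : ℝ}

lemma norm_sub_le (h : Bounds γ A) (hB1 : ∀ s, ‖deriv γ s‖ ≤ B) (s s' : ℝ) :
    ‖γ s - γ s'‖ ≤ B * |s - s'| := by
  simpa using (convex_univ (𝕜 := ℝ) (E := ℝ)).norm_image_sub_le_of_norm_deriv_le (f := γ)
    (fun x _ => h.differentiable x) (fun x _ => hB1 x) (mem_univ s') (mem_univ s)

/-- The number of short arcs into which a curve of curvature at most `B` is divided. -/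
noncomputable def _root_.AlmostSharpFront.arcCount (B : ℝ) : ℕ := ⌈4 * B ^ 2⌉₊

/-- The part of the curve inside a small ball is short. -/
lemma volume_near_le (h : Bounds γ A) (hB1 : ∀ s, ‖deriv γ s‖ ≤ B)
    (hB2 : ∀ s, ‖deriv (deriv γ) s‖ ≤ B * ‖deriv γ s‖ ^ 2) (x : Plane) (ρ : ℝ) :
    volume {s ∈ Ioc (0 : ℝ) 2 | dist x (γ s) ≤ ρ} ≤ ENNReal.ofReal (arcCount B * (4 * B * ρ)) := by
  have hB := h.speed_pos_const hB1
  -- On parameter intervals of length `η` the chord controls the parameter; `(0, 2]` is covered by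
  -- $\lceil 2/\eta\rceil=\lceil 4B^2\rceil$ of them, which is `arcCount B`.
  set η := 1 / (2 * B ^ 2) with hη
  have hη0 : 0 < η := by positivity
  set I : ℕ → Set ℝ := fun k => {s ∈ Ioc (k * η) ((k + 1) * η) | dist x (γ s) ≤ ρ} with hI
  have hcov : {s ∈ Ioc (0 : ℝ) 2 | dist x (γ s) ≤ ρ} ⊆
      ⋃ k ∈ Finset.range (arcCount B), I k := by
    rintro s ⟨hs, hd⟩
    have hpos : 0 < ⌈s / η⌉₊ := Nat.ceil_pos.2 (div_pos hs.1 hη0)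
    obtain ⟨k, hk⟩ := Nat.exists_eq_add_of_lt hpos
    rw [zero_add] at hk
    have h1 : s / η ≤ k + 1 := by
      have := Nat.le_ceil (s / η); rw [hk] at this; exact_mod_cast this
    have h2 : (k : ℝ) < s / η := by
      rw [← Nat.lt_ceil, hk]; omega
    rw [lt_div_iff₀ hη0] at h2
    rw [div_le_iff₀ hη0] at h1
    refine mem_iUnion₂.2 ⟨k, ?_, ⟨h2, h1⟩, hd⟩
    rw [Finset.mem_range, arcCount, Nat.lt_ceil]
    have h3 : (k : ℝ) * η < 2 := h2.trans_le hs.2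
    rw [hη, mul_one_div, div_lt_iff₀ (by positivity)] at h3
    linarith
  -- Two points of the ball on one short arc are at distance at most `2 * ρ`, and the speed is at
  -- least `1 / B`, so their parameters differ by at most `4 * B * ρ`.
  have hI' : ∀ k, volume (I k) ≤ ENNReal.ofReal (4 * B * ρ) := by
    intro k
    refine (Real.volume_le_diam _).trans (Metric.ediam_le fun s hs s' hs' => ?_)
    rw [edist_dist]
    refine ENNReal.ofReal_le_ofReal ?_
    rw [Real.dist_eq]
    have hle : |s - s'| ≤ η := by
      rw [abs_le]
      constructor <;> nlinarith [hs.1.1, hs.1.2, hs'.1.1, hs'.1.2]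
    have h1 := h.half_speed_mul_le hB1 hB2 hle
    have h2 : ‖γ s - γ s'‖ ≤ 2 * ρ := by
      rw [← dist_eq_norm]
      have := dist_triangle_left (γ s) (γ s') x
      linarith [hs.2, hs'.2]
    have h3 := h.one_le_mul_norm_deriv hB.le hB2
    have h4 := abs_nonneg (s - s')
    calc |s - s'| ≤ (B * ‖deriv γ 0‖) * |s - s'| := by nlinarith
      _ = 2 * B * (‖deriv γ 0‖ / 2 * |s - s'|) := by ring
      _ ≤ 2 * B * (2 * ρ) := mul_le_mul_of_nonneg_left (h1.trans h2) (by positivity)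
      _ = _ := by ring
  refine (measure_mono hcov).trans ((measure_biUnion_finset_le _ _).trans ?_)
  refine (Finset.sum_le_sum fun k _ => hI' k).trans ?_
  rw [Finset.sum_const, Finset.card_range, nsmul_eq_mul,
    ENNReal.ofReal_mul (p := (arcCount B : ℝ)) (by positivity), ENNReal.ofReal_natCast]

lemma exists_mem_Ioc (h : Bounds γ A) (s : ℝ) : ∃ s' ∈ Ioc (0 : ℝ) 1, γ s' = γ s := by
  obtain ⟨y, hy, he⟩ := h.periodic.exists_mem_Ioc zero_lt_one s 0
  exact ⟨y, by simpa using hy, he.symm⟩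

/-- The area of a set of points close to the curve, in terms of the part of the curve that is
close to the set. -/
lemma volume_le_of_near (h : Bounds γ A) (hB1 : ∀ s, ‖deriv γ s‖ ≤ B) {r : ℝ} (hr : 0 < r)
    (hrB : r ≤ B) {S : Set Plane} (hS : MeasurableSet S)
    (hnear : ∀ y ∈ S, ∃ s, dist y (γ s) ≤ r) {T : Set ℝ}
    (hST : ∀ s ∈ Ioc (0 : ℝ) 2, ∀ y ∈ S, dist y (γ s) ≤ 2 * r → s ∈ T) :
    ENNReal.ofReal (r / B) * volume S
      ≤ ENNReal.ofReal (4 * r ^ 2 * Real.pi) * volume T := by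
  have hB := hr.trans_le hrB
  have hE : MeasurableSet {p : Plane × ℝ | dist p.1 (γ p.2) ≤ 2 * r} :=
    (isClosed_le (continuous_fst.dist (h.continuous.comp continuous_snd))
      continuous_const).measurableSet
  -- Double counting of the incidences `dist y (γ s) ≤ 2 * r`: each `y` in `S` sees a set of
  -- parameters in `T` of measure at least `r / B`, and each `s` sees at most the area of a disc of
  -- radius `2 * r`.
  set F : Plane → ℝ → ENNReal := fun y s =>
    {p : Plane × ℝ | dist p.1 (γ p.2) ≤ 2 * r}.indicator 1 (y, s) with hF
  have hFm : Measurable (Function.uncurry F) := measurable_one.indicator hE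
  have hlow : ∀ y ∈ S, ENNReal.ofReal (r / B) ≤ ∫⁻ s in T, F y s := by
    intro y hy
    obtain ⟨s₁, hs₁⟩ := hnear y hy
    obtain ⟨s₀, hs₀, he⟩ := h.exists_mem_Ioc s₁
    rw [← he] at hs₁
    -- The interval starts in `(0, 1]` and has length at most one because `r ≤ B`. It therefore
    -- stays in `(0, 2]`, which is why two periods are used.
    have hsub : ∀ s ∈ Ioc s₀ (s₀ + r / B), dist y (γ s) ≤ 2 * r ∧ s ∈ T := by
      intro s hs
      have h1 : dist (γ s₀) (γ s) ≤ r := by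
        rw [dist_comm, dist_eq_norm]
        refine (h.norm_sub_le hB1 s s₀).trans ?_
        rw [abs_of_pos (by linarith [hs.1])]
        have : s - s₀ ≤ r / B := by linarith [hs.2]
        rw [le_div_iff₀ hB] at this
        linarith
      have h2 : dist y (γ s) ≤ 2 * r := by
        have := dist_triangle y (γ s₀) (γ s); linarith
      have h3 : r / B ≤ 1 := (div_le_one hB).2 hrB
      exact ⟨h2, hST s ⟨by linarith [hs.1, hs₀.1], by linarith [hs.2, hs₀.2]⟩ y hy h2⟩
    calc ENNReal.ofReal (r / B) = volume (Ioc s₀ (s₀ + r / B)) := by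
          rw [Real.volume_Ioc]; congr 1; ring
      _ = ∫⁻ s in Ioc s₀ (s₀ + r / B), 1 := by simp
      _ = ∫⁻ s in Ioc s₀ (s₀ + r / B), F y s := by
          refine setLIntegral_congr_fun measurableSet_Ioc fun s hs => ?_
          simp only [hF]
          rw [indicator_of_mem (show (y, s) ∈ {p : Plane × ℝ | dist p.1 (γ p.2) ≤ 2 * r} from
            (hsub s hs).1)]
          rfl
      _ ≤ ∫⁻ s in T, F y s := lintegral_mono_set fun s hs => (hsub s hs).2
  have hup : ∀ s, ∫⁻ y in S, F y s ≤ ENNReal.ofReal (4 * r ^ 2 * Real.pi) := by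
    intro s
    calc ∫⁻ y in S, F y s ≤ ∫⁻ y, F y s := setLIntegral_le_lintegral _ _
      _ = ∫⁻ y, (Metric.closedBall (γ s) (2 * r)).indicator 1 y := rfl
      _ = volume (Metric.closedBall (γ s) (2 * r)) := lintegral_indicator_one
          measurableSet_closedBall
      _ = ENNReal.ofReal (4 * r ^ 2 * Real.pi) := by
          rw [EuclideanSpace.volume_closedBall_fin_two, ← ENNReal.ofReal_pow (by positivity),
            ← ENNReal.ofReal_mul (by positivity)]
          congr 2; ring
  calc ENNReal.ofReal (r / B) * volume S = ∫⁻ _ in S, ENNReal.ofReal (r / B) := by simp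
    _ ≤ ∫⁻ y in S, ∫⁻ s in T, F y s := setLIntegral_mono' hS hlow
    _ = ∫⁻ s in T, ∫⁻ y in S, F y s := lintegral_lintegral_swap hFm.aemeasurable
    _ ≤ ∫⁻ _ in T, ENNReal.ofReal (4 * r ^ 2 * Real.pi) := lintegral_mono hup
    _ = _ := by simp

lemma exists_dist_le_of_mem_midRegion (h : Bounds γ A) {r : ℝ} {y : Plane}
    (hy : y ∈ midRegion A r) : ∃ s, dist y (γ s) ≤ r := by
  have hc : IsCompact (frontier A) := h.isCompact_closure.of_isClosed_subset isClosed_frontier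
    frontier_subset_closure
  have hne : (frontier A).Nonempty := h.frontier_eq ▸ range_nonempty γ
  obtain ⟨w, hw, hd⟩ := hc.exists_infDist_eq_dist hne y
  rw [h.frontier_eq] at hw
  obtain ⟨s, rfl⟩ := hw
  exact ⟨s, hd ▸ hy⟩

lemma measurableSet_midRegion (A : Set Plane) (r : ℝ) : MeasurableSet (midRegion A r) :=
  (isClosed_le (Metric.continuous_infDist_pt _) continuous_const).measurableSet

/-- The transition region has area `O(r)`. -/
lemma volume_midRegion_le (h : Bounds γ A) (hB1 : ∀ s, ‖deriv γ s‖ ≤ B) {r : ℝ} (hr : 0 < r)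
    (hrB : r ≤ B) : volume (midRegion A r) ≤ ENNReal.ofReal (8 * B * Real.pi * r) := by
  have hB := hr.trans_le hrB
  have h1 := h.volume_le_of_near hB1 hr hrB (measurableSet_midRegion A r)
    (fun y hy => h.exists_dist_le_of_mem_midRegion hy)
    (T := Ioc 0 2) (fun s hs _ _ _ => hs)
  rw [Real.volume_Ioc, ← ENNReal.ofReal_mul (by positivity)] at h1
  have h2 : ENNReal.ofReal (4 * r ^ 2 * Real.pi * (2 - 0))
      = ENNReal.ofReal (r / B) * ENNReal.ofReal (8 * B * Real.pi * r) := by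
    rw [← ENNReal.ofReal_mul (by positivity)]
    congr 1; field_simp; ring
  rw [h2] at h1
  exact (ENNReal.mul_le_mul_iff_right (ENNReal.ofReal_pos.2 (by positivity)).ne'
    ENNReal.ofReal_ne_top).1 h1

/-- The number of half-widths within which one leaves the transition region. -/
noncomputable def _root_.AlmostSharpFront.exitFactor (B : ℝ) : ℝ := 64 * arcCount B * B ^ 2 + 2

/-- Every point is close to a point outside of the transition region. -/
lemma exists_notMem_midRegion (h : Bounds γ A) (hB1 : ∀ s, ‖deriv γ s‖ ≤ B)
    (hB2 : ∀ s, ‖deriv (deriv γ) s‖ ≤ B * ‖deriv γ s‖ ^ 2) {r : ℝ} (hr : 0 < r)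
    (hrB : r ≤ B) (x : Plane) :
    ∃ y, dist y x ≤ exitFactor B * r ∧ y ∉ midRegion A r := by
  by_contra! hcon
  have hB := hr.trans_le hrB
  set l := exitFactor B with hl
  have hl2 : 2 ≤ l := by rw [hl, exitFactor]; linarith [show (0 : ℝ) ≤ 64 * arcCount B * B ^ 2 by positivity]
  -- If a disc of radius `l * r` lay in the transition region, its area, quadratic in `l`, would be
  -- controlled by the arc of the curve within `(l + 2) * r` of its centre, whose length is only
  -- linear in `l`.
  have h1 := h.volume_le_of_near hB1 hr hrB (measurableSet_closedBall (x := x) (ε := l * r))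
    (fun y hy => h.exists_dist_le_of_mem_midRegion (hcon y hy))
    (T := {s ∈ Ioc (0 : ℝ) 2 | dist x (γ s) ≤ (l + 2) * r})
    (fun s hs y hy hd => ⟨hs, by
      have h2 := dist_triangle_left x (γ s) y
      have h3 : dist y x ≤ l * r := hy
      linarith⟩)
  have h2 := h1.trans (mul_le_mul_right (h.volume_near_le hB1 hB2 x
    ((l + 2) * r)) _)
  rw [EuclideanSpace.volume_closedBall_fin_two, ← ENNReal.ofReal_pow (by positivity),
    ← ENNReal.ofReal_mul (by positivity), ← ENNReal.ofReal_mul (by positivity),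
    ← ENNReal.ofReal_mul (by positivity),
    ENNReal.ofReal_le_ofReal_iff (by positivity)] at h2
  have h3 : r / B * ((l * r) ^ 2 * Real.pi) = (r ^ 3 * Real.pi / B) * l ^ 2 := by
    field_simp
  have h4 : 4 * r ^ 2 * Real.pi * (arcCount B * (4 * B * ((l + 2) * r)))
      = (r ^ 3 * Real.pi / B) * (16 * arcCount B * B ^ 2 * (l + 2)) := by
    field_simp; ring
  rw [h3, h4] at h2
  -- With $N$ the arc count this reads $l^2\le16NB^2(l+2)\le32NB^2l$, as $l\ge2$, against
  -- $l=64NB^2+2$.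
  have h5 := le_of_mul_le_mul_left h2 (by positivity)
  have h6 : (0 : ℝ) ≤ arcCount B * B ^ 2 := by positivity
  have h7 : l = 64 * (arcCount B * B ^ 2) + 2 := by rw [hl, exitFactor]; ring
  nlinarith

end Bounds

/-- The density of an almost-sharp front is bounded. -/
lemma abs_le_of_transition {γ : ℝ → Plane} {A : Set Plane} {B r δ G : ℝ} (h : Bounds γ A)
    (hB1 : ∀ s, ‖deriv γ s‖ ≤ B)
    (hB2 : ∀ s, ‖deriv (deriv γ) s‖ ≤ B * ‖deriv γ s‖ ^ 2) (hr : 0 < r)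
    (hrB : r ≤ B) {f : Plane → ℝ} (hf : ContDiff ℝ 1 f) (hG : ∀ x, ‖gradient f x‖ ≤ G / δ)
    (hin : ∀ x ∈ inRegion A r, f x = 1) (hout : ∀ x ∈ outRegion A r, f x = 0) (x : Plane) :
    |f x| ≤ 1 + G / δ * (exitFactor B * r) := by
  obtain ⟨y, hy, hmid⟩ := h.exists_notMem_midRegion hB1 hB2 hr hrB x
  have hGn : 0 ≤ G / δ := (norm_nonneg _).trans (hG 0)
  have h1 : |f y| ≤ 1 := by
    by_cases hyi : y ∈ inRegion A r
    · rw [hin y hyi, abs_one]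
    · rw [hout y (by simp [outRegion, hyi, hmid]), abs_zero]; exact zero_le_one
  have h2 : ‖f x - f y‖ ≤ G / δ * ‖x - y‖ :=
    convex_univ.norm_image_sub_le_of_norm_fderiv_le (𝕜 := ℝ)
      (fun z _ => hf.differentiable (by norm_num) z)
      (fun z _ => by
        have := hG z
        rwa [gradient, LinearIsometryEquiv.norm_map] at this) (mem_univ y) (mem_univ x)
  rw [← dist_eq_norm, ← dist_eq_norm, dist_comm x y] at h2
  have h3 := mul_le_mul_of_nonneg_left hy hGn
  have h4 := abs_sub_abs_le_abs_sub (f x) (f y)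
  rw [Real.dist_eq] at h2
  linarith

section Transition

variable {γ : ℝ → Plane} {A : Set Plane} {r : ℝ} {f : Plane → ℝ}

lemma eq_indicator_of_notMem_midRegion (hin : ∀ x ∈ inRegion A r, f x = 1)
    (hout : ∀ x ∈ outRegion A r, f x = 0) {x : Plane} (hx : x ∉ midRegion A r) :
    f x = A.indicator 1 x := by
  by_cases hxA : x ∈ A
  · rw [indicator_of_mem hxA, hin x ⟨hxA, not_le.1 hx⟩]; rfl
  · rw [indicator_of_notMem hxA]
    refine hout x ?_
    rw [outRegion, mem_compl_iff, mem_union, not_or]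
    exact ⟨fun h => hxA h.1, hx⟩

lemma hasCompactSupport_of_transition (h : Bounds γ A) (hin : ∀ x ∈ inRegion A r, f x = 1)
    (hout : ∀ x ∈ outRegion A r, f x = 0) : HasCompactSupport f := by
  obtain ⟨R, hR⟩ := h.isBounded.subset_closedBall (0 : Plane)
  obtain ⟨R', hR'⟩ := h.isCompact_closure.isBounded.subset_closedBall (0 : Plane)
  refine HasCompactSupport.intro (isCompact_closedBall (0 : Plane) (max R (R' + r))) fun x hx => ?_
  rw [Metric.mem_closedBall, not_le, max_lt_iff, dist_zero_right] at hx
  have hxA : x ∉ A := fun hA => by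
    have := hR hA
    rw [Metric.mem_closedBall, dist_zero_right] at this
    linarith [hx.1]
  have hxm : x ∉ midRegion A r := fun hm => by
    obtain ⟨s, hs⟩ := h.exists_dist_le_of_mem_midRegion hm
    have h1 : γ s ∈ closure A := frontier_subset_closure (h.frontier_eq ▸ mem_range_self s)
    have h2 := hR' h1
    rw [Metric.mem_closedBall] at h2
    have h3 := dist_triangle x (γ s) 0
    rw [dist_zero_right] at h3
    linarith [hx.2]
  rw [eq_indicator_of_notMem_midRegion hin hout hxm, indicator_of_notMem hxA]

/-- The difference vanishes off the transition region and is at most `M + 1` on it, so the area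
bound suffices. -/
lemma integral_abs_sub_indicator_le (h : Bounds γ A) {B M : ℝ} (hB1 : ∀ s, ‖deriv γ s‖ ≤ B)
    (hr : 0 < r) (hrB : r ≤ B) (hM : ∀ x, |f x| ≤ M)
    (hin : ∀ x ∈ inRegion A r, f x = 1) (hout : ∀ x ∈ outRegion A r, f x = 0) :
    ∫ x, |f x - A.indicator 1 x| ≤ (M + 1) * (8 * B * Real.pi * r) := by
  have hB := hr.trans_le hrB
  have hM0 : 0 ≤ M := (abs_nonneg _).trans (hM 0)
  have hvol := h.volume_midRegion_le hB1 hr hrB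
  have hfin : volume (midRegion A r) < ⊤ := hvol.trans_lt ENNReal.ofReal_lt_top
  rw [← setIntegral_eq_integral_of_forall_compl_eq_zero (s := midRegion A r) (fun x hx => by
    rw [eq_indicator_of_notMem_midRegion hin hout hx, sub_self, abs_zero])]
  have h1 := norm_setIntegral_le_of_norm_le_const (C := M + 1) hfin
    (f := fun x => |f x - A.indicator 1 x|) (fun x _ => by
      rw [Real.norm_eq_abs, abs_abs]
      refine (abs_sub _ _).trans (add_le_add (hM x) ?_)
      by_cases hx : x ∈ A <;> simp [hx])
  refine (le_abs_self _).trans (h1.trans ?_)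
  refine mul_le_mul_of_nonneg_left ?_ (by linarith)
  exact ENNReal.toReal_le_of_le_ofReal (by positivity) hvol

end Transition

end AlmostSharpFront

/-! ### Antiderivatives in the first space variable -/

namespace AlmostSharpFront

/-- The first basis vector of the plane. -/
noncomputable def basisZero : Plane := planeEquiv (1, 0)

/-- The linear map of `ℝ × ℝ²` that multiplies the first space coordinate by `l`. -/
noncomputable def scaleFirst (l : ℝ) : (ℝ × Plane) →L[ℝ] (ℝ × Plane) :=
  ContinuousLinearMap.id ℝ _ + (l - 1) •
    ((EuclideanSpace.proj (𝕜 := ℝ) (0 : Fin 2)).comp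
      (ContinuousLinearMap.snd ℝ ℝ Plane)).smulRight ((0 : ℝ), basisZero)

lemma scaleFirst_apply (l : ℝ) (p : ℝ × Plane) :
    scaleFirst l p = p + ((l - 1) * p.2 0) • ((0 : ℝ), basisZero) := by
  simp [scaleFirst, mul_smul]

lemma scaleFirst_apply_fst (l : ℝ) (p : ℝ × Plane) : (scaleFirst l p).1 = p.1 := by
  simp [scaleFirst_apply]

lemma continuous_scaleFirst : Continuous scaleFirst := by
  unfold scaleFirst; fun_prop

/-- The antiderivative of `ψ` in the first space variable that vanishes at `x⁰ = 0`. -/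
noncomputable def antideriv (ψ : ℝ × Plane → ℝ) (p : ℝ × Plane) : ℝ :=
  p.2 0 * ∫ l in (0 : ℝ)..1, ψ (scaleFirst l p)

section Antideriv

variable {ψ : ℝ × Plane → ℝ} {C : ℝ}

lemma continuous_scaleFirst_uncurry :
    Continuous (fun q : (ℝ × Plane) × ℝ => scaleFirst q.2 q.1) :=
  (continuous_scaleFirst.comp continuous_snd).clm_apply continuous_fst

lemma hasFDerivAt_integral_scaleFirst (hψ : ContDiff ℝ 1 ψ) (hC : ∀ p, ‖fderiv ℝ ψ p‖ ≤ C)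
    (p : ℝ × Plane) :
    HasFDerivAt (fun p => ∫ l in (0 : ℝ)..1, ψ (scaleFirst l p))
      (∫ l in (0 : ℝ)..1, (fderiv ℝ ψ (scaleFirst l p)).comp (scaleFirst l)) p := by
  have hd : Continuous (fderiv ℝ ψ) := hψ.continuous_fderiv (by norm_num)
  have hl : ∀ q, Continuous fun l => scaleFirst l q := fun q =>
    continuous_scaleFirst.clm_apply continuous_const
  refine intervalIntegral.hasFDerivAt_integral_of_dominated_of_fderiv_le
    (bound := fun l => C * ‖scaleFirst l‖) (s := univ)
    (F' := fun q l => (fderiv ℝ ψ (scaleFirst l q)).comp (scaleFirst l)) univ_mem ?_ ?_ ?_ ?_ ?_ ?_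
  · exact Eventually.of_forall fun q => (hψ.continuous.comp (hl q)).aestronglyMeasurable
  · exact (hψ.continuous.comp (hl p)).intervalIntegrable _ _
  · exact ((hd.comp (hl p)).clm_comp continuous_scaleFirst).aestronglyMeasurable
  · refine ae_of_all _ fun l _ q _ => (ContinuousLinearMap.opNorm_comp_le _ _).trans ?_
    exact mul_le_mul_of_nonneg_right (hC _) (norm_nonneg _)
  · exact (continuous_const.mul continuous_scaleFirst.norm).intervalIntegrable _ _
  · exact ae_of_all _ fun l _ q _ =>
      (hψ.differentiable (by norm_num) _).hasFDerivAt.comp q (scaleFirst l).hasFDerivAt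

/-- Scaling the variable keeps the interval of integration equal to `[0, 1]`, so joint
differentiability is differentiation under the integral sign. -/
lemma contDiff_antideriv (hψ : ContDiff ℝ 1 ψ) (hC : ∀ p, ‖fderiv ℝ ψ p‖ ≤ C) :
    ContDiff ℝ 1 (antideriv ψ) := by
  have hd : Continuous (fderiv ℝ ψ) := hψ.continuous_fderiv (by norm_num)
  have h1 : ContDiff ℝ 1 (fun p => ∫ l in (0 : ℝ)..1, ψ (scaleFirst l p)) := by
    refine contDiff_one_iff_hasFDerivAt.2 ⟨_, ?_, hasFDerivAt_integral_scaleFirst hψ hC⟩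
    exact intervalIntegral.continuous_parametric_intervalIntegral_of_continuous'
      (f := fun p l => (fderiv ℝ ψ (scaleFirst l p)).comp (scaleFirst l))
      ((hd.comp continuous_scaleFirst_uncurry).clm_comp
        (continuous_scaleFirst.comp continuous_snd)) 0 1
  unfold antideriv
  have h2 : ContDiff ℝ 1 (fun p : ℝ × Plane => p.2 0) :=
    ((EuclideanSpace.proj (𝕜 := ℝ) (0 : Fin 2)).comp
      (ContinuousLinearMap.snd ℝ ℝ Plane)).contDiff
  exact h2.mul h1

/-- The scaling leaves the time direction fixed, so the time derivative passes inside. -/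
lemma fderiv_antideriv_time (hψ : ContDiff ℝ 1 ψ) (hC : ∀ p, ‖fderiv ℝ ψ p‖ ≤ C)
    (p : ℝ × Plane) :
    fderiv ℝ (antideriv ψ) p (1, 0) = antideriv (fun q => fderiv ℝ ψ q (1, 0)) p := by
  have h2 : HasFDerivAt (fun p : ℝ × Plane => p.2 0) ((EuclideanSpace.proj (𝕜 := ℝ)
    (0 : Fin 2)).comp (ContinuousLinearMap.snd ℝ ℝ Plane)) p :=
    ((EuclideanSpace.proj (𝕜 := ℝ) (0 : Fin 2)).comp
      (ContinuousLinearMap.snd ℝ ℝ Plane)).hasFDerivAt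
  have h3 : HasFDerivAt (antideriv ψ) _ p := h2.mul (hasFDerivAt_integral_scaleFirst hψ hC p)
  rw [h3.fderiv]
  have hd : Continuous (fderiv ℝ ψ) := hψ.continuous_fderiv (by norm_num)
  have hi : IntervalIntegrable (fun l => (fderiv ℝ ψ (scaleFirst l p)).comp (scaleFirst l))
      volume 0 1 :=
    ((hd.comp (continuous_scaleFirst.clm_apply continuous_const)).clm_comp
      continuous_scaleFirst).intervalIntegrable _ _
  simp only [add_apply, smul_apply, ContinuousLinearMap.comp_apply, ContinuousLinearMap.coe_snd',
    map_zero, smul_eq_mul, mul_zero, add_zero, antideriv,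
    ContinuousLinearMap.intervalIntegral_apply hi]
  congr 1
  refine intervalIntegral.integral_congr fun l _ => ?_
  simp [scaleFirst_apply]

/-- On a line parallel to the first axis, started where the first coordinate is zero, the scaled
integral becomes an ordinary primitive. -/
lemma fderiv_antideriv_first (hψ : ContDiff ℝ 1 ψ) (hC : ∀ p, ‖fderiv ℝ ψ p‖ ≤ C)
    (p : ℝ × Plane) : fderiv ℝ (antideriv ψ) p (0, basisZero) = ψ p := by
  have hF := (contDiff_antideriv hψ hC).differentiable (by norm_num)
  set e : ℝ × Plane := (0, basisZero) with he
  have he0 : e.2 0 = 1 := by simp [he, basisZero]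
  set q : ℝ × Plane := p - (p.2 0) • e with hq
  have hq0 : q.2 0 = 0 := by
    have : q.2 0 = p.2 0 - p.2 0 * e.2 0 := by simp [hq]
    rw [this, he0]; ring
  have hpq : q + (p.2 0) • e = p := by simp [hq]
  have h1 : HasDerivAt (fun u : ℝ => antideriv ψ (q + u • e)) (fderiv ℝ (antideriv ψ) p e)
      (p.2 0) := by
    have h2 : HasDerivAt (fun u : ℝ => q + u • e) ((1 : ℝ) • e) (p.2 0) :=
      ((hasDerivAt_id _).smul_const e).const_add q
    rw [one_smul] at h2
    have h3 := (hF (q + (p.2 0) • e)).hasFDerivAt.comp_hasDerivAt _ h2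
    rw [hpq] at h3
    exact h3
  have h4 : ∀ u : ℝ, antideriv ψ (q + u • e) = ∫ y in (0 : ℝ)..u, ψ (q + y • e) := by
    intro u
    have h5 : (q + u • e).2 0 = u := by
      have : (q + u • e).2 0 = q.2 0 + u * e.2 0 := by simp
      rw [this, hq0, he0]; ring
    have h6 : ∀ l, scaleFirst l (q + u • e) = q + (u * l) • e := by
      intro l
      rw [scaleFirst_apply, h5, add_assoc, ← he, ← add_smul]
      congr 2; ring
    simp only [antideriv, h5, h6]
    rw [← smul_eq_mul, intervalIntegral.smul_integral_comp_mul_left (fun y => ψ (q + y • e))]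
    simp
  simp only [h4] at h1
  have hc : Continuous fun y : ℝ => ψ (q + y • e) := hψ.continuous.comp (by fun_prop)
  have h7 := intervalIntegral.integral_hasDerivAt_right (hc.intervalIntegrable 0 (p.2 0))
    (hc.stronglyMeasurableAtFilter _ _) hc.continuousAt
  rw [hpq] at h7
  exact h1.unique h7

lemma antideriv_eq_zero {t : ℝ} (h : ∀ x, ψ (t, x) = 0) (x : Plane) : antideriv ψ (t, x) = 0 := by
  have : ∀ l, ψ (scaleFirst l (t, x)) = 0 := fun l => by
    have h1 := scaleFirst_apply_fst l (t, x)
    rw [← Prod.mk.eta (p := scaleFirst l (t, x)), h1]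
    exact h _
  simp [antideriv, this]

/-- The integral of a function over a region as a boundary integral. -/
lemma Bounds.setIntegral_eq_antideriv {γ : ℝ → Plane} {A : Set Plane} (h : Bounds γ A)
    (hψ : ContDiff ℝ 1 ψ) (hC : ∀ p, ‖fderiv ℝ ψ p‖ ≤ C) (t : ℝ) :
    ∫ x in A, ψ (t, x)
      = ∫ s in (-1 / 2 : ℝ)..(1 / 2), antideriv ψ (t, γ s) * deriv γ s 1 := by
  have hF := contDiff_antideriv hψ hC
  have hf : ContDiff ℝ 1 (fun x => antideriv ψ (t, x)) :=
    hF.comp (contDiff_const.prodMk contDiff_id)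
  have h1 := h.integral_fderiv_eq hf basisZero
  have h2 : ∀ x, fderiv ℝ (fun x => antideriv ψ (t, x)) x basisZero = ψ (t, x) := by
    intro x
    have h3 : HasFDerivAt (fun x : Plane => (t, x)) (ContinuousLinearMap.inr ℝ ℝ Plane) x :=
      hasFDerivAt_prodMk_right t x
    have h4 : HasFDerivAt (fun x => antideriv ψ (t, x)) _ x :=
      (hF.differentiable (by norm_num) (t, x)).hasFDerivAt.comp x h3
    rw [h4.fderiv]
    simpa using fderiv_antideriv_first hψ hC (t, x)
  simp only [h2] at h1
  rw [h1, ← intervalIntegral.integral_neg]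
  refine intervalIntegral.integral_congr fun s _ => ?_
  simp [inner_perp_eq_cross, cross, basisZero]

end Antideriv

/-! ### Differentiating line integrals along a moving curve -/

lemma continuousOn_parametric_intervalIntegral {f : ℝ × ℝ → ℝ} {J : Set ℝ}
    (hf : ContinuousOn f (J ×ˢ univ)) (a b : ℝ) :
    ContinuousOn (fun t => ∫ s in a..b, f (t, s)) J := by
  rw [continuousOn_iff_continuous_domRestrict]
  refine intervalIntegral.continuous_parametric_intervalIntegral_of_continuous' (μ := volume)
    (f := fun (t : J) s => f (t, s)) ?_ a b
  exact hf.comp_continuous (by fun_prop) (fun p => ⟨p.1.2, mem_univ _⟩)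

section Transport

variable {J : Set ℝ} {a y : ℝ × ℝ → ℝ}

lemma hasDerivAt_of_contDiffOn_fst {E : Type*} [NormedAddCommGroup E] [NormedSpace ℝ E]
    {f : ℝ × ℝ → E} (hJ : IsOpen J) (hf : ContDiffOn ℝ 1 f (J ×ˢ univ)) {t : ℝ}
    (ht : t ∈ J) (s : ℝ) : HasDerivAt (fun t => f (t, s)) (fderiv ℝ f (t, s) (1, 0)) t := by
  have h1 : DifferentiableAt ℝ f (t, s) := (hf.differentiableOn (by norm_num)).differentiableAt
    ((hJ.prod isOpen_univ).mem_nhds ⟨ht, mem_univ _⟩)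
  have h2 : HasDerivAt (fun t : ℝ => (t, s)) ((1 : ℝ), (0 : ℝ)) t :=
    (hasDerivAt_id t).prodMk (hasDerivAt_const t s)
  exact h1.hasFDerivAt.comp_hasDerivAt t h2

lemma hasDerivAt_of_contDiffOn_snd {E : Type*} [NormedAddCommGroup E] [NormedSpace ℝ E]
    {f : ℝ × ℝ → E} (hJ : IsOpen J) (hf : ContDiffOn ℝ 1 f (J ×ˢ univ)) {t : ℝ}
    (ht : t ∈ J) (s : ℝ) : HasDerivAt (fun s => f (t, s)) (fderiv ℝ f (t, s) (0, 1)) s := by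
  have h1 : DifferentiableAt ℝ f (t, s) := (hf.differentiableOn (by norm_num)).differentiableAt
    ((hJ.prod isOpen_univ).mem_nhds ⟨ht, mem_univ _⟩)
  have h2 : HasDerivAt (fun s : ℝ => (t, s)) ((0 : ℝ), (1 : ℝ)) s :=
    (hasDerivAt_const s t).prodMk (hasDerivAt_id s)
  exact h1.hasFDerivAt.comp_hasDerivAt s h2

lemma continuousOn_fderiv_apply {E : Type*} [NormedAddCommGroup E] [NormedSpace ℝ E]
    {f : ℝ × ℝ → E} (hJ : IsOpen J) (hf : ContDiffOn ℝ 1 f (J ×ˢ univ)) (v : ℝ × ℝ) :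
    ContinuousOn (fun p => fderiv ℝ f p v) (J ×ˢ univ) :=
  (hf.continuousOn_fderiv_of_isOpen (hJ.prod isOpen_univ) (by norm_num)).clm_apply
    continuousOn_const

lemma continuous_slice {E : Type*} [TopologicalSpace E] {f : ℝ × ℝ → E}
    (hf : ContinuousOn f (J ×ˢ univ)) {t : ℝ} (ht : t ∈ J) : Continuous fun s => f (t, s) :=
  hf.comp_continuous (by fun_prop) (fun _ => ⟨ht, mem_univ _⟩)

/-- The derivative of `∮ a dy` along a moving closed curve, for functions that are merely `C¹`. -/
lemma hasDerivAt_integral_mul_deriv (hJ : IsOpen J) (ha : ContDiffOn ℝ 1 a (J ×ˢ univ))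
    (hy : ContDiffOn ℝ 1 y (J ×ˢ univ)) (hap : ∀ t ∈ J, ∀ s, a (t, s + 1) = a (t, s))
    (hyp : ∀ t ∈ J, ∀ s, y (t, s + 1) = y (t, s)) {t : ℝ} (ht : t ∈ J) :
    HasDerivAt (fun t => ∫ s in (-1 / 2 : ℝ)..(1 / 2), a (t, s) * fderiv ℝ y (t, s) (0, 1))
      (∫ s in (-1 / 2 : ℝ)..(1 / 2), (fderiv ℝ a (t, s) (1, 0) * fderiv ℝ y (t, s) (0, 1)
        - fderiv ℝ a (t, s) (0, 1) * fderiv ℝ y (t, s) (1, 0))) t := by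
  have hac := ha.continuousOn
  have hyc := hy.continuousOn
  have hat := continuousOn_fderiv_apply hJ ha (1, 0)
  have has := continuousOn_fderiv_apply hJ ha (0, 1)
  have hyt := continuousOn_fderiv_apply hJ hy (1, 0)
  have hys := continuousOn_fderiv_apply hJ hy (0, 1)
  obtain ⟨η, hη, hηJ⟩ := Metric.isOpen_iff.1 hJ t ht
  have hsub : Icc (t - η / 2) (t + η / 2) ⊆ J := fun u hu => hηJ (by
    rw [Metric.mem_ball, Real.dist_eq, abs_lt]; constructor <;> linarith [hu.1, hu.2])
  have hcomp : IsCompact (Icc (t - η / 2) (t + η / 2) ×ˢ Icc (-1 / 2 : ℝ) (1 / 2)) :=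
    isCompact_Icc.prod isCompact_Icc
  have hss : Icc (t - η / 2) (t + η / 2) ×ˢ Icc (-1 / 2 : ℝ) (1 / 2) ⊆ J ×ˢ univ :=
    prod_mono hsub (subset_univ _)
  obtain ⟨C₁, hC₁⟩ := hcomp.exists_bound_of_continuousOn (hat.mono hss)
  obtain ⟨C₂, hC₂⟩ := hcomp.exists_bound_of_continuousOn (hys.mono hss)
  obtain ⟨C₃, hC₃⟩ := hcomp.exists_bound_of_continuousOn (has.mono hss)
  obtain ⟨C₄, hC₄⟩ := hcomp.exists_bound_of_continuousOn (hyt.mono hss)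
  have htm : t ∈ Icc (t - η / 2) (t + η / 2) := ⟨by linarith, by linarith⟩
  have hev : ∀ᶠ u in 𝓝[≠] t, u ∈ Icc (t - η / 2) (t + η / 2) ∧ u ≠ t := by
    refine Filter.Eventually.and ?_ self_mem_nhdsWithin
    exact nhdsWithin_le_nhds (Icc_mem_nhds (by linarith) (by linarith))
  rw [hasDerivAt_iff_tendsto_slope]
  -- Formally the derivative contains $a\,\partial_t\partial_sy$, which need not exist for a $C^1$
  -- curve. The integration by parts in `s` is therefore made on the difference quotient, before the
  -- limit.
  have hslope : ∀ u ∈ Icc (t - η / 2) (t + η / 2), u ≠ t →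
      slope (fun t => ∫ s in (-1 / 2 : ℝ)..(1 / 2), a (t, s) * fderiv ℝ y (t, s) (0, 1)) t u
      = ∫ s in (-1 / 2 : ℝ)..(1 / 2), ((u - t)⁻¹ * (a (u, s) - a (t, s)) * fderiv ℝ y (u, s) (0, 1)
        - fderiv ℝ a (t, s) (0, 1) * ((u - t)⁻¹ * (y (u, s) - y (t, s)))) := by
    intro u hu hne
    have huJ := hsub hu
    have c1 := continuous_slice hac ht
    have c2 := continuous_slice hac huJ
    have c3 := continuous_slice hyc ht
    have c4 := continuous_slice hyc huJ
    have c5 := continuous_slice has ht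
    have c6 := continuous_slice hys ht
    have c7 := continuous_slice hys huJ
    -- The boundary terms cancel by periodicity of `a` and `y`.
    have hparts : ∫ s in (-1 / 2 : ℝ)..(1 / 2),
        a (t, s) * (fderiv ℝ y (u, s) (0, 1) - fderiv ℝ y (t, s) (0, 1))
        = -∫ s in (-1 / 2 : ℝ)..(1 / 2), fderiv ℝ a (t, s) (0, 1) * (y (u, s) - y (t, s)) := by
      rw [intervalIntegral.integral_mul_deriv_eq_deriv_mul
        (u := fun s => a (t, s)) (v := fun s => y (u, s) - y (t, s))
        (fun s _ => hasDerivAt_of_contDiffOn_snd hJ ha ht s)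
        (fun s _ => (hasDerivAt_of_contDiffOn_snd hJ hy huJ s).sub
          (hasDerivAt_of_contDiffOn_snd hJ hy ht s))
        (c5.intervalIntegrable _ _) ((c7.sub c6).intervalIntegrable _ _)]
      have e1 := hap t ht (-1 / 2)
      have e2 := hyp t ht (-1 / 2)
      have e3 := hyp u huJ (-1 / 2)
      rw [show (-1 / 2 : ℝ) + 1 = 1 / 2 by norm_num] at e1 e2 e3
      rw [e1, e2, e3]; ring
    have hi1 : IntervalIntegrable (fun s => (a (u, s) - a (t, s)) * fderiv ℝ y (u, s) (0, 1))
        volume (-1 / 2) (1 / 2) := ((c2.sub c1).mul c7).intervalIntegrable _ _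
    have hi2 : IntervalIntegrable (fun s => fderiv ℝ a (t, s) (0, 1) * (y (u, s) - y (t, s)))
        volume (-1 / 2) (1 / 2) := (c5.mul (c4.sub c3)).intervalIntegrable _ _
    have hi3 : IntervalIntegrable (fun s => a (t, s) * (fderiv ℝ y (u, s) (0, 1)
        - fderiv ℝ y (t, s) (0, 1))) volume (-1 / 2) (1 / 2) :=
      (c1.mul (c7.sub c6)).intervalIntegrable _ _
    have hrhs : ∫ s in (-1 / 2 : ℝ)..(1 / 2),
        ((u - t)⁻¹ * (a (u, s) - a (t, s)) * fderiv ℝ y (u, s) (0, 1)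
          - fderiv ℝ a (t, s) (0, 1) * ((u - t)⁻¹ * (y (u, s) - y (t, s))))
        = (u - t)⁻¹ * ((∫ s in (-1 / 2 : ℝ)..(1 / 2),
            (a (u, s) - a (t, s)) * fderiv ℝ y (u, s) (0, 1))
          - ∫ s in (-1 / 2 : ℝ)..(1 / 2), fderiv ℝ a (t, s) (0, 1) * (y (u, s) - y (t, s))) := by
      rw [← intervalIntegral.integral_sub hi1 hi2, ← intervalIntegral.integral_const_mul]
      refine intervalIntegral.integral_congr fun s _ => ?_
      ring
    rw [hrhs, sub_eq_add_neg (∫ s in (-1 / 2 : ℝ)..(1 / 2), _) _, ← hparts, ← intervalIntegral.integral_add hi1 hi3, slope_def_module,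
      smul_eq_mul]
    have hi4 : IntervalIntegrable (fun s => a (u, s) * fderiv ℝ y (u, s) (0, 1))
        volume (-1 / 2) (1 / 2) := (c2.mul c7).intervalIntegrable _ _
    have hi5 : IntervalIntegrable (fun s => a (t, s) * fderiv ℝ y (t, s) (0, 1))
        volume (-1 / 2) (1 / 2) := (c1.mul c6).intervalIntegrable _ _
    rw [← intervalIntegral.integral_sub hi4 hi5]
    congr 1
    refine intervalIntegral.integral_congr fun s _ => ?_
    ring
  refine Tendsto.congr' (f₁ := fun u => ∫ s in (-1 / 2 : ℝ)..(1 / 2),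
    ((u - t)⁻¹ * (a (u, s) - a (t, s)) * fderiv ℝ y (u, s) (0, 1)
      - fderiv ℝ a (t, s) (0, 1) * ((u - t)⁻¹ * (y (u, s) - y (t, s))))) ?_ ?_
  · filter_upwards [hev] with u hu
    exact (hslope u hu.1 hu.2).symm
  have hquot : ∀ {f : ℝ × ℝ → ℝ} {C : ℝ}, ContDiffOn ℝ 1 f (J ×ˢ univ) →
      (∀ p ∈ Icc (t - η / 2) (t + η / 2) ×ˢ Icc (-1 / 2 : ℝ) (1 / 2), ‖fderiv ℝ f p (1, 0)‖ ≤ C) →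
      ∀ u ∈ Icc (t - η / 2) (t + η / 2), ∀ s ∈ Icc (-1 / 2 : ℝ) (1 / 2), u ≠ t →
      |(u - t)⁻¹ * (f (u, s) - f (t, s))| ≤ C := by
    intro f C hf hC u hu s hs hne
    have h1 := (convex_Icc (t - η / 2) (t + η / 2)).norm_image_sub_le_of_norm_hasDerivWithin_le
      (f := fun t => f (t, s)) (C := C)
      (fun x hx => (hasDerivAt_of_contDiffOn_fst hJ hf (hsub hx) s).hasDerivWithinAt)
      (fun x hx => hC (x, s) ⟨hx, hs⟩) htm hu
    rw [Real.norm_eq_abs, Real.norm_eq_abs] at h1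
    rw [abs_mul, abs_inv, inv_mul_le_iff₀ (abs_pos.2 (sub_ne_zero.2 hne)), mul_comm]
    exact h1
  have hsl : ∀ {f : ℝ × ℝ → ℝ}, ContDiffOn ℝ 1 f (J ×ˢ univ) → ∀ s,
      Tendsto (fun u => (u - t)⁻¹ * (f (u, s) - f (t, s))) (𝓝[≠] t)
        (𝓝 (fderiv ℝ f (t, s) (1, 0))) := by
    intro f hf s
    have := hasDerivAt_iff_tendsto_slope.1 (hasDerivAt_of_contDiffOn_fst hJ hf ht s)
    refine this.congr fun u => ?_
    rw [slope_def_module, smul_eq_mul]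
  refine intervalIntegral.tendsto_integral_filter_of_dominated_convergence
    (fun _ => C₁ * C₂ + C₃ * C₄) ?_ ?_ intervalIntegrable_const ?_
  · filter_upwards [hev] with u hu
    have huJ := hsub hu.1
    refine Continuous.aestronglyMeasurable ?_
    exact ((continuous_const.mul ((continuous_slice hac huJ).sub (continuous_slice hac ht))).mul
      (continuous_slice hys huJ)).sub ((continuous_slice has ht).mul
      (continuous_const.mul ((continuous_slice hyc huJ).sub (continuous_slice hyc ht))))
  · filter_upwards [hev] with u hu
    refine ae_of_all _ fun s hs => ?_
    rw [uIoc_of_le (by norm_num)] at hs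
    have hs' := Ioc_subset_Icc_self hs
    refine (norm_sub_le _ _).trans ?_
    rw [norm_mul _ (fderiv ℝ y (u, s) (0, 1)), norm_mul (fderiv ℝ a (t, s) (0, 1))]
    have k1 := hquot ha hC₁ u hu.1 s hs' hu.2
    have k2 := hC₂ (u, s) ⟨hu.1, hs'⟩
    have k3 := hC₃ (t, s) ⟨htm, hs'⟩
    have k4 := hquot hy hC₄ u hu.1 s hs' hu.2
    rw [← Real.norm_eq_abs] at k1 k4
    refine add_le_add ?_ ?_
    · exact mul_le_mul k1 k2 (norm_nonneg _) ((norm_nonneg _).trans k1)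
    · exact mul_le_mul k3 k4 (norm_nonneg _) ((norm_nonneg _).trans k3)
  · refine ae_of_all _ fun s _ => ?_
    have hysc : Tendsto (fun u => fderiv ℝ y (u, s) (0, 1)) (𝓝[≠] t)
        (𝓝 (fderiv ℝ y (t, s) (0, 1))) := by
      have h1 : ContinuousAt (fun p => fderiv ℝ y p (0, 1)) (t, s) :=
        hys.continuousAt ((hJ.prod isOpen_univ).mem_nhds ⟨ht, mem_univ _⟩)
      have h2 : ContinuousAt (fun u => fderiv ℝ y (u, s) (0, 1)) t :=
        ContinuousAt.comp (f := fun u : ℝ => (u, s)) h1 (by fun_prop)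
      exact h2.tendsto.mono_left nhdsWithin_le_nhds
    exact ((hsl ha s).mul hysc).sub ((hsl hy s).const_mul _)

end Transport

end AlmostSharpFront

/-! ### Bounds for test functions -/

namespace AlmostSharpFront

namespace IsTestFunction

variable {T : ℝ} {φ : ℝ → Plane → ℝ}

lemma contDiff_uncurry (hφ : IsTestFunction T φ) {n : ℕ} :
    ContDiff ℝ n (fun p : ℝ × Plane => φ p.1 p.2) :=
  hφ.smooth.of_le (by exact_mod_cast le_top)

lemma contDiff_fderiv (hφ : IsTestFunction T φ) :
    ContDiff ℝ 1 (fderiv ℝ (fun p : ℝ × Plane => φ p.1 p.2)) :=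
  (hφ.contDiff_uncurry (n := 2)).fderiv_right (by norm_num)

/-- The curve is controlled only inside the open interval `(0, T)`, so time integrals are confined
to a compact subinterval. The test function vanishes at its endpoints too, which later removes the
boundary terms. -/
lemma exists_time_interval (hT : 0 < T) (hφ : IsTestFunction T φ) :
    ∃ t₀ t₁, 0 < t₀ ∧ t₀ < t₁ ∧ t₁ < T ∧
      ∀ t ∉ Ioo t₀ t₁, ∀ x, (t, x) ∉ tsupport (fun p : ℝ × Plane => φ p.1 p.2) := by
  set K := Prod.fst '' tsupport (fun p : ℝ × Plane => φ p.1 p.2) with hK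
  have hKc : IsCompact K := hφ.compact.isCompact.image continuous_fst
  have hKT : K ⊆ Ioo 0 T := by
    rintro _ ⟨p, hp, rfl⟩
    exact (hφ.support hp).1
  rcases K.eq_empty_or_nonempty with he | hne
  · refine ⟨T / 3, T / 2, by linarith, by linarith, by linarith, fun t _ x hx => ?_⟩
    have : t ∈ K := ⟨_, hx, rfl⟩
    rw [he] at this
    exact this
  · obtain ⟨m, hm, hmin⟩ := hKc.exists_isLeast hne
    obtain ⟨M, hM, hmax⟩ := hKc.exists_isGreatest hne
    have h1 := hKT hm
    have h2 := hKT hM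
    have h3 := hmin hM
    refine ⟨m / 2, (M + T) / 2, by linarith [h1.1], by linarith [h1.1, h2.2],
      by linarith [h2.2], fun t ht x hx => ht ?_⟩
    have htK : t ∈ K := ⟨_, hx, rfl⟩
    exact ⟨by linarith [hmin htK, h1.1], by linarith [hmax htK, h2.2]⟩

lemma exists_bound (hφ : IsTestFunction T φ) : ∃ C, ∀ p : ℝ × Plane, |φ p.1 p.2| ≤ C :=
  hφ.compact.exists_bound_of_continuous hφ.smooth.continuous

lemma exists_bound_fderiv (hφ : IsTestFunction T φ) :
    ∃ C, ∀ p, ‖fderiv ℝ (fun p : ℝ × Plane => φ p.1 p.2) p‖ ≤ C :=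
  (hφ.compact.fderiv ℝ).exists_bound_of_continuous hφ.contDiff_fderiv.continuous

lemma contDiff_time_deriv (hφ : IsTestFunction T φ) :
    ContDiff ℝ 1 (fun p => fderiv ℝ (fun p : ℝ × Plane => φ p.1 p.2) p (1, 0)) :=
  hφ.contDiff_fderiv.clm_apply contDiff_const

lemma exists_bound_fderiv_time_deriv (hφ : IsTestFunction T φ) : ∃ C, ∀ q,
    ‖fderiv ℝ (fun p => fderiv ℝ (fun p : ℝ × Plane => φ p.1 p.2) p (1, 0)) q‖ ≤ C :=
  ((hφ.compact.fderiv_apply ℝ (1, 0)).fderiv ℝ).exists_bound_of_continuous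
    (hφ.contDiff_time_deriv.continuous_fderiv (by norm_num))

lemma deriv_time (hφ : IsTestFunction T φ) (t : ℝ) (x : Plane) :
    deriv (fun τ => φ τ x) t = fderiv ℝ (fun p : ℝ × Plane => φ p.1 p.2) (t, x) (1, 0) := by
  have h1 : HasDerivAt (fun τ : ℝ => (τ, x)) ((1 : ℝ), (0 : Plane)) t :=
    (hasDerivAt_id t).prodMk (hasDerivAt_const t x)
  exact (((hφ.contDiff_uncurry (n := 1)).differentiable (by norm_num)
    (t, x)).hasFDerivAt.comp_hasDerivAt t h1).deriv

lemma contDiff_slice (hφ : IsTestFunction T φ) (t : ℝ) : ContDiff ℝ 1 (φ t) :=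
  (hφ.contDiff_uncurry (n := 1)).comp (contDiff_const.prodMk contDiff_id)

lemma fderiv_slice (hφ : IsTestFunction T φ) (t : ℝ) (x : Plane) :
    fderiv ℝ (φ t) x = (fderiv ℝ (fun p : ℝ × Plane => φ p.1 p.2) (t, x)).comp
      (ContinuousLinearMap.inr ℝ ℝ Plane) := by
  have h3 : HasFDerivAt (fun x : Plane => (t, x)) (ContinuousLinearMap.inr ℝ ℝ Plane) x :=
    hasFDerivAt_prodMk_right t x
  exact (((hφ.contDiff_uncurry (n := 1)).differentiable (by norm_num)
    (t, x)).hasFDerivAt.comp x h3).fderiv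

lemma exists_gradient_bounds (hφ : IsTestFunction T φ) : ∃ H, ∀ t,
    (∀ x, ‖gradient (φ t) x‖ ≤ H) ∧
      ∀ x y, ‖gradient (φ t) x - gradient (φ t) y‖ ≤ H * ‖x - y‖ := by
  obtain ⟨C, hC⟩ := hφ.exists_bound_fderiv
  obtain ⟨L, hL⟩ := hφ.contDiff_fderiv.lipschitzWith_of_hasCompactSupport
    (hφ.compact.fderiv ℝ) (by norm_num)
  have hinr : ‖ContinuousLinearMap.inr ℝ ℝ Plane‖ ≤ 1 :=
    ContinuousLinearMap.norm_inr_le_one ℝ ℝ Plane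
  refine ⟨max C L, fun t => ⟨fun x => ?_, fun x y => ?_⟩⟩
  · rw [gradient, LinearIsometryEquiv.norm_map, hφ.fderiv_slice]
    refine (ContinuousLinearMap.opNorm_comp_le _ _).trans (le_trans ?_ (le_max_left _ _))
    exact (mul_le_of_le_one_right (norm_nonneg _) hinr).trans (hC _)
  · rw [gradient, gradient, ← map_sub, LinearIsometryEquiv.norm_map, hφ.fderiv_slice,
      hφ.fderiv_slice, ← ContinuousLinearMap.sub_comp]
    refine (ContinuousLinearMap.opNorm_comp_le _ _).trans
      ((mul_le_of_le_one_right (norm_nonneg _) hinr).trans ?_)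
    have h1 := hL.dist_le_mul (t, x) (t, y)
    rw [dist_eq_norm, dist_eq_norm] at h1
    have h2 : ‖(t, x) - (t, y)‖ = ‖x - y‖ := by simp
    rw [h2] at h1
    exact h1.trans (mul_le_mul_of_nonneg_right (le_max_right _ _) (norm_nonneg _))

lemma eq_zero_of_notMem {t : ℝ} {x : Plane}
    (h : (t, x) ∉ tsupport (fun p : ℝ × Plane => φ p.1 p.2)) :
    φ t x = 0 ∧ fderiv ℝ (fun p : ℝ × Plane => φ p.1 p.2) (t, x) = 0 := by
  constructor
  · exact image_eq_zero_of_notMem_tsupport (f := fun p : ℝ × Plane => φ p.1 p.2) h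
  · by_contra hne
    exact h (tsupport_fderiv_subset ℝ (subset_tsupport _ hne))

end IsTestFunction

/-! ### Time integrals and transport of the moving region -/

lemma setIntegral_eq_intervalIntegral_of_support {f : ℝ → ℝ} {T t₀ t₁ : ℝ} (h0 : 0 < t₀)
    (h01 : t₀ < t₁) (h1 : t₁ < T) (hf : ContinuousOn f (Ioo 0 T))
    (hz : ∀ t ∈ Ioo 0 T, t ∉ Ioo t₀ t₁ → f t = 0) :
    IntegrableOn f (Ioo 0 T) ∧ ∫ t in Ioo 0 T, f t = ∫ t in t₀..t₁, f t := by
  have hsub : Icc t₀ t₁ ⊆ Ioo 0 T := Icc_subset_Ioo h0 h1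
  constructor
  · have h2 : IntegrableOn f (Icc t₀ t₁) := (hf.mono hsub).integrableOn_compact isCompact_Icc
    exact h2.of_forall_sdiff_eq_zero measurableSet_Ioo fun t ht => hz t ht.1 fun h =>
      ht.2 (Ioo_subset_Icc_self h)
  · rw [intervalIntegral.integral_of_le h01.le, integral_Ioc_eq_integral_Ioo]
    exact setIntegral_eq_of_subset_of_forall_sdiff_eq_zero measurableSet_Ioo
      (Ioo_subset_Icc_self.trans hsub) fun t ht => hz t ht.1 ht.2

section MovingCurve

variable {T : ℝ} {z : ℝ → ℝ → Plane}

lemma deriv_time_curve (hz : ContDiffOn ℝ 1 (fun p : ℝ × ℝ => z p.1 p.2) (Ioo 0 T ×ˢ univ))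
    {t : ℝ} (ht : t ∈ Ioo 0 T) (s : ℝ) :
    deriv (fun τ => z τ s) t = fderiv ℝ (fun p : ℝ × ℝ => z p.1 p.2) (t, s) (1, 0) :=
  (hasDerivAt_of_contDiffOn_fst isOpen_Ioo hz ht s).deriv

lemma deriv_param_curve (hz : ContDiffOn ℝ 1 (fun p : ℝ × ℝ => z p.1 p.2) (Ioo 0 T ×ˢ univ))
    {t : ℝ} (ht : t ∈ Ioo 0 T) (s : ℝ) :
    deriv (z t) s = fderiv ℝ (fun p : ℝ × ℝ => z p.1 p.2) (t, s) (0, 1) :=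
  (hasDerivAt_of_contDiffOn_snd isOpen_Ioo hz ht s).deriv

lemma continuousOn_deriv_time_curve
    (hz : ContDiffOn ℝ 1 (fun p : ℝ × ℝ => z p.1 p.2) (Ioo 0 T ×ˢ univ)) :
    ContinuousOn (fun p : ℝ × ℝ => deriv (fun τ => z τ p.2) p.1) (Ioo 0 T ×ˢ univ) :=
  (continuousOn_fderiv_apply isOpen_Ioo hz (1, 0)).congr
    fun p hp => deriv_time_curve hz hp.1 p.2

lemma continuousOn_deriv_param_curve
    (hz : ContDiffOn ℝ 1 (fun p : ℝ × ℝ => z p.1 p.2) (Ioo 0 T ×ˢ univ)) :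
    ContinuousOn (fun p : ℝ × ℝ => deriv (z p.1) p.2) (Ioo 0 T ×ˢ univ) :=
  (continuousOn_fderiv_apply isOpen_Ioo hz (0, 1)).congr
    fun p hp => deriv_param_curve hz hp.1 p.2

/-- The transport identity: the flux of a test function through the moving curve is the integral
of its time derivative over the moving region. -/
theorem integral_transport {A : ℝ → Set Plane} (hT : 0 < T)
    (hz : ContDiffOn ℝ 1 (fun p : ℝ × ℝ => z p.1 p.2) (Ioo 0 T ×ˢ univ))
    (hb : ∀ t ∈ Ioo 0 T, Bounds (z t) (A t)) {φ : ℝ → Plane → ℝ} (hφ : IsTestFunction T φ) :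
    IntegrableOn (fun t => ∫ x in A t, deriv (fun τ => φ τ x) t) (Ioo 0 T) ∧
    IntegrableOn (fun t => ∫ s in (-1 / 2 : ℝ)..(1 / 2), φ t (z t s) *
      inner ℝ (deriv (fun τ => z τ s) t) (perp (deriv (z t) s))) (Ioo 0 T) ∧
    ∫ t in Ioo 0 T, ∫ x in A t, deriv (fun τ => φ τ x) t
      = ∫ t in Ioo 0 T, ∫ s in (-1 / 2 : ℝ)..(1 / 2), φ t (z t s) *
        inner ℝ (deriv (fun τ => z τ s) t) (perp (deriv (z t) s)) := by
  set Φ : ℝ × Plane → ℝ := fun p => φ p.1 p.2 with hΦ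
  set Z : ℝ × ℝ → Plane := fun p => z p.1 p.2 with hZ
  obtain ⟨C, hC⟩ := hφ.exists_bound_fderiv
  obtain ⟨C', hC'⟩ := hφ.exists_bound_fderiv_time_deriv
  obtain ⟨t₀, t₁, h0, h01, h1, hsupp⟩ := hφ.exists_time_interval hT
  have hΦ1 : ContDiff ℝ 1 Φ := hφ.contDiff_uncurry (n := 1)
  have hΦt := hφ.contDiff_time_deriv
  have hF := contDiff_antideriv hΦ1 hC
  have hFt := contDiff_antideriv hΦt hC'
  set Ψ : ℝ × Plane → ℝ := fun p => fderiv ℝ Φ p (1, 0) with hΨ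
  have hJ : IsOpen (Ioo (0 : ℝ) T) := isOpen_Ioo
  have hZc : ContinuousOn Z (Ioo 0 T ×ˢ univ) := hz.continuousOn
  have hpair : ContDiffOn ℝ 1 (fun p : ℝ × ℝ => (p.1, Z p)) (Ioo 0 T ×ˢ univ) :=
    contDiff_fst.contDiffOn.prodMk hz
  -- The integral of the test function over the region is the line integral of `a` against `dy`, so
  -- the motion of the region is seen only through the curve.
  set a : ℝ × ℝ → ℝ := fun p => antideriv Φ (p.1, Z p) with ha
  set y : ℝ × ℝ → ℝ := fun p => Z p 1 with hy
  have hac : ContDiffOn ℝ 1 a (Ioo 0 T ×ˢ univ) := hF.comp_contDiffOn hpair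
  have hyc : ContDiffOn ℝ 1 y (Ioo 0 T ×ˢ univ) :=
    (EuclideanSpace.proj (𝕜 := ℝ) (1 : Fin 2)).contDiff.comp_contDiffOn hz
  have hZd : ∀ p ∈ Ioo 0 T ×ˢ (univ : Set ℝ), HasFDerivAt Z (fderiv ℝ Z p) p := fun p hp =>
    ((hz.differentiableOn (by norm_num)).differentiableAt
      ((hJ.prod isOpen_univ).mem_nhds hp)).hasFDerivAt
  have hyd : ∀ p ∈ Ioo 0 T ×ˢ (univ : Set ℝ), ∀ v, fderiv ℝ y p v = fderiv ℝ Z p v 1 := by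
    intro p hp v
    have : HasFDerivAt y _ p :=
      (EuclideanSpace.proj (𝕜 := ℝ) (1 : Fin 2)).hasFDerivAt.comp p (hZd p hp)
    rw [this.fderiv]; rfl
  have had : ∀ p ∈ Ioo 0 T ×ˢ (univ : Set ℝ), ∀ v,
      fderiv ℝ a p v = fderiv ℝ (antideriv Φ) (p.1, Z p) (v.1, fderiv ℝ Z p v) := by
    intro p hp v
    have h2 : HasFDerivAt (fun p : ℝ × ℝ => (p.1, Z p)) _ p :=
      hasFDerivAt_fst.prodMk (hZd p hp)
    have h3 : HasFDerivAt a _ p :=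
      HasFDerivAt.comp (g := antideriv Φ) p
        (hF.differentiable (by norm_num) (p.1, Z p)).hasFDerivAt h2
    rw [h3.fderiv]; rfl
  -- `E` is the derivative of the antiderivative in the second space variable. It needs no formula,
  -- since it cancels in the determinant below.
  obtain ⟨E, hsplit⟩ : ∃ E : ℝ × Plane → ℝ, ∀ q (τ : ℝ) (v : Plane),
      fderiv ℝ (antideriv Φ) q (τ, v) = τ * antideriv Ψ q + v 0 * Φ q + v 1 * E q := by
    refine ⟨fun q => fderiv ℝ (antideriv Φ) q (0, planeEquiv (0, 1)), fun q τ v => ?_⟩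
    have hv : ((τ, v) : ℝ × Plane) = τ • ((1 : ℝ), (0 : Plane)) + v 0 • ((0 : ℝ), basisZero)
        + v 1 • ((0 : ℝ), planeEquiv (0, 1)) := by
      ext i
      · simp
      · fin_cases i <;> simp [basisZero]
    conv_lhs => rw [hv]
    simp only [map_add, map_smul, smul_eq_mul]
    rw [fderiv_antideriv_time hΦ1 hC, fderiv_antideriv_first hΦ1 hC]
  have hper : ∀ t ∈ Ioo 0 T, ∀ s, Z (t, s + 1) = Z (t, s) := fun t ht s => (hb t ht).periodic s
  have hderiv : ∀ t ∈ Ioo 0 T, HasDerivAt (fun t => ∫ s in (-1 / 2 : ℝ)..(1 / 2),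
      a (t, s) * fderiv ℝ y (t, s) (0, 1)) (∫ s in (-1 / 2 : ℝ)..(1 / 2),
      (fderiv ℝ a (t, s) (1, 0) * fderiv ℝ y (t, s) (0, 1)
        - fderiv ℝ a (t, s) (0, 1) * fderiv ℝ y (t, s) (1, 0))) t := fun t ht =>
    hasDerivAt_integral_mul_deriv hJ hac hyc
      (fun t ht s => by simp only [ha, hper t ht s]) (fun t ht s => by simp only [hy, hper t ht s]) ht
  set v : ℝ × ℝ → ℝ := fun p => antideriv Ψ (p.1, Z p) * deriv (z p.1) p.2 1 with hv
  set w : ℝ × ℝ → ℝ := fun p => φ p.1 (z p.1 p.2) *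
    inner ℝ (deriv (fun τ => z τ p.2) p.1) (perp (deriv (z p.1) p.2)) with hw
  have hvc : ContinuousOn v (Ioo 0 T ×ˢ univ) :=
    (hFt.continuous.comp_continuousOn hpair.continuousOn).mul
      ((EuclideanSpace.proj (𝕜 := ℝ) (1 : Fin 2)).continuous.comp_continuousOn
        (continuousOn_deriv_param_curve hz))
  have hwc : ContinuousOn w (Ioo 0 T ×ˢ univ) :=
    (hΦ1.continuous.comp_continuousOn hpair.continuousOn).mul
      ((continuousOn_deriv_time_curve hz).inner
        (continuous_perp.comp_continuousOn (continuousOn_deriv_param_curve hz)))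
  have hV : ∀ t ∈ Ioo 0 T, ∫ x in A t, deriv (fun τ => φ τ x) t
      = ∫ s in (-1 / 2 : ℝ)..(1 / 2), v (t, s) := by
    intro t ht
    simp only [hφ.deriv_time]
    exact (hb t ht).setIntegral_eq_antideriv hΦt hC' t
  -- The terms with `E` cancel; the terms with the test function form the cross product of
  -- $\partial_tz$ and $\partial_sz$, which is minus the normal velocity.
  have hpt : ∀ t ∈ Ioo 0 T, ∀ s, fderiv ℝ a (t, s) (1, 0) * fderiv ℝ y (t, s) (0, 1)
        - fderiv ℝ a (t, s) (0, 1) * fderiv ℝ y (t, s) (1, 0) = v (t, s) - w (t, s) := by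
    intro t ht s
    have hm : (t, s) ∈ Ioo 0 T ×ˢ (univ : Set ℝ) := ⟨ht, mem_univ _⟩
    rw [had _ hm, had _ hm, hyd _ hm, hyd _ hm, hsplit, hsplit]
    simp only [hv, hw, inner_perp_eq_cross, deriv_time_curve hz ht, deriv_param_curve hz ht,
      cross, hΦ, hZ]
    ring
  have hvC := continuousOn_parametric_intervalIntegral hvc (-1 / 2) (1 / 2)
  have hwC := continuousOn_parametric_intervalIntegral hwc (-1 / 2) (1 / 2)
  have hΨ0 : ∀ t ∉ Ioo t₀ t₁, ∀ x, Ψ (t, x) = 0 := fun t ht x => by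
    have h2 : fderiv ℝ Φ (t, x) = 0 := (IsTestFunction.eq_zero_of_notMem (hsupp t ht x)).2
    simp only [hΨ, h2, zero_apply]
  have hv0 : ∀ t ∈ Ioo 0 T, t ∉ Ioo t₀ t₁ → ∫ s in (-1 / 2 : ℝ)..(1 / 2), v (t, s) = 0 := by
    intro t _ ht
    simp only [hv, antideriv_eq_zero (hΨ0 t ht), zero_mul, intervalIntegral.integral_zero]
  have hw0 : ∀ t ∈ Ioo 0 T, t ∉ Ioo t₀ t₁ → ∫ s in (-1 / 2 : ℝ)..(1 / 2), w (t, s) = 0 := by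
    intro t _ ht
    simp only [hw, (IsTestFunction.eq_zero_of_notMem (hsupp t ht _)).1, zero_mul,
      intervalIntegral.integral_zero]
  obtain ⟨iv, ev⟩ := setIntegral_eq_intervalIntegral_of_support h0 h01 h1 hvC hv0
  obtain ⟨iw, ew⟩ := setIntegral_eq_intervalIntegral_of_support h0 h01 h1 hwC hw0
  have hsub : Icc t₀ t₁ ⊆ Ioo 0 T := Icc_subset_Ioo h0 h1
  refine ⟨iv.congr_fun (fun t ht => (hV t ht).symm) measurableSet_Ioo, iw, ?_⟩
  rw [setIntegral_congr_fun measurableSet_Ioo hV, ev]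
  refine Eq.trans ?_ ew.symm
  rw [← sub_eq_zero]
  have hsubI : uIcc t₀ t₁ ⊆ Ioo 0 T := by rw [uIcc_of_le h01.le]; exact hsub
  rw [← intervalIntegral.integral_sub ((hvC.mono hsubI).intervalIntegrable)
    ((hwC.mono hsubI).intervalIntegrable)]
  have hgoal : ∀ t ∈ uIcc t₀ t₁, HasDerivAt (fun t => ∫ s in (-1 / 2 : ℝ)..(1 / 2),
      a (t, s) * fderiv ℝ y (t, s) (0, 1)) ((∫ s in (-1 / 2 : ℝ)..(1 / 2), v (t, s))
        - ∫ s in (-1 / 2 : ℝ)..(1 / 2), w (t, s)) t := by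
    intro t ht
    have htJ := hsubI ht
    have := hderiv t htJ
    simp only [hpt t htJ] at this
    rwa [intervalIntegral.integral_sub ((continuous_slice hvc htJ).intervalIntegrable _ _)
      ((continuous_slice hwc htJ).intervalIntegrable _ _)] at this
  -- The difference of the two time integrals is the increment of the line integral, which vanishes
  -- at both ends of the time support.
  rw [intervalIntegral.integral_eq_sub_of_hasDerivAt hgoal
    (((hvC.mono hsubI).sub (hwC.mono hsubI)).intervalIntegrable)]
  have hΦ0 : ∀ t ∉ Ioo t₀ t₁, ∀ x, Φ (t, x) = 0 := fun t ht x =>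
    (IsTestFunction.eq_zero_of_notMem (hsupp t ht x)).1
  simp only [ha, antideriv_eq_zero (hΦ0 t₁ (by simp)), antideriv_eq_zero (hΦ0 t₀ (by simp)),
    zero_mul, intervalIntegral.integral_zero, sub_self]

end MovingCurve

end AlmostSharpFront

/-! ### The weak sharp-front equation with an explicit error -/

namespace AlmostSharpFront

lemma frontDefect_eq (α : ℝ) (z : ℝ → ℝ → Plane) (t s : ℝ) :
    frontDefect α z t s = inner ℝ (deriv (fun τ => z τ s) t) (perp (deriv (z t) s))
      + inner ℝ (frontIntegral α (z t) s) (perp (deriv (z t) s)) := by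
  rw [frontDefect, inner_neg_left, sub_neg_eq_add]

section MovingCurve

variable {α T B : ℝ} {z : ℝ → ℝ → Plane} {A : ℝ → Set Plane} {φ : ℝ → Plane → ℝ}

lemma integrableOn_of_Icc {f : ℝ × ℝ → ℝ} {t₀ t₁ : ℝ}
    (hf : IntegrableOn f (Icc t₀ t₁ ×ˢ Ioc (-1 / 2) (1 / 2)))
    (h0 : ∀ t ∉ Ioo t₀ t₁, ∀ s, f (t, s) = 0) :
    IntegrableOn f (Ioo 0 T ×ˢ Ioc (-1 / 2) (1 / 2)) :=
  hf.of_forall_sdiff_eq_zero (measurableSet_Ioo.prod measurableSet_Ioc) fun p hp =>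
    h0 p.1 (fun h => hp.2 ⟨Ioo_subset_Icc_self h, hp.1.2⟩) p.2

lemma integrableOn_normal_velocity (hT : 0 < T)
    (hz : ContDiffOn ℝ 1 (fun p : ℝ × ℝ => z p.1 p.2) (Ioo 0 T ×ˢ univ))
    (hφ : IsTestFunction T φ) :
    IntegrableOn (fun p : ℝ × ℝ => φ p.1 (z p.1 p.2) *
      inner ℝ (deriv (fun τ => z τ p.2) p.1) (perp (deriv (z p.1) p.2)))
      (Ioo 0 T ×ˢ Ioc (-1 / 2) (1 / 2)) := by
  obtain ⟨t₀, t₁, h0, h01, h1, hsupp⟩ := hφ.exists_time_interval hT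
  have hwc : ContinuousOn (fun p : ℝ × ℝ => φ p.1 (z p.1 p.2) *
      inner ℝ (deriv (fun τ => z τ p.2) p.1) (perp (deriv (z p.1) p.2))) (Ioo 0 T ×ˢ univ) :=
    (hφ.smooth.continuous.comp_continuousOn (continuousOn_fst.prodMk hz.continuousOn)).mul
      ((continuousOn_deriv_time_curve hz).inner
        (continuous_perp.comp_continuousOn (continuousOn_deriv_param_curve hz)))
  refine integrableOn_of_Icc (t₀ := t₀) (t₁ := t₁) ?_ fun t ht s => ?_
  · exact ((hwc.mono (prod_mono (Icc_subset_Ioo h0 h1) (subset_univ _))).integrableOn_compact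
      (isCompact_Icc.prod isCompact_Icc)).mono_set (prod_mono le_rfl Ioc_subset_Icc_self)
  · simp only [(IsTestFunction.eq_zero_of_notMem (hsupp t ht _)).1, zero_mul]

/-- On compact time intervals the front satisfies uniform arc-chord and Lipschitz bounds. -/
lemma exists_front_bounds
    (hz : ContDiffOn ℝ 1 (fun p : ℝ × ℝ => z p.1 p.2) (Ioo 0 T ×ˢ univ))
    (hb : ∀ t ∈ Ioo 0 T, Bounds (z t) (A t)) (hB1 : ∀ t ∈ Ioo 0 T, ∀ s, ‖deriv (z t) s‖ ≤ B)
    (hB2 : ∀ t ∈ Ioo 0 T, ∀ s, ‖deriv (deriv (z t)) s‖ ≤ B * ‖deriv (z t) s‖ ^ 2)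
    {J : Set ℝ} (hJ : IsCompact J) (hJT : J ⊆ Ioo 0 T) :
    ∃ c > 0, ∀ t ∈ J, (∀ s s', c * distInt (s - s') ≤ ‖z t s - z t s'‖) ∧
      ∀ s s', ‖deriv (z t) s' - deriv (z t) s‖ ≤ B ^ 3 * distInt (s - s') := by
  obtain ⟨c, hc, hac⟩ := exists_arc_chord hJ
    (hz.continuousOn.mono (prod_mono hJT le_rfl)) (fun t ht => hb t (hJT ht))
    (fun t ht => hB1 t (hJT ht)) (fun t ht => hB2 t (hJT ht))
  exact ⟨c, hc, fun t ht => ⟨hac t ht,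
    (hb t (hJT ht)).norm_deriv_sub_le_distInt (hB1 t (hJT ht)) (hB2 t (hJT ht))⟩⟩

/-- Measurability in `(t, s)` is that of a parameter integral of a jointly measurable function.
Boundedness comes from the arc-chord constant, which is uniform on the compact time support of the
test function. -/
lemma integrableOn_front (hα : α ∈ Ioo (0 : ℝ) 1) (hT : 0 < T)
    (hz : ContDiffOn ℝ 1 (fun p : ℝ × ℝ => z p.1 p.2) (Ioo 0 T ×ˢ univ))
    (hb : ∀ t ∈ Ioo 0 T, Bounds (z t) (A t)) (hB1 : ∀ t ∈ Ioo 0 T, ∀ s, ‖deriv (z t) s‖ ≤ B)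
    (hB2 : ∀ t ∈ Ioo 0 T, ∀ s, ‖deriv (deriv (z t)) s‖ ≤ B * ‖deriv (z t) s‖ ^ 2)
    (hφ : IsTestFunction T φ) :
    IntegrableOn (fun p : ℝ × ℝ => φ p.1 (z p.1 p.2) *
      inner ℝ (frontIntegral α (z p.1) p.2) (perp (deriv (z p.1) p.2)))
      (Ioo 0 T ×ˢ Ioc (-1 / 2) (1 / 2)) := by
  obtain ⟨t₀, t₁, h0, h01, h1, hsupp⟩ := hφ.exists_time_interval hT
  have hsub : Icc t₀ t₁ ⊆ Ioo 0 T := Icc_subset_Ioo h0 h1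
  obtain ⟨c, hc, hcb⟩ := exists_front_bounds hz hb hB1 hB2 isCompact_Icc hsub
  obtain ⟨P, hP⟩ := hφ.exists_bound
  refine integrableOn_of_Icc (t₀ := t₀) (t₁ := t₁) ?_ fun t ht s => ?_
  swap
  · simp only [(IsTestFunction.eq_zero_of_notMem (hsupp t ht _)).1, zero_mul]
  set S : Set (ℝ × ℝ) := Icc t₀ t₁ ×ˢ Ioc (-1 / 2) (1 / 2) with hS
  have hSm : MeasurableSet S := measurableSet_Icc.prod measurableSet_Ioc
  have hSsub : S ⊆ Ioo 0 T ×ˢ univ := prod_mono hsub (subset_univ _)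
  have hdc := continuousOn_deriv_param_curve hz
  have hmeas : AEStronglyMeasurable (fun p : ℝ × ℝ => frontIntegral α (z p.1) p.2)
      (volume.restrict S) := by
    have hS2 : MeasurableSet (S ×ˢ Ioc (-1 / 2 : ℝ) (1 / 2)) := hSm.prod measurableSet_Ioc
    have m1 : MapsTo (fun q : (ℝ × ℝ) × ℝ => q.1) (S ×ˢ Ioc (-1 / 2 : ℝ) (1 / 2))
        (Ioo 0 T ×ˢ univ) := fun q hq => hSsub hq.1
    have m2 : MapsTo (fun q : (ℝ × ℝ) × ℝ => (q.1.1, q.2)) (S ×ˢ Ioc (-1 / 2 : ℝ) (1 / 2))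
        (Ioo 0 T ×ˢ univ) := fun q hq => ⟨(hSsub hq.1).1, mem_univ _⟩
    have c1 := hz.continuousOn.comp (f := fun q : (ℝ × ℝ) × ℝ => q.1) (by fun_prop) m1
    have c2 := hz.continuousOn.comp (f := fun q : (ℝ × ℝ) × ℝ => (q.1.1, q.2)) (by fun_prop) m2
    have c3 := hdc.comp (f := fun q : (ℝ × ℝ) × ℝ => q.1) (by fun_prop) m1
    have c4 := hdc.comp (f := fun q : (ℝ × ℝ) × ℝ => (q.1.1, q.2)) (by fun_prop) m2
    have hm : AEStronglyMeasurable
        (fun q : (ℝ × ℝ) × ℝ => frontIntegrand α (z q.1.1) q.1.2 q.2)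
        ((volume.restrict S).prod (volume.restrict (Ioc (-1 / 2 : ℝ) (1 / 2)))) := by
      rw [Measure.prod_restrict]
      exact ((kernelK_measurable.comp_aemeasurable
        ((c1.sub c2).aemeasurable hS2)).aestronglyMeasurable).smul
        ((c4.sub c3).aestronglyMeasurable hS2)
    have := hm.integral_prod_right'
    refine this.congr (ae_of_all _ fun p => ?_)
    simp only [frontIntegral]
    rw [intervalIntegral.integral_of_le (by norm_num)]
  have hBpos : 0 < B := (hb t₀ (hsub ⟨le_rfl, h01.le⟩)).speed_pos_const
    (hB1 t₀ (hsub ⟨le_rfl, h01.le⟩))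
  set Q := c ^ (-1 - α) * B ^ 3 * ∫ u in (-1 / 2 : ℝ)..(1 / 2), distInt u ^ (-α) with hQ
  have : IsFiniteMeasure (volume.restrict S) :=
    isFiniteMeasure_restrict.2 (((isCompact_Icc.prod isCompact_Icc).measure_lt_top).trans_le'
      (measure_mono (prod_mono le_rfl Ioc_subset_Icc_self))).ne
  refine Integrable.of_bound (C := P * (Q * B)) ?_ ?_
  · refine AEStronglyMeasurable.mul ?_ (hmeas.inner ?_)
    · exact ((hφ.smooth.continuous.comp_continuousOn
        (continuousOn_fst.prodMk hz.continuousOn)).mono hSsub).aestronglyMeasurable hSm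
    · exact ((continuous_perp.comp_continuousOn hdc).mono hSsub).aestronglyMeasurable hSm
  · refine (ae_restrict_iff' hSm).2 (ae_of_all _ fun p hp => ?_)
    have htJ := hp.1
    have htT := hsub htJ
    rw [norm_mul, Real.norm_eq_abs]
    have h2 := norm_frontIntegral_le hα hc (hcb _ htJ).1 (hcb _ htJ).2 p.2
    have h3 := hP (p.1, z p.1 p.2)
    refine mul_le_mul h3 ((norm_inner_le_norm _ _).trans ?_) (norm_nonneg _)
      ((abs_nonneg _).trans h3)
    rw [norm_perp]
    exact mul_le_mul h2 (hB1 _ htT _) (norm_nonneg _) ((norm_nonneg _).trans h2)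

lemma continuous_gradient_slice (hφ : IsTestFunction T φ) :
    Continuous (fun p : ℝ × Plane => gradient (φ p.1) p.2) := by
  refine (InnerProductSpace.toDual ℝ Plane).symm.continuous.comp ?_
  have : Continuous fun p : ℝ × Plane => (fderiv ℝ (fun p : ℝ × Plane => φ p.1 p.2) p).comp
      (ContinuousLinearMap.inr ℝ ℝ Plane) :=
    hφ.contDiff_fderiv.continuous.clm_comp continuous_const
  exact this.congr fun p => (hφ.fderiv_slice p.1 p.2).symm

/-- The weak formulation as an identity between integrals over time. -/
lemma IsWeakSolution.iterated {θ : ℝ → Plane → ℝ} (hsol : IsWeakSolution α T θ)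
    (hφ : IsTestFunction T φ) :
    IntegrableOn (fun t => ∫ x, θ t x * deriv (fun τ => φ τ x) t) (Ioo 0 T) ∧
    IntegrableOn (fun t => ∫ x, θ t x * inner ℝ (velocity α (θ t) x) (gradient (φ t) x))
      (Ioo 0 T) ∧
    (∫ t in Ioo 0 T, ∫ x, θ t x * deriv (fun τ => φ τ x) t)
      + ∫ t in Ioo 0 T, ∫ x, θ t x * inner ℝ (velocity α (θ t) x) (gradient (φ t) x) = 0 := by
  obtain ⟨H, hH⟩ := hφ.exists_gradient_bounds
  have hμ : (volume : Measure (ℝ × Plane)).restrict (Ioo 0 T ×ˢ univ)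
      = (volume.restrict (Ioo 0 T)).prod volume := by
    rw [Measure.volume_eq_prod, ← Measure.prod_restrict, Measure.restrict_univ]
  -- The density is in $L^2$, and so are both factors that multiply it; by Hölder the two terms are
  -- integrable separately, and each may be iterated.
  have i1 : IntegrableOn (fun p : ℝ × Plane => θ p.1 p.2 * deriv (fun τ => φ τ p.2) p.1)
      (Ioo 0 T ×ˢ univ) := by
    have h1 : MemLp (fun p : ℝ × Plane => deriv (fun τ => φ τ p.2) p.1) 2
        (volume.restrict (Ioo 0 T ×ˢ univ)) := by
      simp only [hφ.deriv_time]
      exact (hφ.contDiff_time_deriv.continuous.memLp_of_hasCompactSupport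
        (hφ.compact.fderiv_apply ℝ (1, 0))).restrict _
    exact hsol.memLp.integrable_mul h1
  have i2 : IntegrableOn (fun p : ℝ × Plane => θ p.1 p.2 *
      inner ℝ (velocity α (θ p.1) p.2) (gradient (φ p.1) p.2)) (Ioo 0 T ×ˢ univ) := by
    have h1 : MemLp (fun p : ℝ × Plane =>
        inner ℝ (velocity α (θ p.1) p.2) (gradient (φ p.1) p.2)) 2
        (volume.restrict (Ioo 0 T ×ˢ univ)) := by
      refine hsol.memLp_velocity.of_le_mul (c := H)
        (hsol.memLp_velocity.aestronglyMeasurable.inner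
          (continuous_gradient_slice hφ).aestronglyMeasurable) (ae_of_all _ fun p => ?_)
      refine (norm_inner_le_norm _ _).trans ?_
      rw [mul_comm]
      exact mul_le_mul_of_nonneg_right ((hH p.1).1 p.2) (norm_nonneg _)
    exact hsol.memLp.integrable_mul h1
  have hw := hsol.weak φ hφ
  rw [integral_add i1 i2] at hw
  rw [IntegrableOn, hμ] at i1 i2
  rw [hμ, integral_prod _ i1, integral_prod _ i2] at hw
  exact ⟨i1.integral_prod_left, i2.integral_prod_left, hw⟩

/-- The weak sharp-front equation with an explicit error bound. -/
theorem abs_integral_frontDefect_le {M H C₁ r : ℝ} {θ : ℝ → Plane → ℝ} (hα : α ∈ Ioo (0 : ℝ) 1)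
    (hT : 0 < T) (hz : ContDiffOn ℝ 1 (fun p : ℝ × ℝ => z p.1 p.2) (Ioo 0 T ×ˢ univ))
    (hb : ∀ t ∈ Ioo 0 T, Bounds (z t) (A t)) (hB1 : ∀ t ∈ Ioo 0 T, ∀ s, ‖deriv (z t) s‖ ≤ B)
    (hB2 : ∀ t ∈ Ioo 0 T, ∀ s, ‖deriv (deriv (z t)) s‖ ≤ B * ‖deriv (z t) s‖ ^ 2)
    (hφ : IsTestFunction T φ) (hr : 0 < r) (hrB : r ≤ B) (hsol : IsWeakSolution α T θ)
    (hθ : ∀ t ∈ Ioo 0 T, ContDiff ℝ 1 (θ t)) (hM1 : 1 ≤ M)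
    (hM : ∀ t ∈ Ioo 0 T, ∀ x, |θ t x| ≤ M)
    (hin : ∀ t ∈ Ioo 0 T, ∀ x ∈ inRegion (A t) r, θ t x = 1)
    (hout : ∀ t ∈ Ioo 0 T, ∀ x ∈ outRegion (A t) r, θ t x = 0)
    (hH : ∀ t, (∀ x, ‖gradient (φ t) x‖ ≤ H) ∧
      ∀ x y, ‖gradient (φ t) x - gradient (φ t) y‖ ≤ H * ‖x - y‖)
    (hC₁ : ∀ t x, |deriv (fun τ => φ τ x) t| ≤ C₁) :
    |∫ p in Ioo (0 : ℝ) T ×ˢ Ioc (-1 / 2 : ℝ) (1 / 2),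
      φ p.1 (z p.1 p.2) * frontDefect α z p.1 p.2|
      ≤ (C₁ + 2 * M * ((1 + α) * H * ∫ x, majorant α x))
        * ((M + 1) * (8 * B * Real.pi * r)) * T := by
  have j1 := integrableOn_normal_velocity hT hz hφ
  have j2 := integrableOn_front hα hT hz hb hB1 hB2 hφ
  obtain ⟨k1, -, k3⟩ := integral_transport hT hz hb hφ
  obtain ⟨w1, w2, w3⟩ := hsol.iterated hφ
  have hIoc : ∀ f : ℝ → ℝ, ∫ s in Ioc (-1 / 2 : ℝ) (1 / 2), f s
      = ∫ s in (-1 / 2 : ℝ)..(1 / 2), f s := fun f =>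
    (intervalIntegral.integral_of_le (by norm_num)).symm
  have hR : IntegrableOn (fun t => ∫ s in (-1 / 2 : ℝ)..(1 / 2), φ t (z t s) *
      inner ℝ (frontIntegral α (z t) s) (perp (deriv (z t) s))) (Ioo 0 T) := by
    have j2' := j2
    rw [IntegrableOn, Measure.volume_eq_prod, ← Measure.prod_restrict] at j2'
    have := j2'.integral_prod_left
    simp only [hIoc] at this
    exact this
  have hD : ∫ p in Ioo (0 : ℝ) T ×ˢ Ioc (-1 / 2 : ℝ) (1 / 2),
      φ p.1 (z p.1 p.2) * frontDefect α z p.1 p.2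
      = (∫ t in Ioo 0 T, ∫ x in A t, deriv (fun τ => φ τ x) t)
        + ∫ t in Ioo 0 T, ∫ s in (-1 / 2 : ℝ)..(1 / 2), φ t (z t s) *
          inner ℝ (frontIntegral α (z t) s) (perp (deriv (z t) s)) := by
    simp only [frontDefect_eq, mul_add]
    rw [integral_add j1 j2, k3]
    congr 1
    · rw [Measure.volume_eq_prod, setIntegral_prod _ (by rwa [← Measure.volume_eq_prod])]
      simp only [hIoc]
    · rw [Measure.volume_eq_prod, setIntegral_prod _ (by rwa [← Measure.volume_eq_prod])]
      simp only [hIoc]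
  -- The weak formulation is zero and is subtracted under the time integral, so that each time slice
  -- compares the density with the indicator of the region.
  have hD2 : ∫ p in Ioo (0 : ℝ) T ×ˢ Ioc (-1 / 2 : ℝ) (1 / 2),
      φ p.1 (z p.1 p.2) * frontDefect α z p.1 p.2
      = ∫ t in Ioo 0 T, (((∫ x in A t, deriv (fun τ => φ τ x) t)
          - ∫ x, θ t x * deriv (fun τ => φ τ x) t)
        + ((∫ s in (-1 / 2 : ℝ)..(1 / 2), φ t (z t s) *
          inner ℝ (frontIntegral α (z t) s) (perp (deriv (z t) s)))
          - ∫ x, θ t x * inner ℝ (velocity α (θ t) x) (gradient (φ t) x))) := by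
    have i1 : IntegrableOn (fun t => (∫ x in A t, deriv (fun τ => φ τ x) t)
        - ∫ x, θ t x * deriv (fun τ => φ τ x) t) (Ioo 0 T) := k1.sub w1
    have i2 : IntegrableOn (fun t => (∫ s in (-1 / 2 : ℝ)..(1 / 2), φ t (z t s) *
        inner ℝ (frontIntegral α (z t) s) (perp (deriv (z t) s)))
        - ∫ x, θ t x * inner ℝ (velocity α (θ t) x) (gradient (φ t) x)) (Ioo 0 T) := hR.sub w2
    rw [integral_add i1 i2, integral_sub k1 w1, integral_sub hR w2, hD]
    linarith
  rw [hD2, ← Real.norm_eq_abs]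
  have hvol : volume.real (Ioo (0 : ℝ) T) = T := by
    rw [Real.volume_real_Ioo_of_le hT.le, sub_zero]
  have hmaj : 0 ≤ ∫ x, majorant α x := integral_nonneg majorant_nonneg
  have hH0 : 0 ≤ H := (norm_nonneg _).trans ((hH 0).1 0)
  have hC0 : 0 ≤ C₁ := (abs_nonneg _).trans (hC₁ 0 0)
  have := norm_setIntegral_le_of_norm_le_const (μ := volume) (s := Ioo (0 : ℝ) T)
    (C := (C₁ + 2 * M * ((1 + α) * H * ∫ x, majorant α x)) * ((M + 1) * (8 * B * Real.pi * r)))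
    measure_Ioo_lt_top (f := fun t => (((∫ x in A t, deriv (fun τ => φ τ x) t)
          - ∫ x, θ t x * deriv (fun τ => φ τ x) t)
        + ((∫ s in (-1 / 2 : ℝ)..(1 / 2), φ t (z t s) *
          inner ℝ (frontIntegral α (z t) s) (perp (deriv (z t) s)))
          - ∫ x, θ t x * inner ℝ (velocity α (θ t) x) (gradient (φ t) x)))) ?_
  · rwa [hvol] at this
  intro t ht
  have hbt := hb t ht
  have hcs := hasCompactSupport_of_transition hbt (hin t ht) (hout t ht)
  have hL1 := integral_abs_sub_indicator_le hbt (hB1 t ht) hr hrB (hM t ht) (hin t ht) (hout t ht)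
  -- An arc-chord constant for the single time `t` suffices, since the bound on the flux does not
  -- contain it.
  obtain ⟨c, hc, hcb⟩ := exists_front_bounds hz hb hB1 hB2 (isCompact_singleton (x := t))
    (singleton_subset_iff.2 ht)
  have hflux := abs_flux_sub_front_le hbt hα hc (hcb t rfl).1 (hcb t rfl).2 (hθ t ht) hcs hM1
    (hM t ht) (hφ.contDiff_slice t) (hH t).1 (hH t).2
  have hθi : Integrable (θ t) := (hθ t ht).continuous.integrable_of_hasCompactSupport hcs
  have hAi : Integrable ((A t).indicator (1 : Plane → ℝ)) :=
    (integrable_indicator_iff hbt.isOpen.measurableSet).2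
      (integrableOn_const hbt.volume_lt_top.ne)
  have hdc : Continuous fun x => deriv (fun τ => φ τ x) t := by
    simp only [hφ.deriv_time]
    exact hφ.contDiff_time_deriv.continuous.comp (by fun_prop)
  have hdiff : |(∫ x in A t, deriv (fun τ => φ τ x) t)
      - ∫ x, θ t x * deriv (fun τ => φ τ x) t| ≤ C₁ * ∫ x, |θ t x - (A t).indicator 1 x| := by
    have e1 : ∫ x in A t, deriv (fun τ => φ τ x) t
        = ∫ x, (A t).indicator 1 x * deriv (fun τ => φ τ x) t := by
      rw [← integral_indicator hbt.isOpen.measurableSet]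
      congr 1; ext x
      by_cases hx : x ∈ A t <;> simp [hx]
    have hbm : ∀ᵐ x : Plane, ‖deriv (fun τ => φ τ x) t‖ ≤ C₁ := ae_of_all _ fun x => hC₁ t x
    rw [e1, ← integral_sub (hAi.mul_bdd hdc.aestronglyMeasurable hbm)
      (hθi.mul_bdd hdc.aestronglyMeasurable hbm), ← integral_const_mul, ← Real.norm_eq_abs]
    refine norm_integral_le_of_norm_le ((hθi.sub hAi).abs.const_mul C₁) (ae_of_all _ fun x => ?_)
    rw [← sub_mul, norm_mul, Real.norm_eq_abs, Real.norm_eq_abs, abs_sub_comm, mul_comm]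
    exact mul_le_mul_of_nonneg_right (hC₁ t x) (abs_nonneg _)
  rw [Real.norm_eq_abs]
  refine (abs_add_le _ _).trans ?_
  rw [abs_sub_comm (∫ s in (-1 / 2 : ℝ)..(1 / 2), _)]
  refine (add_le_add hdiff hflux).trans ?_
  rw [← add_mul]
  refine mul_le_mul_of_nonneg_left hL1 ?_
  have := hα.1
  positivity

end MovingCurve

end AlmostSharpFront

/-! ### From the explicit bound to the asymptotic statement -/

theorem mainTheorem2 (α T : ℝ) (hα : α ∈ Ioo (0 : ℝ) 1) (hT : 0 < T)
    (θ : ℝ → ℝ → AlmostSharpFront.Plane → ℝ) (z : ℝ → ℝ → ℝ → AlmostSharpFront.Plane)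
    (hθ : AlmostSharpFront.IsAlmostSharpFront α T θ)
    (hz : AlmostSharpFront.IsCompatibleCurve T θ z) :
    (∀ᶠ δ : ℝ in 𝓝[>] 0, ∀ t ∈ Ioo 0 T, ∀ s : ℝ,
      IntervalIntegrable (AlmostSharpFront.frontIntegrand α (z δ t) s) volume (-1 / 2) (1 / 2)) ∧
    ∀ φ : ℝ → AlmostSharpFront.Plane → ℝ, AlmostSharpFront.IsTestFunction T φ →
      (∀ᶠ δ : ℝ in 𝓝[>] 0,
        IntegrableOn
          (fun p : ℝ × ℝ => φ p.1 (z δ p.1 p.2) * AlmostSharpFront.frontDefect α (z δ) p.1 p.2)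
          (Ioo 0 T ×ˢ Ioc (-1 / 2) (1 / 2))) ∧
      (fun δ : ℝ => ∫ p in Ioo (0 : ℝ) T ×ˢ Ioc (-1 / 2 : ℝ) (1 / 2),
          φ p.1 (z δ p.1 p.2) * AlmostSharpFront.frontDefect α (z δ) p.1 p.2)
        =O[𝓝[>] 0] (fun δ : ℝ => δ ^ (1 - α)) := by
  open AlmostSharpFront in
  obtain ⟨C, B, hev⟩ := hz
  obtain ⟨G, hG⟩ := hθ.growth
  refine ⟨?_, fun φ hφ => ⟨?_, ?_⟩⟩
  · filter_upwards [hev] with δ hδ t ht s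
    obtain ⟨Cz, -, -, A, hzc, hall⟩ := hδ
    obtain ⟨c, hc, hcb⟩ := exists_front_bounds hzc (fun t ht => (hall t ht).1)
      (fun t ht => (hall t ht).2.1) (fun t ht => (hall t ht).2.2.1) (isCompact_singleton (x := t))
      (singleton_subset_iff.2 ht)
    exact intervalIntegrable_frontIntegrand (hall t ht).1 hα hc (hcb t rfl).1 (hcb t rfl).2 s
  · filter_upwards [hev] with δ hδ
    obtain ⟨Cz, -, -, A, hzc, hall⟩ := hδ
    simp only [frontDefect_eq, mul_add]
    exact (integrableOn_normal_velocity hT hzc hφ).add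
      (integrableOn_front hα hT hzc (fun t ht => (hall t ht).1)
        (fun t ht => (hall t ht).2.1) (fun t ht => (hall t ht).2.2.1) hφ)
  · obtain ⟨H, hH⟩ := hφ.exists_gradient_bounds
    obtain ⟨C₁, hC₁⟩ := (hφ.compact.fderiv_apply ℝ (1, 0)).exists_bound_of_continuous
      hφ.contDiff_time_deriv.continuous
    -- Positivity of both constants is read off from one admissible `δ` at time `T / 2`.
    have hCB : 0 < C ∧ 0 < B := by
      obtain ⟨δ, Cz, h0, h1, A, -, hall⟩ := hev.exists
      have hm : T / 2 ∈ Ioo 0 T := ⟨by linarith, by linarith⟩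
      exact ⟨h0.trans h1, (hall _ hm).1.speed_pos_const (hall _ hm).2.1⟩
    obtain ⟨hC, hB⟩ := hCB
    have hE : 0 ≤ exitFactor B := by rw [exitFactor]; positivity
    -- Independent of `δ`: the factor `1 / δ` of the gradient bound cancels the factor `δ` of the
    -- half-width.
    set M := 1 + |G| * (exitFactor B * C) with hM
    have hM1 : 1 ≤ M := le_add_of_nonneg_right (by positivity)
    have hH0 : 0 ≤ H := (norm_nonneg _).trans ((hH 0).1 0)
    have hC₁0 : 0 ≤ C₁ := (norm_nonneg _).trans (hC₁ 0)
    have hmaj : 0 ≤ ∫ x, majorant α x := integral_nonneg majorant_nonneg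
    have hα0 := hα.1
    set Q := C₁ + 2 * M * ((1 + α) * H * ∫ x, majorant α x) with hQ
    have hQ0 : 0 ≤ Q := by positivity
    -- `δ < B / C` keeps the half-width below `B`, as the area bounds require; `δ < 1` serves to
    -- compare powers of `δ`.
    have hsmall : ∀ᶠ δ : ℝ in 𝓝[>] 0, δ < min 1 (B / C) :=
      nhdsWithin_le_nhds (Iio_mem_nhds (by positivity))
    refine Asymptotics.IsBigO.of_bound (Q * ((M + 1) * (8 * B * Real.pi * C)) * T) ?_
    filter_upwards [hev, hG, hθ.solution, hθ.contDiff, hsmall, self_mem_nhdsWithin]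
      with δ hδ hGδ hsol hcd hs (hδ0 : 0 < δ)
    obtain ⟨Cz, hCz, hCzC, A, hzc, hall⟩ := hδ
    obtain ⟨hs1, hs2⟩ := lt_min_iff.1 hs
    rw [lt_div_iff₀ hC] at hs2
    have hle : Cz * δ ≤ C * δ := mul_le_mul_of_nonneg_right hCzC.le hδ0.le
    have hrB : Cz * δ ≤ B := hle.trans (by linarith)
    have hr : 0 < Cz * δ := mul_pos hCz hδ0
    have hcd1 : ∀ t ∈ Ioo 0 T, ContDiff ℝ 1 (θ δ t) := fun t ht =>
      (hcd t ht).of_le (by norm_num)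
    have hsup : ∀ t ∈ Ioo 0 T, ∀ x, |θ δ t x| ≤ M := fun t ht x => by
      refine (abs_le_of_transition (hall t ht).1 (hall t ht).2.1 (hall t ht).2.2.1 hr hrB
        (hcd1 t ht) (hGδ t ht) (hall t ht).2.2.2.1 (hall t ht).2.2.2.2 x).trans ?_
      have e : G / δ * (exitFactor B * (Cz * δ)) = G * (exitFactor B * Cz) := by
        field_simp
      rw [e, hM]
      gcongr
      exact le_abs_self G
    have key := abs_integral_frontDefect_le hα hT hzc (fun t ht => (hall t ht).1)
      (fun t ht => (hall t ht).2.1) (fun t ht => (hall t ht).2.2.1) hφ hr hrB hsol hcd1 hM1 hsup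
      (fun t ht => (hall t ht).2.2.2.1) (fun t ht => (hall t ht).2.2.2.2) hH
      (fun t x => by rw [hφ.deriv_time]; exact hC₁ (t, x))
    -- The explicit bound is linear in `δ`; only here is it weakened to the stated rate.
    have hpow : δ ≤ δ ^ (1 - α) := by
      simpa using Real.rpow_le_rpow_of_exponent_ge hδ0 hs1.le (by linarith : 1 - α ≤ 1)
    rw [Real.norm_eq_abs, Real.norm_of_nonneg (by positivity)]
    calc _ ≤ _ := key
      _ ≤ Q * ((M + 1) * (8 * B * Real.pi * (C * δ))) * T := by gcongr
      _ = Q * ((M + 1) * (8 * B * Real.pi * C)) * T * δ := by ring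
      _ ≤ _ := by gcongr
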